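/- Let $n\ge 2$. Write points of the open upper half space $\mathbb R^n_+$ as $x=(x',x_n)$ with $x'\in\mathbb R^{n-1}$, $x_n>0$, identify $\partial\mathbb R^n_+$ with $\mathbb R^{n-1}$, and put $$P_\lambda(x,y,\mu)=\frac{x_n^{\lambda}}{\left(|x'-y|^2+x_n^2\right)^{\mu/2}},\qquad x\in\mathbb R^n_+,\ y\in\partial\mathbb R^n_+ .$$ Let $0<\alpha,\beta<n$, $\lambda\ge 0$, $0<\mu<n-2\lambda$, $0<p_0,q_0<\infty$ satisfy $$\frac{n-1}{n}\,\frac1{p_0+1}+\frac1{q_0+1}=\frac{\alpha+\beta+\mu-\lambda}{n}.$$ Let $u:\partial\mathbb R^n_+\to(0,\infty]$ and $v:\mathbb R^n_+\to(0,\infty]$ with $u\in L^{p_0+1}(\partial\mathbb R^n_+)$, $v\in L^{q_0+1}(\mathbb R^n_+)$ solve, pointwise (with $|y|^{-\alpha}=\infty$ at $y=0$), $$u(y)=\int_{\mathbb R^n_+}|x|^{-\beta}P_\lambda(x,y,\mu)\,v^{q_0}(x)\,|y|^{-\alpha}\,dx\quad(y\in\partial\mathbb R^n_+),$$ $$v(x)=\int_{\partial\mathbb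 R^n_+}|y|^{-\alpha}P_\lambda(x,y,\mu)\,u^{p_0}(y)\,|x|^{-\beta}\,dy\quad(x\in\mathbb R^n_+).$$ Then there is a point $y_0\in\partial\mathbb R^n_+$ such that: 1. $u$ is radially symmetric and strictly decreasing about $y_0$: $u(y)$ depends only on $|y-y_0|$, and $u(z)<u(y)$ whenever $|y-y_0|<|z-y_0|$. 2. For every $t>0$ the function $v(\cdot,t)$ on $\mathbb R^{n-1}$ is radially symmetric and strictly decreasing about $y_0$. 3. The restriction of $v$ to $\partial\mathbb R^n_+$ is radially symmetric and decreasing about $y_0$. Here the boundary values are taken as $\liminf_{t\to0^+}v(y,t)$, and also as $\limsup_{t\to0^+}v(y,t)$ (so they are the limit, where it exists); for both functions $w$, $w(y)$ depends only on $|y-y_0|$, and if $|y-y_0|<|z-y_0|$ then $w(z)\le w(y)$, with strict inequality if $0<w(z)<\infty$. -/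

import Mathlib

open MeasureTheory Filter Topology
open scoped ENNReal

noncomputable section

/-- The boundary of the upper half space of dimension `n`, identified with Euclidean space of
dimension `n - 1`. -/
abbrev Bdry (n : ℕ) : Type := EuclideanSpace ℝ (Fin (n - 1))

/-- The points `x = (x', x_n)`. The type is only used for its coordinates and for the Lebesgue
(product) measure; the Euclidean length is `euclLength` below, not the norm of the product. -/
abbrev Pt (n : ℕ) : Type := Bdry n × ℝ

/-- The open upper half space `x_n > 0`. -/
def upperHalf (n : ℕ) : Set (Pt n) := {x | 0 < x.2}

/-- The Euclidean length `|x| = (|x'|² + x_n²)^{1/2}`. -/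
def euclLength {n : ℕ} (x : Pt n) : ℝ := Real.sqrt (‖x.1‖ ^ 2 + x.2 ^ 2)

/-- `P_lam(x, y, mu) = x_n^lam / (|x' - y|² + x_n²)^{mu / 2}`. -/
def kerP {n : ℕ} (lam mu : ℝ) (x : Pt n) (y : Bdry n) : ℝ :=
  x.2 ^ lam / (‖x.1 - y‖ ^ 2 + x.2 ^ 2) ^ (mu / 2)

/-- The doubly weighted kernel `|y|^{-a} P_lam(x, y, mu) |x|^{-b}`, with values in `[0, ∞]`;
for `a > 0` the weight `|y|^{-a}` is `∞` at `y = 0`. -/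
def weightedKer {n : ℕ} (a b lam mu : ℝ) (x : Pt n) (y : Bdry n) : ℝ≥0∞ :=
  ENNReal.ofReal ‖y‖ ^ (-a) * ENNReal.ofReal (kerP lam mu x y)
    * ENNReal.ofReal (euclLength x) ^ (-b)

/-- `(u, v)` is a pair of positive `[0, ∞]`-valued solutions of the doubly weighted integral
system. Only the values of `v` on the open upper half space matter. -/
structure IsPositiveSolution (n : ℕ) (a b lam mu p q : ℝ)
    (u : Bdry n → ℝ≥0∞) (v : Pt n → ℝ≥0∞) : Prop where
  u_pos : ∀ y, 0 < u y
  v_pos : ∀ x ∈ upperHalf n, 0 < v x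
  u_eq : ∀ y, u y = ∫⁻ x in upperHalf n, weightedKer a b lam mu x y * v x ^ q
  v_eq : ∀ x ∈ upperHalf n, v x = ∫⁻ y, weightedKer a b lam mu x y * u y ^ p

/-- `w(y)` depends only on `|y - c|`. -/
def RadialAbout {n : ℕ} (c : Bdry n) (w : Bdry n → ℝ≥0∞) : Prop :=
  ∀ y z, ‖y - c‖ = ‖z - c‖ → w y = w z

/-- `w(y)` is strictly decreasing in `|y - c|`. -/
def DecreasingAbout {n : ℕ} (c : Bdry n) (w : Bdry n → ℝ≥0∞) : Prop :=
  ∀ y z, ‖y - c‖ < ‖z - c‖ → w z < w y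

/-- `w(y)` is nonincreasing in `|y - c|`, and strictly decreasing as long as its values are
neither `0` nor `∞`. Boundary values need this form, since the factor `x_n^lam` can make them
vanish identically. -/
def WeaklyDecreasingAbout {n : ℕ} (c : Bdry n) (w : Bdry n → ℝ≥0∞) : Prop :=
  ∀ y z, ‖y - c‖ < ‖z - c‖ → w z ≤ w y ∧ (w z ≠ 0 → w z ≠ ∞ → w z < w y)

/-- The slice `v(·, t)` of `v` at height `t`. -/
def slice {n : ℕ} (v : Pt n → ℝ≥0∞) (t : ℝ) : Bdry n → ℝ≥0∞ := fun y => v (y, t)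

/-- The lower boundary values of `v`: the lower limit of `v(y, t)` as `t` decreases to `0`. -/
def lowerTrace {n : ℕ} (v : Pt n → ℝ≥0∞) : Bdry n → ℝ≥0∞ :=
  fun y => liminf (fun t : ℝ => v (y, t)) (𝓝[>] 0)

/-- The upper boundary values of `v`: the upper limit of `v(y, t)` as `t` decreases to `0`.
Where the limit exists, it is the common value of `lowerTrace v` and `upperTrace v`. -/
def upperTrace {n : ℕ} (v : Pt n → ℝ≥0∞) : Bdry n → ℝ≥0∞ :=
  fun y => limsup (fun t : ℝ => v (y, t)) (𝓝[>] 0)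

end

/-! ### Sub-Markovian kernels and vanishing of nonlinear two-step cycles -/

section MarkovKernel

variable {X Y : Type*} [MeasurableSpace X] [MeasurableSpace Y]

/-! The weights `|y|^{-α}` and `|x|^{-β}` single out the origin, and the common centre is the
origin. The method is moving planes in integral form. For a unit vector `e` and `h > 0`, let `R` be
the reflection in `⟨y, e⟩ = h`. The claim is `u ≤ u ∘ R` almost everywhere beyond the plane, for
every such plane. Any two boundary points of different norm are exchanged by one of these
reflections, so the claim makes `u` and the slices of `v` nonincreasing in the norm. Strictness
comes from the weights, which are strictly larger at the reflected point.

Folding the equations along the plane bounds the positive parts of `u - u ∘ R` and `v - v ∘ R` by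
integrals of each other with the antisymmetrised kernel `D` (`diffKer`), which lies below the full
kernel. With relative deficits `A = (u - u ∘ R)⁺ / u` and `B = (v - v ∘ R)⁺ / v` and measures `u ^
(p + 1) dy`, `v ^ (q + 1) dx` beyond the plane, the kernel `D / (u v)` is sub-Markovian in both
variables, because `u` and `v` solve the system, and strictly so in one of them. The inequalities
become `A ≤ T (1 - (1 - B) ^ q)` and `B ≤ T* (1 - (1 - A) ^ p)`. If `p q ≤ 1`, Jensen's inequality
and strictness force `A = 0` with no further estimate. If `p q > 1`, a doubly weighted
Hardy-Littlewood-Sobolev inequality makes the cycle contractive once `A` is supported on a set of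
small measure. Both cases are joined in `exists_pos_ae_eq_zero_of_system`;
`IsPositiveSolution.exists_pos_forall_le_reflect` transfers them to the solution, with a threshold
that does not depend on the plane.

The admissible `h` therefore form a nonempty, relatively closed and open subset of `(0, ∞)`
(`IsPositiveSolution.ae_le_bdryReflect`). The Hardy-Littlewood-Sobolev inequality follows from a
Schur test with power kernels; its conditions `α < (n - 1) / (p + 1) < α + μ` are forced by the
integrability of `u`, since a positive solution is bounded below by multiples of `|y|^{-α}` near the
origin and of `|y|^{-α-μ}` near infinity.

Radial symmetry does not come from planes through the origin: monotonicity in the norm, a dilation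
argument and integrability give invariance of `u` under rotations almost everywhere, which the
equations upgrade to every point. -/

theorem lintegral_kernel_mul_swap {m : Measure Y} {ν : Measure X} [SFinite m] [SFinite ν]
    {κ : X → Y → ℝ≥0∞} (hκ : Measurable (Function.uncurry κ)) {f : Y → ℝ≥0∞} {g : X → ℝ≥0∞}
    (hf : Measurable f) (hg : Measurable g) :
    ∫⁻ y, f y * ∫⁻ x, κ x y * g x ∂ν ∂m = ∫⁻ x, g x * ∫⁻ y, κ x y * f y ∂m ∂ν := by
  have hκ1 : ∀ x, Measurable (κ x) := fun x => hκ.of_uncurry_left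
  have hκ2 : ∀ y, Measurable fun x => κ x y := fun y => hκ.of_uncurry_right
  calc ∫⁻ y, f y * ∫⁻ x, κ x y * g x ∂ν ∂m
      = ∫⁻ y, ∫⁻ x, f y * (κ x y * g x) ∂ν ∂m := by
        refine lintegral_congr fun y => ?_
        rw [lintegral_const_mul]
        exact (hκ2 y).mul hg
    _ = ∫⁻ x, ∫⁻ y, f y * (κ x y * g x) ∂m ∂ν := by
        rw [lintegral_lintegral_swap]
        refine Measurable.aemeasurable ?_
        exact (hf.comp measurable_fst).mul
          ((hκ.comp measurable_swap).mul (hg.comp measurable_snd))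
    _ = _ := by
        refine lintegral_congr fun x => ?_
        rw [← lintegral_const_mul]
        · exact lintegral_congr fun y => by ring
        · exact (hκ1 x).mul hf

/-- For a strictly sub-Markovian kernel a cycle `f ≤ T g`, `g ≤ T* f` is trivial. -/
theorem ae_eq_zero_of_le_kernel_cycle {m : Measure Y} {ν : Measure X} [IsFiniteMeasure m]
    [SFinite ν] {κ : X → Y → ℝ≥0∞} (hκ : Measurable (Function.uncurry κ))
    {f : Y → ℝ≥0∞} {g : X → ℝ≥0∞} (hf : Measurable f) (hg : Measurable g) (hf1 : ∀ y, f y ≤ 1)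
    (hfg : ∀ᵐ y ∂m, f y ≤ ∫⁻ x, κ x y * g x ∂ν)
    (hgf : ∀ᵐ x ∂ν, g x ≤ ∫⁻ y, κ x y * f y ∂m)
    (h1 : ∀ᵐ y ∂m, ∫⁻ x, κ x y ∂ν < 1) (h2 : ∀ᵐ x ∂ν, ∫⁻ y, κ x y ∂m ≤ 1) :
    ∀ᵐ y ∂m, f y = 0 := by
  have hk : Measurable fun y => ∫⁻ x, κ x y ∂ν := hκ.lintegral_prod_left'
  -- Duality: `∫ f ≤ ∫ T g = ∫ g · T*1 ≤ ∫ g ≤ ∫ T* f = ∫ f · T1`. Since `T1 < 1` and `∫ f` is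
  -- finite, `f` must vanish.
  have key : ∫⁻ y, f y ∂m ≤ ∫⁻ y, f y * ∫⁻ x, κ x y ∂ν ∂m := by
    calc ∫⁻ y, f y ∂m ≤ ∫⁻ y, 1 * ∫⁻ x, κ x y * g x ∂ν ∂m := by
          refine lintegral_mono_ae ?_
          simpa using hfg
      _ = ∫⁻ x, g x * ∫⁻ y, κ x y * 1 ∂m ∂ν :=
          lintegral_kernel_mul_swap hκ measurable_const hg
      _ ≤ ∫⁻ x, 1 * ∫⁻ y, κ x y * f y ∂m ∂ν := by
          refine lintegral_mono_ae ?_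
          filter_upwards [hgf, h2] with x hx1 hx2
          simp only [mul_one, one_mul]
          calc _ ≤ g x * 1 := by gcongr
            _ ≤ _ := by simpa using hx1
      _ = ∫⁻ y, f y * ∫⁻ x, κ x y * 1 ∂ν ∂m :=
          (lintegral_kernel_mul_swap hκ hf measurable_const).symm
      _ = _ := by simp
  have hfin : ∫⁻ y, f y ∂m ≠ ∞ := by
    refine ne_of_lt (lt_of_le_of_lt (lintegral_mono hf1) ?_)
    simp
  have hle : (fun y => f y * ∫⁻ x, κ x y ∂ν) ≤ᵐ[m] f := by
    filter_upwards [h1] with y hy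
    calc _ ≤ f y * 1 := by gcongr
      _ = _ := mul_one _
  have heq := ae_eq_of_ae_le_of_lintegral_le hle
    (ne_top_of_le_ne_top hfin (lintegral_mono_ae hle)) hf.aemeasurable key
  filter_upwards [heq, h1] with y hy hy1
  by_contra h0
  have : f y * ∫⁻ x, κ x y ∂ν < f y * 1 :=
    ENNReal.mul_lt_mul_right h0 ((hf1 y).trans_lt ENNReal.one_lt_top).ne hy1
  rw [mul_one] at this
  exact absurd hy this.ne

theorem Real.rpow_tangent_le {P s w : ℝ} (hP : 1 ≤ P) (hs : 0 ≤ s) (hw : 0 ≤ w) :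
    w ^ P + P * w ^ (P - 1) * (s - w) ≤ s ^ P := by
  rcases hw.eq_or_lt with rfl | hw
  · rcases hP.eq_or_lt with rfl | hP
    · simp
    · rw [Real.zero_rpow (by linarith), Real.zero_rpow (by linarith)]
      simpa using Real.rpow_nonneg hs P
  · have h := one_add_mul_self_le_rpow_one_add (s := s / w - 1) (by
      have := div_nonneg hs hw.le
      linarith) hP
    have h2 : (1 + (s / w - 1)) ^ P = s ^ P / w ^ P := by
      rw [add_sub_cancel, Real.div_rpow hs hw.le]
    rw [h2, le_div_iff₀ (by positivity)] at h
    refine le_trans (le_of_eq ?_) h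
    rw [Real.rpow_sub_one hw.ne']
    field_simp

/-- Jensen's inequality for the concave function `1 - (1 - a) ^ P` and a measure of mass at
most one. -/
theorem lintegral_one_sub_one_sub_rpow_le {m : Measure Y} (hm : m Set.univ ≤ 1)
    {a : Y → ℝ≥0∞} (ha : Measurable a) (ha1 : ∀ y, a y ≤ 1) {P : ℝ} (hP : 1 ≤ P) :
    ∫⁻ y, (1 - (1 - a y) ^ P) ∂m ≤ 1 - (1 - ∫⁻ y, a y ∂m) ^ P := by
  have hz1 : ∫⁻ y, a y ∂m ≤ 1 := by
    calc _ ≤ ∫⁻ _, 1 ∂m := lintegral_mono ha1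
      _ ≤ 1 := by simpa using hm
  obtain ⟨z, hz⟩ : ∃ z : ℝ, z = (∫⁻ y, a y ∂m).toReal := ⟨_, rfl⟩
  have hzt : ∫⁻ y, a y ∂m ≠ ∞ := (hz1.trans_lt ENNReal.one_lt_top).ne
  have hz' : ∫⁻ y, a y ∂m = ENNReal.ofReal z := by rw [hz, ENNReal.ofReal_toReal hzt]
  have hz0 : 0 ≤ z := hz ▸ ENNReal.toReal_nonneg
  have hzle : z ≤ 1 := by rw [hz]; exact ENNReal.toReal_le_of_le_ofReal zero_le_one (by simpa)
  set w := 1 - z with hw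
  have hw0 : 0 ≤ w := by linarith
  set c1 : ℝ := P * w ^ (P - 1) with hc1
  have hc1' : 0 ≤ c1 := by positivity
  -- `c0 + c1 t` is the tangent at `t = z`. Its value at `0` is nonnegative because the concave
  -- function vanishes there; this is what allows total mass below one.
  set c0 : ℝ := 1 - w ^ P - c1 * z with hc0
  have hc0' : 0 ≤ c0 := by
    have := Real.rpow_tangent_le hP zero_le_one hw0
    rw [Real.one_rpow, show (1 : ℝ) - w = z by rw [hw]; ring] at this
    linarith
  have conv : ∀ t : ℝ, 0 ≤ t → t ≤ 1 →
      1 - (1 - ENNReal.ofReal t) ^ P = ENNReal.ofReal (1 - (1 - t) ^ P) := by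
    intro t ht0 ht1
    rw [ENNReal.ofReal_sub _ (Real.rpow_nonneg (by linarith) _), ENNReal.ofReal_one,
      ← ENNReal.ofReal_rpow_of_nonneg (by linarith) (by linarith), ENNReal.ofReal_sub _ ht0,
      ENNReal.ofReal_one]
  have pt : ∀ y, 1 - (1 - a y) ^ P ≤ ENNReal.ofReal c0 + ENNReal.ofReal c1 * a y := by
    intro y
    have hay : a y ≠ ∞ := ((ha1 y).trans_lt ENNReal.one_lt_top).ne
    obtain ⟨t, ht⟩ : ∃ t : ℝ, t = (a y).toReal := ⟨_, rfl⟩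
    have ht0 : 0 ≤ t := ht ▸ ENNReal.toReal_nonneg
    have ht1 : t ≤ 1 := by
      rw [ht]; exact ENNReal.toReal_le_of_le_ofReal zero_le_one (by simpa using ha1 y)
    rw [show a y = ENNReal.ofReal t by rw [ht, ENNReal.ofReal_toReal hay], conv t ht0 ht1,
      ← ENNReal.ofReal_mul hc1', ← ENNReal.ofReal_add hc0' (by positivity)]
    refine ENNReal.ofReal_le_ofReal ?_
    have := Real.rpow_tangent_le hP (s := 1 - t) (by linarith) hw0
    rw [show (1 - t - w) = z - t by rw [hw]; ring] at this
    rw [hc0]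
    linarith
  calc ∫⁻ y, (1 - (1 - a y) ^ P) ∂m
      ≤ ∫⁻ y, (ENNReal.ofReal c0 + ENNReal.ofReal c1 * a y) ∂m := lintegral_mono pt
    _ = ENNReal.ofReal c0 * m Set.univ + ENNReal.ofReal c1 * ∫⁻ y, a y ∂m := by
        rw [lintegral_add_left measurable_const, lintegral_const, lintegral_const_mul _ ha]
    _ ≤ ENNReal.ofReal c0 * 1 + ENNReal.ofReal c1 * ENNReal.ofReal z := by
        rw [hz']; gcongr
    _ = 1 - (1 - ∫⁻ y, a y ∂m) ^ P := by
        rw [hz', conv z hz0 hzle, mul_one, ← ENNReal.ofReal_mul hc1',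
          ← ENNReal.ofReal_add hc0' (by positivity), hc0]
        congr 1
        ring

theorem ENNReal.one_sub_one_sub_rpow_mono {a : ℝ≥0∞} {p P : ℝ} (h : p ≤ P) :
    1 - (1 - a) ^ p ≤ 1 - (1 - a) ^ P := by
  refine tsub_le_tsub_left ?_ 1
  exact ENNReal.rpow_le_rpow_of_exponent_ge tsub_le_self h

theorem lintegral_kernel_eq_withDensity {m : Measure Y} {k f : Y → ℝ≥0∞} (hk : Measurable k)
    (hf : Measurable f) : ∫⁻ y, f y ∂(m.withDensity k) = ∫⁻ y, k y * f y ∂m := by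
  rw [lintegral_withDensity_eq_lintegral_mul _ hk hf]
  rfl

/-- If `b ≤ T (1 - (1 - a) ^ p)` with `T` sub-Markovian and `q ≤ 1`, `p q ≤ 1`, then
`1 - (1 - b) ^ q ≤ T a`. -/
theorem one_sub_rpow_le_lintegral_of_le {m : Measure Y} {k : Y → ℝ≥0∞} (hk : Measurable k)
    (hk1 : ∫⁻ y, k y ∂m ≤ 1) {a : Y → ℝ≥0∞} (ha : Measurable a) (ha1 : ∀ y, a y ≤ 1)
    {b : ℝ≥0∞} {p q : ℝ} (hq0 : 0 < q) (hq : q ≤ 1) (hpq : p * q ≤ 1)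
    (hb : b ≤ ∫⁻ y, k y * (1 - (1 - a y) ^ p) ∂m) :
    1 - (1 - b) ^ q ≤ ∫⁻ y, k y * a y ∂m := by
  -- Raising the exponent to at least `1` gives concavity, and `P q ≤ 1` still holds because `q ≤
  -- 1`.
  set P := max p 1
  have hP : 1 ≤ P := le_max_right _ _
  have hPq : P * q ≤ 1 := by
    rcases max_choice p 1 with h | h
    · rwa [show P = p from h]
    · rw [show P = 1 from h]; linarith
  have hmeas : Measurable fun y => 1 - (1 - a y) ^ P := by fun_prop
  have h1 : b ≤ 1 - (1 - ∫⁻ y, k y * a y ∂m) ^ P := by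
    rw [← lintegral_kernel_eq_withDensity hk ha]
    refine hb.trans (le_trans ?_ (lintegral_one_sub_one_sub_rpow_le (m := m.withDensity k)
      ?_ ha ha1 hP))
    · rw [lintegral_kernel_eq_withDensity hk hmeas]
      refine lintegral_mono fun y => ?_
      exact mul_le_mul' le_rfl (ENNReal.one_sub_one_sub_rpow_mono (le_max_left _ _))
    · simpa using hk1
  set z := ∫⁻ y, k y * a y ∂m
  have h2 : (1 - z) ^ P ≤ 1 - b := by
    have hle1 : (1 - z) ^ P ≤ 1 := ENNReal.rpow_le_one tsub_le_self (by linarith)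
    calc (1 - z) ^ P = 1 - (1 - (1 - z) ^ P) := (ENNReal.sub_sub_cancel ENNReal.one_ne_top hle1).symm
      _ ≤ 1 - b := tsub_le_tsub_left h1 1
  have h3 : 1 - z ≤ (1 - b) ^ q := by
    calc 1 - z = (1 - z) ^ (1 : ℝ) := by simp
      _ ≤ (1 - z) ^ (P * q) := ENNReal.rpow_le_rpow_of_exponent_ge tsub_le_self hPq
      _ = ((1 - z) ^ P) ^ q := ENNReal.rpow_mul _ _ _
      _ ≤ _ := by gcongr
  calc 1 - (1 - b) ^ q ≤ 1 - (1 - z) := tsub_le_tsub_left h3 1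
    _ ≤ z := by
      rw [tsub_le_iff_right]
      exact le_add_tsub

/-- The sublinear case `p q ≤ 1`. -/
theorem ae_eq_zero_of_sublinear_system {m : Measure Y} {ν : Measure X} [IsFiniteMeasure m]
    [SFinite ν] {κ : X → Y → ℝ≥0∞} (hκ : Measurable (Function.uncurry κ))
    {a : Y → ℝ≥0∞} {b : X → ℝ≥0∞} (ha : Measurable a) (hb : Measurable b)
    (ha1 : ∀ y, a y ≤ 1) (hb1 : ∀ x, b x ≤ 1) {p q : ℝ} (hp : 0 < p) (hq : 0 < q)
    (hpq : p * q ≤ 1)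
    (hab : ∀ᵐ y ∂m, a y ≤ ∫⁻ x, κ x y * (1 - (1 - b x) ^ q) ∂ν)
    (hba : ∀ᵐ x ∂ν, b x ≤ ∫⁻ y, κ x y * (1 - (1 - a y) ^ p) ∂m)
    (h1 : ∀ᵐ y ∂m, ∫⁻ x, κ x y ∂ν < 1) (h2 : ∀ᵐ x ∂ν, ∫⁻ y, κ x y ∂m ≤ 1) :
    ∀ᵐ y ∂m, a y = 0 := by
  have hκ1 : ∀ x, Measurable (κ x) := fun x => hκ.of_uncurry_left
  have hκ2 : ∀ y, Measurable fun x => κ x y := fun y => hκ.of_uncurry_right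
  -- At least one of `p`, `q` is at most `1`, and the power with that exponent is absorbed by
  -- Jensen. The linear cycle is `(a, 1 - (1 - b) ^ q)` in the first case and `(1 - (1 - a) ^ p, b)`
  -- in the second.
  rcases le_total q 1 with hq1 | hq1
  · refine ae_eq_zero_of_le_kernel_cycle hκ ha (g := fun x => 1 - (1 - b x) ^ q) (by fun_prop)
      ha1 hab ?_ h1 h2
    filter_upwards [hba, h2] with x hx hx2
    exact one_sub_rpow_le_lintegral_of_le (hκ1 x) hx2 ha ha1 hq hq1 hpq hx
  · have hp1 : p ≤ 1 := by nlinarith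
    have h0 := ae_eq_zero_of_le_kernel_cycle hκ (f := fun y => 1 - (1 - a y) ^ p) (by fun_prop)
      hb (fun y => tsub_le_self) ?_ hba h1 h2
    · filter_upwards [h0] with y hy
      have h3 : 1 ≤ (1 - a y) ^ p := tsub_eq_zero_iff_le.1 hy
      have h4 : 1 ≤ 1 - a y := by
        by_contra h
        push Not at h
        exact absurd h3 (not_le.2 (ENNReal.rpow_lt_one h hp))
      by_contra hne
      exact absurd h4 (not_le.2 (ENNReal.sub_lt_self ENNReal.one_ne_top one_ne_zero hne))
    · filter_upwards [hab, h1] with y hy hy1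
      exact one_sub_rpow_le_lintegral_of_le (hκ2 y) hy1.le hb hb1 hp hp1
        (by rwa [mul_comm]) hy

/-- For exponent `max q 1` the left side is concave in `b`, hence below its tangent at `0`. It
linearises the cycle in the superlinear case. -/
theorem ENNReal.one_sub_one_sub_rpow_le {b : ℝ≥0∞} (hb : b ≤ 1) {q : ℝ} (hq : 0 < q) :
    1 - (1 - b) ^ q ≤ ENNReal.ofReal (max q 1) * b := by
  refine (ENNReal.one_sub_one_sub_rpow_mono (le_max_left q 1)).trans ?_
  set Q := max q 1
  have hQ : 1 ≤ Q := le_max_right _ _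
  have hbt : b ≠ ∞ := (hb.trans_lt ENNReal.one_lt_top).ne
  lift b to NNReal using hbt
  have hb' : (b : ℝ) ≤ 1 := by exact_mod_cast hb
  have h := Real.rpow_tangent_le hQ (s := 1 - b) (w := 1) (by linarith) zero_le_one
  simp only [Real.one_rpow, mul_one] at h
  rw [tsub_le_iff_right, show (b : ℝ≥0∞) = ENNReal.ofReal b by simp, ← ENNReal.ofReal_one,
    ← ENNReal.ofReal_sub _ b.coe_nonneg, ENNReal.ofReal_rpow_of_nonneg (by linarith) (by linarith),
    ← ENNReal.ofReal_mul (by linarith), ← ENNReal.ofReal_add (by positivity)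
      (Real.rpow_nonneg (by linarith) _)]
  exact ENNReal.ofReal_le_ofReal (by linarith)

theorem rpow_lintegral_kernel_le {m : Measure Y} {k f : Y → ℝ≥0∞} (hk : Measurable k)
    (hf : Measurable f) (hk1 : ∫⁻ y, k y ∂m ≤ 1) {S : ℝ} (hS : 1 < S) :
    (∫⁻ y, k y * f y ∂m) ^ S ≤ ∫⁻ y, k y * f y ^ S ∂m := by
  rw [← lintegral_kernel_eq_withDensity hk hf,
    ← lintegral_kernel_eq_withDensity hk (hf.pow_const S)]
  have h := ENNReal.lintegral_mul_le_Lp_mul_Lq (m.withDensity k)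
    (Real.HolderConjugate.conjExponent hS) hf.aemeasurable (g := 1) aemeasurable_const
  have hmass : (m.withDensity k) Set.univ ≤ 1 := by simpa using hk1
  calc (∫⁻ y, f y ∂(m.withDensity k)) ^ S
      ≤ ((∫⁻ y, f y ^ S ∂(m.withDensity k)) ^ (1 / S) * 1) ^ S := by
        gcongr
        refine le_trans ?_ (h.trans ?_)
        · simp
        · gcongr
          refine ENNReal.rpow_le_one ?_ ?_
          · simpa using hmass
          · have := (Real.HolderConjugate.conjExponent hS).symm.pos
            positivity
    _ = _ := by
        rw [mul_one, ← ENNReal.rpow_mul, one_div_mul_cancel (by linarith), ENNReal.rpow_one]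

/-- The superlinear case `p q > 1`: an improving bound for the adjoint kernel forces `a` to vanish
once its support has small measure. -/
theorem exists_pos_ae_eq_zero_of_superlinear_system {p q : ℝ} (hp : 0 < p) (hq : 0 < q)
    (hpq : 1 < p * q) {C : ℝ≥0∞} (hC : C ≠ ∞) :
    ∃ ε : ℝ≥0∞, 0 < ε ∧ ∀ (m : Measure Y) (ν : Measure X) [IsFiniteMeasure m] [SFinite ν]
      (κ : X → Y → ℝ≥0∞) (a : Y → ℝ≥0∞) (b : X → ℝ≥0∞), Measurable (Function.uncurry κ) →
      Measurable a → Measurable b → (∀ y, a y ≤ 1) → (∀ x, b x ≤ 1) →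
      (∀ᵐ y ∂m, a y ≤ ∫⁻ x, κ x y * (1 - (1 - b x) ^ q) ∂ν) →
      (∀ᵐ x ∂ν, b x ≤ ∫⁻ y, κ x y * (1 - (1 - a y) ^ p) ∂m) →
      (∀ᵐ y ∂m, ∫⁻ x, κ x y ∂ν ≤ 1) → (∀ᵐ x ∂ν, ∫⁻ y, κ x y ∂m ≤ 1) →
      (∫⁻ x, (∫⁻ y, κ x y * a y ∂m) ^ (q + 1) ∂ν ≤
        C * (∫⁻ y, a y ^ ((p + 1) / p) ∂m) ^ ((q + 1) * p / (p + 1))) →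
      m {y | a y ≠ 0} < ε → ∀ᵐ y ∂m, a y = 0 := by
  set S := q + 1 with hS
  set r := (p + 1) / p with hr
  have hr0 : 0 < r := by positivity
  have hS0 : 1 < S := by linarith
  -- This is where `p q > 1` enters: it makes the Hölder gain `e = S / r - 1` positive.
  have hrS : r < S := by
    rw [hr, div_lt_iff₀ hp]
    nlinarith
  have hSr : S * p / (p + 1) = S / r := by rw [hr]; field_simp
  set e := S / r - 1 with he
  have he0 : 0 < e := by
    rw [he, sub_pos, lt_div_iff₀ hr0]
    linarith
  set Q := ENNReal.ofReal (max q 1)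
  set Pp := ENNReal.ofReal (max p 1)
  set D := Q ^ S * (Pp ^ S * C) with hD
  have hDt : D ≠ ∞ := by
    refine ENNReal.mul_ne_top ?_ (ENNReal.mul_ne_top ?_ hC) <;>
    exact ENNReal.rpow_ne_top_of_nonneg (by linarith) ENNReal.ofReal_ne_top
  -- Chosen so that a support of measure below it satisfies `D * m(supp) ^ e < 1`; the `+ 1` covers
  -- `D = 0`.
  refine ⟨(D + 1)⁻¹ ^ (1 / e), ENNReal.rpow_pos (by simp [hDt]) (by simp), ?_⟩
  intro m ν _ _ κ a b hκ ha hb ha1 hb1 hab hba h1 h2 hHLS hsmall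
  have hκ1 : ∀ x, Measurable (κ x) := fun x => hκ.of_uncurry_left
  have hκ2 : ∀ y, Measurable fun x => κ x y := fun y => hκ.of_uncurry_right
  set I := ∫⁻ y, a y ^ S ∂m with hI
  have hIt : I ≠ ∞ := by
    refine ne_of_lt (lt_of_le_of_lt (lintegral_mono (g := fun _ => 1) fun y => ?_) (by simp))
    exact ENNReal.rpow_le_one (ha1 y) (by linarith)
  -- Linearise, apply Jensen to `T`, and integrate using `T*1 ≤ 1`.
  have step1 : I ≤ Q ^ S * ∫⁻ x, b x ^ S ∂ν := by
    calc I ≤ ∫⁻ y, Q ^ S * ∫⁻ x, κ x y * b x ^ S ∂ν ∂m := by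
          refine lintegral_mono_ae ?_
          filter_upwards [hab, h1] with y hy hy1
          have hay : a y ≤ Q * ∫⁻ x, κ x y * b x ∂ν := by
            rw [← lintegral_const_mul _ (show Measurable fun x => κ x y * b x from (hκ2 y).mul hb)]
            refine hy.trans (lintegral_mono fun x => ?_)
            calc _ ≤ κ x y * (Q * b x) := by
                  gcongr
                  exact ENNReal.one_sub_one_sub_rpow_le (hb1 x) hq
              _ = _ := by ring
          calc a y ^ S ≤ (Q * ∫⁻ x, κ x y * b x ∂ν) ^ S := by gcongr
            _ = Q ^ S * (∫⁻ x, κ x y * b x ∂ν) ^ S := ENNReal.mul_rpow_of_nonneg _ _ (by linarith)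
            _ ≤ _ := by
              gcongr
              exact rpow_lintegral_kernel_le (hκ2 y) hb hy1 hS0
      _ = Q ^ S * ∫⁻ y, 1 * ∫⁻ x, κ x y * b x ^ S ∂ν ∂m := by
          simp only [one_mul]
          rw [lintegral_const_mul]
          exact Measurable.lintegral_prod_left' (f := fun z : X × Y => κ z.1 z.2 * b z.1 ^ S)
            (hκ.mul ((hb.comp measurable_fst).pow_const S))
      _ = Q ^ S * ∫⁻ x, b x ^ S * ∫⁻ y, κ x y * 1 ∂m ∂ν := by
          rw [lintegral_kernel_mul_swap hκ measurable_const (hb.pow_const S)]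
      _ ≤ _ := by
          refine mul_le_mul' le_rfl (lintegral_mono_ae ?_)
          filter_upwards [h2] with x hx
          simp only [mul_one]
          calc _ ≤ b x ^ S * 1 := by gcongr
            _ = _ := mul_one _
  have step2 : ∫⁻ x, b x ^ S ∂ν ≤ Pp ^ S * ∫⁻ x, (∫⁻ y, κ x y * a y ∂m) ^ S ∂ν := by
    rw [← lintegral_const_mul]
    · refine lintegral_mono_ae ?_
      filter_upwards [hba] with x hx
      rw [← ENNReal.mul_rpow_of_nonneg _ _ (by linarith : (0 : ℝ) ≤ S)]
      gcongr
      rw [← lintegral_const_mul _ (show Measurable fun y => κ x y * a y from (hκ1 x).mul ha)]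
      refine hx.trans (lintegral_mono fun y => ?_)
      calc _ ≤ κ x y * (Pp * a y) := by
            gcongr
            exact ENNReal.one_sub_one_sub_rpow_le (ha1 y) hp
        _ = _ := by ring
    · refine Measurable.pow_const ?_ _
      exact Measurable.lintegral_prod_right' (f := fun z : X × Y => κ z.1 z.2 * a z.2)
        (hκ.mul (ha.comp measurable_snd))
  -- Hölder on the support of `a`: the exponent drops from `S` to `r` at the price of a positive
  -- power of the measure of the support.
  have step3 : ∫⁻ y, a y ^ r ∂m ≤ I ^ (r / S) * m {y | a y ≠ 0} ^ (1 - r / S) := by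
    have hset : MeasurableSet {y | a y ≠ 0} := (measurableSet_eq_fun ha measurable_const).compl
    have h := ENNReal.lintegral_mul_norm_pow_le (μ := m) (f := fun y => a y ^ S)
      (g := {y | a y ≠ 0}.indicator 1) (p := r / S) (q := 1 - r / S)
      (ha.pow_const S).aemeasurable (measurable_one.indicator hset).aemeasurable
      (by positivity) (by rw [sub_nonneg, div_le_one (by linarith)]; exact hrS.le) (by ring)
    rw [lintegral_indicator_one hset] at h
    refine le_trans (lintegral_mono fun y => ?_) h
    rw [← ENNReal.rpow_mul, mul_div_cancel₀ _ (by linarith : S ≠ 0)]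
    by_cases h0 : a y = 0
    · simp [h0, ENNReal.zero_rpow_of_pos hr0]
    · simp [h0]
  have step4 : (∫⁻ y, a y ^ r ∂m) ^ (S / r) ≤ I * m {y | a y ≠ 0} ^ e := by
    calc _ ≤ (I ^ (r / S) * m {y | a y ≠ 0} ^ (1 - r / S)) ^ (S / r) := by gcongr
      _ = _ := by
        rw [ENNReal.mul_rpow_of_nonneg _ _ (by positivity), ← ENNReal.rpow_mul,
          ← ENNReal.rpow_mul]
        have e1 : r / S * (S / r) = 1 := by field_simp
        have e2 : (1 - r / S) * (S / r) = e := by rw [he]; field_simp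
        rw [e1, e2, ENNReal.rpow_one]
  have key : I ≤ I * (D * m {y | a y ≠ 0} ^ e) := by
    rw [hSr] at hHLS
    calc I ≤ Q ^ S * (Pp ^ S * (C * (I * m {y | a y ≠ 0} ^ e))) := by
          refine step1.trans ?_
          gcongr
          refine step2.trans ?_
          gcongr
          refine hHLS.trans ?_
          gcongr
      _ = _ := by rw [hD]; ring
  have hlt : D * m {y | a y ≠ 0} ^ e < 1 := by
    have h5 : m {y | a y ≠ 0} ^ e < (D + 1)⁻¹ := by
      calc _ < ((D + 1)⁻¹ ^ (1 / e)) ^ e := ENNReal.rpow_lt_rpow hsmall he0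
        _ = _ := by rw [← ENNReal.rpow_mul, one_div_mul_cancel he0.ne', ENNReal.rpow_one]
    have hD1 : D + 1 ≠ ∞ := by simp [hDt]
    calc D * m {y | a y ≠ 0} ^ e ≤ (D + 1) * m {y | a y ≠ 0} ^ e := by gcongr; simp
      _ < (D + 1) * (D + 1)⁻¹ := ENNReal.mul_lt_mul_right (by simp) hD1 h5
      _ = 1 := ENNReal.mul_inv_cancel (by simp) hD1
  have hI0 : I = 0 := by
    by_contra h0
    have : I * (D * m {y | a y ≠ 0} ^ e) < I * 1 := ENNReal.mul_lt_mul_right h0 hIt hlt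
    rw [mul_one] at this
    exact absurd key (not_le.2 this)
  rw [hI, lintegral_eq_zero_iff (ha.pow_const S)] at hI0
  filter_upwards [hI0] with y hy
  simpa [ENNReal.rpow_eq_zero_iff, show ¬ S < 0 by linarith, show 0 < S by linarith] using hy

/-- The sublinear and the superlinear case together. -/
theorem exists_pos_ae_eq_zero_of_system {p q : ℝ} (hp : 0 < p) (hq : 0 < q) {C : ℝ≥0∞}
    (hC : C ≠ ∞) :
    ∃ ε : ℝ≥0∞, 0 < ε ∧ ∀ (m : Measure Y) (ν : Measure X) [IsFiniteMeasure m] [SFinite ν]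
      (κ : X → Y → ℝ≥0∞) (a : Y → ℝ≥0∞) (b : X → ℝ≥0∞), Measurable (Function.uncurry κ) →
      Measurable a → Measurable b → (∀ y, a y ≤ 1) → (∀ x, b x ≤ 1) →
      (∀ᵐ y ∂m, a y ≤ ∫⁻ x, κ x y * (1 - (1 - b x) ^ q) ∂ν) →
      (∀ᵐ x ∂ν, b x ≤ ∫⁻ y, κ x y * (1 - (1 - a y) ^ p) ∂m) →
      (∀ᵐ y ∂m, ∫⁻ x, κ x y ∂ν < 1) → (∀ᵐ x ∂ν, ∫⁻ y, κ x y ∂m ≤ 1) →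
      (1 < p * q → ∫⁻ x, (∫⁻ y, κ x y * a y ∂m) ^ (q + 1) ∂ν ≤
        C * (∫⁻ y, a y ^ ((p + 1) / p) ∂m) ^ ((q + 1) * p / (p + 1))) →
      m {y | a y ≠ 0} < ε → ∀ᵐ y ∂m, a y = 0 := by
  rcases le_or_gt (p * q) 1 with hpq | hpq
  -- The sublinear case needs no smallness, so the threshold may be infinite.
  · refine ⟨⊤, ENNReal.zero_lt_top, fun m ν _ _ κ a b hκ ha hb ha1 hb1 hab hba h1 h2 _ _ => ?_⟩
    exact ae_eq_zero_of_sublinear_system hκ ha hb ha1 hb1 hp hq hpq hab hba h1 h2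
  · obtain ⟨ε, hε, H⟩ := exists_pos_ae_eq_zero_of_superlinear_system (X := X) (Y := Y)
      hp hq hpq hC
    refine ⟨ε, hε, fun m ν _ _ κ a b hκ ha hb ha1 hb1 hab hba h1 h2 h3 h4 => ?_⟩
    exact H m ν κ a b hκ ha hb ha1 hb1 hab hba (h1.mono fun y hy => hy.le) h2 (h3 hpq) h4

end MarkovKernel

/-! ### Integrals of powers of the norm over balls and their complements -/

section PowerIntegrals

theorem rpow_neg_le_of_comparable {s t : ℝ} (hs : 0 < s) (h1 : s / 2 ≤ t) (h2 : t ≤ 2 * s)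
    (e : ℝ) : t ^ (-e) ≤ 2 ^ |e| * s ^ (-e) := by
  have ht : 0 < t := by linarith
  rcases le_total 0 e with he | he
  · rw [abs_of_nonneg he]
    calc t ^ (-e) ≤ (s / 2) ^ (-e) :=
          Real.rpow_le_rpow_of_nonpos (by positivity) h1 (by linarith)
      _ = _ := by
        rw [Real.div_rpow hs.le zero_le_two, Real.rpow_neg zero_le_two, div_inv_eq_mul, mul_comm]
  · rw [abs_of_nonpos he]
    calc t ^ (-e) ≤ (2 * s) ^ (-e) := Real.rpow_le_rpow ht.le h2 (by linarith)
      _ = _ := Real.mul_rpow zero_le_two hs.le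

open Module in
theorem lintegral_fun_norm_addHaar {E : Type*} [NormedAddCommGroup E] [NormedSpace ℝ E]
    [FiniteDimensional ℝ E] [Nontrivial E] [MeasurableSpace E] [BorelSpace E]
    (μ : Measure E) [μ.IsAddHaarMeasure] {f : ℝ → ℝ≥0∞} (hf : Measurable f) :
    ∫⁻ x, f ‖x‖ ∂μ = μ.toSphere Set.univ *
      ∫⁻ y in Set.Ioi (0 : ℝ), ENNReal.ofReal (y ^ (finrank ℝ E - 1)) * f y := by
  have hm : MeasurableSet ({(0 : E)}ᶜ : Set E) := (measurableSet_singleton _).compl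
  calc ∫⁻ x, f ‖x‖ ∂μ = ∫⁻ x : ({(0)}ᶜ : Set E), f ‖x.1‖ ∂(μ.comap (↑)) := by
        rw [lintegral_subtype_comap hm (fun x => f ‖x‖), restrict_compl_singleton]
    _ = ∫⁻ x, f x.2 ∂μ.toSphere.prod (.volumeIoiPow (finrank ℝ E - 1)) := by
        rw [← μ.measurePreserving_homeomorphUnitSphereProd.lintegral_comp_emb
          (Homeomorph.measurableEmbedding _)]
        simp only [homeomorphUnitSphereProd_apply_snd_coe]
    _ = μ.toSphere Set.univ * ∫⁻ x : Set.Ioi (0 : ℝ), f x ∂.volumeIoiPow (finrank ℝ E - 1) := by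
        have hmeas : Measurable fun x : Metric.sphere (0 : E) 1 × Set.Ioi (0 : ℝ) =>
            f (x.2 : ℝ) := by fun_prop
        rw [lintegral_prod _ hmeas.aemeasurable]
        simp [mul_comm]
    _ = _ := by
        rw [Measure.volumeIoiPow, lintegral_withDensity_eq_lintegral_mul _ (by fun_prop)
          (by fun_prop)]
        congr 1
        exact lintegral_subtype_comap measurableSet_Ioi
          (fun y : ℝ => ENNReal.ofReal (y ^ (finrank ℝ E - 1)) * f y)

theorem lintegral_Ioc_rpow {s R : ℝ} (hs : -1 < s) (hR : 0 < R) :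
    ∫⁻ y in Set.Ioc 0 R, ENNReal.ofReal (y ^ s) = ENNReal.ofReal (R ^ (s + 1) / (s + 1)) := by
  have hint : IntegrableOn (fun y : ℝ => y ^ s) (Set.Ioc 0 R) :=
    (intervalIntegrable_iff_integrableOn_Ioc_of_le hR.le).1
      (intervalIntegral.intervalIntegrable_rpow' hs)
  rw [← ofReal_integral_eq_lintegral_ofReal hint, ← intervalIntegral.integral_of_le hR.le,
    integral_rpow (Or.inl hs), Real.zero_rpow (by linarith), sub_zero]
  filter_upwards [ae_restrict_mem measurableSet_Ioc] with y hy
  exact Real.rpow_nonneg hy.1.le _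

theorem lintegral_Ioi_rpow {s R : ℝ} (hs : s < -1) (hR : 0 < R) :
    ∫⁻ y in Set.Ioi R, ENNReal.ofReal (y ^ s) = ENNReal.ofReal (-R ^ (s + 1) / (s + 1)) := by
  rw [← ofReal_integral_eq_lintegral_ofReal (integrableOn_Ioi_rpow_of_lt hs hR),
    integral_Ioi_rpow_of_lt hs hR]
  filter_upwards [ae_restrict_mem measurableSet_Ioi] with y hy
  exact Real.rpow_nonneg (hR.trans hy).le _

variable {E : Type*} [NormedAddCommGroup E] [NormedSpace ℝ E]
    [FiniteDimensional ℝ E] [Nontrivial E] [MeasurableSpace E] [BorelSpace E]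
    (μ : Measure E) [μ.IsAddHaarMeasure]

theorem lintegral_norm_rpow {A : Set ℝ} (hA : MeasurableSet A) (hA0 : A ⊆ Set.Ioi 0) (s : ℝ) :
    ∫⁻ x in {x : E | ‖x‖ ∈ A}, ENNReal.ofReal (‖x‖ ^ s) ∂μ = μ.toSphere Set.univ *
      ∫⁻ y in A, ENNReal.ofReal (y ^ (s + Module.finrank ℝ E - 1)) := by
  have hd : 1 ≤ Module.finrank ℝ E := Module.finrank_pos
  have hA' : MeasurableSet {x : E | ‖x‖ ∈ A} := measurable_norm hA
  rw [← lintegral_indicator hA']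
  have h := lintegral_fun_norm_addHaar μ (f := A.indicator fun y => ENNReal.ofReal (y ^ s))
    (Measurable.indicator (by fun_prop) hA)
  refine Eq.trans (lintegral_congr fun x => ?_) (h.trans ?_)
  · simp [Set.indicator]
  congr 1
  rw [← lintegral_indicator hA, ← lintegral_indicator measurableSet_Ioi]
  refine lintegral_congr fun y => ?_
  by_cases hy : y ∈ A
  · have hy0 : 0 < y := hA0 hy
    rw [Set.indicator_of_mem (show y ∈ Set.Ioi 0 from hy0), Set.indicator_of_mem hy,
      Set.indicator_of_mem hy, ← ENNReal.ofReal_mul (by positivity), ← Real.rpow_natCast,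
      ← Real.rpow_add hy0]
    congr 2
    push_cast [hd]
    ring
  · simp [hy]

/-- A gauge comparable with the norm has the expected integrals of powers over its balls. -/
theorem exists_lintegral_rpow_le_of_lt {g : E → ℝ} (hg1 : ∀ x, ‖x‖ ≤ g x)
    (hg2 : ∀ x, g x ≤ 2 * ‖x‖) {e : ℝ} (he : e < Module.finrank ℝ E) :
    ∃ C : ℝ≥0∞, C ≠ ∞ ∧ ∀ R : ℝ, 0 < R →
      ∫⁻ x in {x : E | g x ≤ R}, ENNReal.ofReal (g x ^ (-e)) ∂μ
        ≤ C * ENNReal.ofReal (R ^ (Module.finrank ℝ E - e)) := by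
  set d : ℝ := (Module.finrank ℝ E : ℝ)
  refine ⟨ENNReal.ofReal (2 ^ |e|) * (μ.toSphere Set.univ * ENNReal.ofReal (1 / (d - e))),
    ENNReal.mul_ne_top ENNReal.ofReal_ne_top
      (ENNReal.mul_ne_top (measure_ne_top _ _) ENNReal.ofReal_ne_top), fun R hR => ?_⟩
  have hsub : {x : E | g x ≤ R} ⊆ {x : E | ‖x‖ ≤ R} := fun x hx => (hg1 x).trans hx
  calc ∫⁻ x in {x : E | g x ≤ R}, ENNReal.ofReal (g x ^ (-e)) ∂μ
      ≤ ∫⁻ x in {x : E | ‖x‖ ≤ R}, ENNReal.ofReal (g x ^ (-e)) ∂μ :=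
        lintegral_mono_set hsub
    _ ≤ ∫⁻ x in {x : E | ‖x‖ ≤ R}, ENNReal.ofReal (2 ^ |e|) * ENNReal.ofReal (‖x‖ ^ (-e)) ∂μ := by
        refine lintegral_mono_ae (ae_restrict_of_ae ?_)
        filter_upwards [Measure.ae_ne μ (0 : E)] with x hx
        rw [← ENNReal.ofReal_mul (by positivity)]
        exact ENNReal.ofReal_le_ofReal (rpow_neg_le_of_comparable (norm_pos_iff.2 hx)
          (by linarith [hg1 x, norm_nonneg x]) (hg2 x) e)
    _ = ENNReal.ofReal (2 ^ |e|) * ∫⁻ x in {x : E | ‖x‖ ∈ Set.Ioc 0 R},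
          ENNReal.ofReal (‖x‖ ^ (-e)) ∂μ := by
        rw [lintegral_const_mul _ (by fun_prop)]
        congr 1
        refine setLIntegral_congr ?_
        filter_upwards [Measure.ae_ne μ (0 : E)] with x hx
        have : 0 < ‖x‖ := norm_pos_iff.2 hx
        simp only [eq_iff_iff]
        exact ⟨fun h => ⟨this, h⟩, fun h => h.2⟩
    _ = _ := by
        rw [lintegral_norm_rpow μ measurableSet_Ioc (fun y hy => hy.1),
          lintegral_Ioc_rpow (by linarith) hR, mul_assoc, mul_assoc,
          ← ENNReal.ofReal_mul (by rw [one_div, inv_nonneg]; linarith)]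
        congr 3
        rw [show -e + d - 1 + 1 = d - e by ring]
        field_simp

theorem exists_lintegral_rpow_le_of_gt {g : E → ℝ} (hg1 : ∀ x, ‖x‖ ≤ g x)
    (hg2 : ∀ x, g x ≤ 2 * ‖x‖) {e : ℝ} (he : Module.finrank ℝ E < e) :
    ∃ C : ℝ≥0∞, C ≠ ∞ ∧ ∀ R : ℝ, 0 < R →
      ∫⁻ x in {x : E | R < g x}, ENNReal.ofReal (g x ^ (-e)) ∂μ
        ≤ C * ENNReal.ofReal (R ^ (Module.finrank ℝ E - e)) := by
  set d : ℝ := (Module.finrank ℝ E : ℝ)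
  refine ⟨ENNReal.ofReal (2 ^ |e|) * (μ.toSphere Set.univ *
    ENNReal.ofReal ((1 / 2) ^ (d - e) / (e - d))),
    ENNReal.mul_ne_top ENNReal.ofReal_ne_top
      (ENNReal.mul_ne_top (measure_ne_top _ _) ENNReal.ofReal_ne_top), fun R hR => ?_⟩
  have hsub : {x : E | R < g x} ⊆ {x : E | ‖x‖ ∈ Set.Ioi (R / 2)} := fun x hx => by
    have h1 : R < g x := hx
    have h2 := hg2 x
    show R / 2 < ‖x‖
    linarith
  calc ∫⁻ x in {x : E | R < g x}, ENNReal.ofReal (g x ^ (-e)) ∂μ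
      ≤ ∫⁻ x in {x : E | ‖x‖ ∈ Set.Ioi (R / 2)}, ENNReal.ofReal (g x ^ (-e)) ∂μ :=
        lintegral_mono_set hsub
    _ ≤ ∫⁻ x in {x : E | ‖x‖ ∈ Set.Ioi (R / 2)},
          ENNReal.ofReal (2 ^ |e|) * ENNReal.ofReal (‖x‖ ^ (-e)) ∂μ := by
        refine lintegral_mono_ae (ae_restrict_of_ae ?_)
        filter_upwards [Measure.ae_ne μ (0 : E)] with x hx
        rw [← ENNReal.ofReal_mul (by positivity)]
        exact ENNReal.ofReal_le_ofReal (rpow_neg_le_of_comparable (norm_pos_iff.2 hx)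
          (by linarith [hg1 x, norm_nonneg x]) (hg2 x) e)
    _ = _ := by
        rw [lintegral_const_mul _ (by fun_prop), lintegral_norm_rpow μ measurableSet_Ioi
          (Set.Ioi_subset_Ioi (by positivity)),
          lintegral_Ioi_rpow (by linarith) (by positivity), mul_assoc, mul_assoc,
          ← ENNReal.ofReal_mul (div_nonneg (by positivity) (by linarith))]
        congr 3
        rw [show -e + d - 1 + 1 = d - e by ring, show e - d = -(d - e) by ring,
          show R / 2 = 1 / 2 * R by ring, Real.mul_rpow (by norm_num) hR.le, div_neg, neg_div]
        ring

theorem lintegral_ball_rpow_eq_top {e : ℝ} (he : Module.finrank ℝ E ≤ e) :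
    ∫⁻ x in {x : E | ‖x‖ ∈ Set.Ioo (0 : ℝ) 1}, ENNReal.ofReal (‖x‖ ^ (-e)) ∂μ = ∞ := by
  rw [lintegral_norm_rpow μ measurableSet_Ioo (fun y hy => hy.1)]
  have hpos : μ.toSphere Set.univ ≠ 0 := Measure.measure_univ_ne_zero.2 (Measure.toSphere_ne_zero μ)
  have : ∫⁻ y in Set.Ioo (0 : ℝ) 1, ENNReal.ofReal (y ^ (-e + Module.finrank ℝ E - 1)) = ∞ := by
    by_contra h
    have hint : IntegrableOn (fun y : ℝ => y ^ (-e + Module.finrank ℝ E - 1)) (Set.Ioo 0 1) := by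
      refine (lintegral_ofReal_ne_top_iff_integrable ?_ ?_).1 h
      · exact (by fun_prop : Measurable _).aestronglyMeasurable
      · filter_upwards [ae_restrict_mem measurableSet_Ioo] with y hy
        exact Real.rpow_nonneg hy.1.le _
    rw [intervalIntegral.integrableOn_Ioo_rpow_iff one_pos] at hint
    linarith
  rw [this, ENNReal.mul_top hpos]

theorem lintegral_compl_ball_rpow_eq_top {e : ℝ} (he : e ≤ Module.finrank ℝ E) :
    ∫⁻ x in {x : E | ‖x‖ ∈ Set.Ioi (1 : ℝ)}, ENNReal.ofReal (‖x‖ ^ (-e)) ∂μ = ∞ := by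
  rw [lintegral_norm_rpow μ measurableSet_Ioi (Set.Ioi_subset_Ioi zero_le_one)]
  have hpos : μ.toSphere Set.univ ≠ 0 := Measure.measure_univ_ne_zero.2 (Measure.toSphere_ne_zero μ)
  have : ∫⁻ y in Set.Ioi (1 : ℝ), ENNReal.ofReal (y ^ (-e + Module.finrank ℝ E - 1)) = ∞ := by
    by_contra h
    have hint : IntegrableOn (fun y : ℝ => y ^ (-e + Module.finrank ℝ E - 1)) (Set.Ioi 1) := by
      refine (lintegral_ofReal_ne_top_iff_integrable ?_ ?_).1 h
      · exact (by fun_prop : Measurable _).aestronglyMeasurable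
      · filter_upwards [ae_restrict_mem measurableSet_Ioi] with y hy
        exact Real.rpow_nonneg (lt_trans one_pos hy).le _
    rw [integrableOn_Ioi_rpow_iff one_pos] at hint
    linarith
  rw [this, ENNReal.mul_top hpos]

end PowerIntegrals

/-! ### Euclidean length, distance to boundary points and power kernels -/

section Length

variable {n : ℕ}

theorem euclLength_eq_norm (x : Pt n) : euclLength x = ‖WithLp.toLp 2 x‖ := by
  rw [WithLp.prod_norm_eq_of_L2, euclLength]
  simp

theorem euclLength_nonneg (x : Pt n) : 0 ≤ euclLength x := Real.sqrt_nonneg _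

theorem euclLength_add_le (x y : Pt n) : euclLength (x + y) ≤ euclLength x + euclLength y := by
  simp only [euclLength_eq_norm, WithLp.toLp_add]
  exact norm_add_le _ _

theorem euclLength_neg (x : Pt n) : euclLength (-x) = euclLength x := by
  simp [euclLength]

theorem euclLength_boundary (y : Bdry n) : euclLength ((y, 0) : Pt n) = ‖y‖ := by
  simp [euclLength, Real.sqrt_sq]

theorem norm_fst_le_euclLength (x : Pt n) : ‖x.1‖ ≤ euclLength x :=
  Real.le_sqrt_of_sq_le (by nlinarith)

theorem abs_snd_le_euclLength (x : Pt n) : |x.2| ≤ euclLength x :=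
  Real.le_sqrt_of_sq_le (by rw [sq_abs]; nlinarith)

theorem norm_le_euclLength (x : Pt n) : ‖x‖ ≤ euclLength x :=
  max_le (norm_fst_le_euclLength x) (abs_snd_le_euclLength x)

theorem euclLength_le_two_mul_norm (x : Pt n) : euclLength x ≤ 2 * ‖x‖ := by
  have h1 : ‖x.1‖ ≤ ‖x‖ := norm_fst_le x
  have h2 : |x.2| ≤ ‖x‖ := norm_snd_le x
  refine Real.sqrt_le_iff.2 ⟨by positivity, ?_⟩
  rw [← sq_abs x.2]
  nlinarith [norm_nonneg x, norm_nonneg x.1, abs_nonneg x.2]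

theorem euclLength_pos {x : Pt n} (hx : 0 < x.2) : 0 < euclLength x :=
  hx.trans_le ((le_abs_self _).trans (abs_snd_le_euclLength x))

/-- The distance from `x` to the boundary point `y`. -/
noncomputable def bdryDist (x : Pt n) (y : Bdry n) : ℝ := euclLength ((x.1 - y, x.2) : Pt n)

theorem bdryDist_eq (x : Pt n) (y : Bdry n) : bdryDist x y = euclLength (x - (y, 0)) := by
  rw [bdryDist]
  congr 1
  ext <;> simp

theorem snd_le_bdryDist (x : Pt n) (y : Bdry n) : x.2 ≤ bdryDist x y :=
  (le_abs_self _).trans (abs_snd_le_euclLength ((x.1 - y, x.2) : Pt n))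

theorem norm_sub_le_bdryDist (x : Pt n) (y : Bdry n) : ‖x.1 - y‖ ≤ bdryDist x y :=
  norm_fst_le_euclLength ((x.1 - y, x.2) : Pt n)

theorem bdryDist_pos {x : Pt n} (hx : 0 < x.2) (y : Bdry n) : 0 < bdryDist x y :=
  hx.trans_le (snd_le_bdryDist x y)

theorem euclLength_le_bdryDist_add (x : Pt n) (y : Bdry n) :
    euclLength x ≤ bdryDist x y + ‖y‖ := by
  have h := euclLength_add_le (x - ((y, 0) : Pt n)) ((y, 0) : Pt n)
  rwa [sub_add_cancel, euclLength_boundary, ← bdryDist_eq] at h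

theorem bdryDist_le_add (x : Pt n) (y : Bdry n) : bdryDist x y ≤ euclLength x + ‖y‖ := by
  have h := euclLength_add_le x (-((y, 0) : Pt n))
  rwa [← sub_eq_add_neg, euclLength_neg, euclLength_boundary, ← bdryDist_eq] at h

theorem norm_le_euclLength_add_bdryDist (x : Pt n) (y : Bdry n) :
    ‖y‖ ≤ euclLength x + bdryDist x y := by
  have h := euclLength_add_le x (-(x - ((y, 0) : Pt n)))
  rwa [← sub_eq_add_neg, sub_sub_cancel, euclLength_neg, euclLength_boundary,
    ← bdryDist_eq] at h

theorem kerP_eq (lam mu : ℝ) (x : Pt n) (y : Bdry n) :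
    kerP lam mu x y = x.2 ^ lam / bdryDist x y ^ mu := by
  rw [kerP, bdryDist, euclLength, Real.sqrt_eq_rpow, ← Real.rpow_mul (by positivity)]
  congr 2
  ring

@[fun_prop]
theorem measurable_euclLength : Measurable (euclLength : Pt n → ℝ) := by
  unfold euclLength
  fun_prop

@[fun_prop]
theorem measurable_bdryDist : Measurable (fun z : Pt n × Bdry n => bdryDist z.1 z.2) := by
  unfold bdryDist
  fun_prop

theorem measurableSet_upperHalf : MeasurableSet (upperHalf n) :=
  measurableSet_lt measurable_const measurable_snd

/-- The kernel `|x|^{-i} |y|^{-j} x_n^l |x - y|^{-m}`. -/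
noncomputable def powKer (i j l m : ℝ) (x : Pt n) (y : Bdry n) : ℝ :=
  euclLength x ^ (-i) * ‖y‖ ^ (-j) * x.2 ^ l * bdryDist x y ^ (-m)

@[fun_prop]
theorem measurable_powKer (i j l m : ℝ) :
    Measurable (fun z : Pt n × Bdry n => powKer i j l m z.1 z.2) := by
  unfold powKer
  fun_prop

theorem powKer_nonneg (i j l m : ℝ) {x : Pt n} (hx : 0 < x.2) (y : Bdry n) :
    0 ≤ powKer i j l m x y := by
  have := bdryDist_pos hx y
  have := euclLength_pos hx
  unfold powKer
  positivity

theorem powKer_rpow_mul_rpow {i j l m i' j' l' m' s t : ℝ} {x : Pt n} (hx : 0 < x.2)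
    {y : Bdry n} (hy : y ≠ 0) :
    powKer i j l m x y ^ s * powKer i' j' l' m' x y ^ t =
      powKer (i * s + i' * t) (j * s + j' * t) (l * s + l' * t) (m * s + m' * t) x y := by
  have h1 := bdryDist_pos hx y
  have h2 := euclLength_pos hx
  have h3 : 0 < ‖y‖ := norm_pos_iff.2 hy
  have key : ∀ z : ℝ, 0 < z → ∀ a b : ℝ, z ^ (a * s + b * t) = (z ^ a) ^ s * (z ^ b) ^ t := by
    intro z hz a b
    rw [Real.rpow_add hz, Real.rpow_mul hz.le, Real.rpow_mul hz.le]
  unfold powKer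
  rw [show -(i * s + i' * t) = (-i) * s + (-i') * t by ring,
    show -(j * s + j' * t) = (-j) * s + (-j') * t by ring,
    show -(m * s + m' * t) = (-m) * s + (-m') * t by ring, key _ h1, key _ h2, key _ h3, key _ hx,
    Real.mul_rpow (by positivity) (by positivity), Real.mul_rpow (by positivity) (by positivity),
    Real.mul_rpow (by positivity) (by positivity), Real.mul_rpow (by positivity) (by positivity),
    Real.mul_rpow (by positivity) (by positivity), Real.mul_rpow (by positivity) (by positivity)]
  ring

theorem weightedKer_eq_powKer (a b lam mu : ℝ) {x : Pt n} (hx : 0 < x.2) {y : Bdry n}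
    (hy : y ≠ 0) : weightedKer a b lam mu x y = ENNReal.ofReal (powKer b a lam mu x y) := by
  have h1 := bdryDist_pos hx y
  have h2 := euclLength_pos hx
  have h3 : 0 < ‖y‖ := norm_pos_iff.2 hy
  rw [weightedKer, kerP_eq, ENNReal.ofReal_rpow_of_pos h3, ENNReal.ofReal_rpow_of_pos h2,
    ← ENNReal.ofReal_mul (by positivity), ← ENNReal.ofReal_mul (by positivity), powKer,
    Real.rpow_neg h1.le mu]
  congr 1
  ring

end Length

/-! ### A Schur test between different Lebesgue exponents -/

section SchurTest

variable {X Y : Type*} [MeasurableSpace X] [MeasurableSpace Y]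

/-- A Schur test from `L^r` to `L^S` with `r ≤ S`. -/
theorem lintegral_rpow_lintegral_le_of_schur {ξ : Measure X} {η : Measure Y} [SFinite ξ]
    [SFinite η] {k w₁ w₂ : X → Y → ℝ≥0∞} (hw₁ : Measurable (Function.uncurry w₁))
    (hw₂ : Measurable (Function.uncurry w₂)) {S r r' : ℝ} (hr : 0 < r) (hr' : 0 < r')
    (hrr : 1 / r + 1 / r' = 1) (hrS : r ≤ S)
    (hk : ∀ᵐ x ∂ξ, ∀ᵐ y ∂η, k x y ≤ w₁ x y ^ (1 / S) * w₂ x y ^ (1 / r'))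
    {C₁ C₂ : ℝ≥0∞} (h1 : ∀ᵐ y ∂η, ∫⁻ x, w₁ x y ∂ξ ≤ C₁) (h2 : ∀ᵐ x ∂ξ, ∫⁻ y, w₂ x y ∂η ≤ C₂)
    {f : Y → ℝ≥0∞} (hf : Measurable f) :
    ∫⁻ x, (∫⁻ y, k x y * f y ∂η) ^ S ∂ξ ≤ C₁ * C₂ ^ (S / r') * (∫⁻ y, f y ^ r ∂η) ^ (S / r) := by
  have hS : 0 < S := hr.trans_le hrS
  have hw₁x : ∀ x, Measurable (w₁ x) := fun x => hw₁.of_uncurry_left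
  have hw₂x : ∀ x, Measurable (w₂ x) := fun x => hw₂.of_uncurry_left
  set F := ∫⁻ y, f y ^ r ∂η with hF
  have hexp : 0 ≤ 1 / r - 1 / S := by
    rw [sub_nonneg]
    exact one_div_le_one_div_of_le hr hrS
  have pt : ∀ᵐ x ∂ξ, (∫⁻ y, k x y * f y ∂η) ^ S ≤
      (∫⁻ y, w₁ x y * f y ^ r ∂η) * (F ^ (S / r - 1) * C₂ ^ (S / r')) := by
    filter_upwards [hk, h2] with x hkx h2x
    -- Three-factor Hölder with exponents `1 / S`, `1 / r - 1 / S`, `1 / r'`, which sum to `1`. The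
    -- middle one is nonnegative because `r ≤ S`.
    have hol := ENNReal.lintegral_prod_norm_pow_le (μ := η) (Finset.univ : Finset (Fin 3))
      (f := ![fun y => w₁ x y * f y ^ r, fun y => f y ^ r, w₂ x])
      (by
        intro i _
        fin_cases i
        · exact ((hw₁x x).mul (hf.pow_const r)).aemeasurable
        · exact (hf.pow_const r).aemeasurable
        · exact (hw₂x x).aemeasurable)
      (p := ![1 / S, 1 / r - 1 / S, 1 / r'])
      (by simp [Fin.sum_univ_three]; simp at hrr; linarith)
      (by
        intro i _
        fin_cases i
        · show 0 ≤ 1 / S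
          positivity
        · exact hexp
        · show 0 ≤ 1 / r'
          positivity)
    simp only [Fin.prod_univ_three] at hol
    change ∫⁻ y, (w₁ x y * f y ^ r) ^ (1 / S) * (f y ^ r) ^ (1 / r - 1 / S) *
      w₂ x y ^ (1 / r') ∂η ≤ (∫⁻ y, w₁ x y * f y ^ r ∂η) ^ (1 / S) *
      F ^ (1 / r - 1 / S) * (∫⁻ y, w₂ x y ∂η) ^ (1 / r') at hol
    have hle : ∫⁻ y, k x y * f y ∂η ≤
        (∫⁻ y, w₁ x y * f y ^ r ∂η) ^ (1 / S) * F ^ (1 / r - 1 / S) * C₂ ^ (1 / r') := by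
      refine (lintegral_mono_ae ?_).trans (hol.trans ?_)
      · filter_upwards [hkx] with y hy
        rw [ENNReal.mul_rpow_of_nonneg _ _ (by positivity : 0 ≤ 1 / S)]
        have e1 : (f y ^ r) ^ (1 / S) * (f y ^ r) ^ (1 / r - 1 / S) = f y := by
          rw [← ENNReal.rpow_add_of_nonneg _ _ (by positivity) hexp, add_sub_cancel,
            ← ENNReal.rpow_mul, mul_one_div_cancel hr.ne', ENNReal.rpow_one]
        calc k x y * f y ≤ (w₁ x y ^ (1 / S) * w₂ x y ^ (1 / r')) *
              ((f y ^ r) ^ (1 / S) * (f y ^ r) ^ (1 / r - 1 / S)) := by rw [e1]; gcongr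
          _ = _ := by ring
      · gcongr
    calc (∫⁻ y, k x y * f y ∂η) ^ S
        ≤ ((∫⁻ y, w₁ x y * f y ^ r ∂η) ^ (1 / S) * F ^ (1 / r - 1 / S) * C₂ ^ (1 / r')) ^ S := by
          gcongr
      _ = _ := by
        rw [ENNReal.mul_rpow_of_nonneg _ _ hS.le, ENNReal.mul_rpow_of_nonneg _ _ hS.le,
          ← ENNReal.rpow_mul, ← ENNReal.rpow_mul, ← ENNReal.rpow_mul,
          one_div_mul_cancel hS.ne', ENNReal.rpow_one, mul_assoc]
        congr 3
        · field_simp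
        · field_simp
  calc ∫⁻ x, (∫⁻ y, k x y * f y ∂η) ^ S ∂ξ
      ≤ ∫⁻ x, (∫⁻ y, w₁ x y * f y ^ r ∂η) * (F ^ (S / r - 1) * C₂ ^ (S / r')) ∂ξ :=
        lintegral_mono_ae pt
    _ = (∫⁻ x, 1 * ∫⁻ y, w₁ x y * f y ^ r ∂η ∂ξ) * (F ^ (S / r - 1) * C₂ ^ (S / r')) := by
        simp only [one_mul]
        rw [lintegral_mul_const]
        exact Measurable.lintegral_prod_right' (f := fun z : X × Y => w₁ z.1 z.2 * f z.2 ^ r)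
          (hw₁.mul ((hf.comp measurable_snd).pow_const r))
    _ = (∫⁻ y, f y ^ r * ∫⁻ x, w₁ x y * 1 ∂ξ ∂η) * (F ^ (S / r - 1) * C₂ ^ (S / r')) := by
        rw [lintegral_kernel_mul_swap hw₁ (hf.pow_const r) measurable_const]
    _ ≤ (∫⁻ y, f y ^ r * C₁ ∂η) * (F ^ (S / r - 1) * C₂ ^ (S / r')) := by
        gcongr ?_ * _
        refine lintegral_mono_ae ?_
        filter_upwards [h1] with y hy
        simp only [mul_one]
        gcongr
    _ = C₁ * C₂ ^ (S / r') * (F ^ (1 : ℝ) * F ^ (S / r - 1)) := by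
        rw [lintegral_mul_const _ (hf.pow_const r), ← hF, ENNReal.rpow_one]
        ring
    _ = _ := by
        rw [← ENNReal.rpow_add_of_nonneg _ _ zero_le_one, add_sub_cancel]
        rw [sub_nonneg, one_le_div hr]
        exact hrS

end SchurTest

/-! ### Power kernel bounds and the weighted Hardy-Littlewood-Sobolev inequality -/

section PowKerIntegrals

/-- Away from the singularity the distance `ρ` is comparable from below with the larger scale `T`,
and the height factor is absorbed by the length `g`. -/
theorem rpow_prod_le_of_half_le {i j l m g r x ρ T : ℝ} (hl : 0 ≤ l) (hm : 0 ≤ m) (hg : 0 < g)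
    (hr : 0 < r) (hx : 0 < x) (hxg : x ≤ g) (hT : 0 < T) (hρ : T / 2 ≤ ρ) :
    g ^ (-i) * r ^ (-j) * x ^ l * ρ ^ (-m) ≤ 2 ^ m * (g ^ (-(i - l)) * r ^ (-j) * T ^ (-m)) := by
  have h1 : x ^ l ≤ g ^ l := Real.rpow_le_rpow hx.le hxg hl
  have h2 : ρ ^ (-m) ≤ 2 ^ m * T ^ (-m) := by
    calc ρ ^ (-m) ≤ (T / 2) ^ (-m) :=
          Real.rpow_le_rpow_of_nonpos (by positivity) hρ (by linarith)
      _ = _ := by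
        rw [Real.div_rpow hT.le zero_le_two, Real.rpow_neg zero_le_two, div_inv_eq_mul, mul_comm]
  have hρ0 : 0 < ρ := by linarith
  calc g ^ (-i) * r ^ (-j) * x ^ l * ρ ^ (-m)
      ≤ g ^ (-i) * r ^ (-j) * g ^ l * (2 ^ m * T ^ (-m)) := by gcongr
    _ = _ := by
      rw [show -(i - l) = -i + l by ring, Real.rpow_add hg]
      ring

theorem rpow_mul_rpow_neg_le {l m x ρ : ℝ} (hl : 0 ≤ l) (hx : 0 < x) (hxρ : x ≤ ρ) :
    x ^ l * ρ ^ (-m) ≤ ρ ^ (-(m - l)) := by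
  have hρ : 0 < ρ := hx.trans_le hxρ
  calc x ^ l * ρ ^ (-m) ≤ ρ ^ l * ρ ^ (-m) := by
        gcongr
    _ = _ := by
      rw [← Real.rpow_add hρ]
      congr 1
      ring

theorem ofReal_rpow_mul_rpow_neg {R s t : ℝ} (hR : 0 < R) (h : s + t = 0) :
    ENNReal.ofReal (R ^ s) * ENNReal.ofReal (R ^ t) = 1 := by
  rw [← ENNReal.ofReal_mul (by positivity), ← Real.rpow_add hR, h, Real.rpow_zero,
    ENNReal.ofReal_one]

variable {n : ℕ}

theorem nontrivial_bdry (hn : 2 ≤ n) : Nontrivial (Bdry n) := by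
  have : Nonempty (Fin (n - 1)) := ⟨⟨0, by omega⟩⟩
  exact Module.nontrivial_of_finrank_pos (R := ℝ) (by simp; omega)

theorem finrank_bdry (hn : 2 ≤ n) : (Module.finrank ℝ (Bdry n) : ℝ) = n - 1 := by
  rw [finrank_euclideanSpace_fin, Nat.cast_sub (by omega)]
  simp

theorem finrank_pt (hn : 2 ≤ n) : (Module.finrank ℝ (Pt n) : ℝ) = n := by
  rw [Module.finrank_prod, Nat.cast_add, finrank_bdry hn]
  simp

instance isAddHaarMeasure_volume_pt : (volume : Measure (Pt n)).IsAddHaarMeasure :=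
  inferInstanceAs (((volume : Measure (Bdry n)).prod (volume : Measure ℝ)).IsAddHaarMeasure)

/-- The homogeneity relation makes the integral scale invariant, so only convergence matters. The
three strict conditions govern `x` near the origin, near infinity and near `y`, treated in the
regions `|x| ≤ |y| / 2`, `|x| ≥ 2 |y|` and the shell between. The height is bounded by `|x|` in the
outer regions and by the distance to `y` in the shell. -/
theorem exists_lintegral_powKer_fst_le (hn : 2 ≤ n) {i j l m : ℝ} (hl : 0 ≤ l) (hm : 0 ≤ m)
    (h0 : i - l < n) (h1 : n < i - l + m) (h2 : m - l < n) (hhom : i + j + m - l = n) :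
    ∃ C : ℝ≥0∞, C ≠ ∞ ∧ ∀ y : Bdry n, y ≠ 0 →
      ∫⁻ x in upperHalf n, ENNReal.ofReal (powKer i j l m x y) ≤ C := by
  have := nontrivial_bdry hn
  have hfr := finrank_pt hn
  obtain ⟨C₁, hC₁, H₁⟩ := exists_lintegral_rpow_le_of_lt (volume : Measure (Pt n))
    norm_le_euclLength euclLength_le_two_mul_norm (e := i - l) (by rwa [hfr])
  obtain ⟨C₂, hC₂, H₂⟩ := exists_lintegral_rpow_le_of_gt (volume : Measure (Pt n))
    norm_le_euclLength euclLength_le_two_mul_norm (e := i - l + m) (by rwa [hfr])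
  obtain ⟨C₃, hC₃, H₃⟩ := exists_lintegral_rpow_le_of_lt (volume : Measure (Pt n))
    norm_le_euclLength euclLength_le_two_mul_norm (e := m - l) (by rwa [hfr])
  rw [hfr] at H₁ H₂ H₃
  set A : ℝ := 2 ^ m + 2 ^ |i| with hA
  have hA0 : 0 ≤ A := by positivity
  refine ⟨ENNReal.ofReal A * (C₁ + C₂ + C₃ * ENNReal.ofReal (3 ^ (n - (m - l)))),
    ENNReal.mul_ne_top ENNReal.ofReal_ne_top (ENNReal.add_ne_top.2
      ⟨ENNReal.add_ne_top.2 ⟨hC₁, hC₂⟩, ENNReal.mul_ne_top hC₃ ENNReal.ofReal_ne_top⟩),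
    fun y hy => ?_⟩
  set R := ‖y‖ with hR
  have hR0 : 0 < R := norm_pos_iff.2 hy
  set F₁ : Pt n → ℝ≥0∞ := {x : Pt n | euclLength x ≤ R}.indicator
    (fun x => ENNReal.ofReal (euclLength x ^ (-(i - l)))) with hF₁
  set F₂ : Pt n → ℝ≥0∞ := {x : Pt n | R < euclLength x}.indicator
    (fun x => ENNReal.ofReal (euclLength x ^ (-(i - l + m)))) with hF₂
  set F₃ : Pt n → ℝ≥0∞ := {x : Pt n | euclLength x ≤ 3 * R}.indicator
    (fun x => ENNReal.ofReal (euclLength x ^ (-(m - l)))) with hF₃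
  have ms₁ : MeasurableSet {x : Pt n | euclLength x ≤ R} :=
    measurableSet_le measurable_euclLength measurable_const
  have ms₂ : MeasurableSet {x : Pt n | R < euclLength x} :=
    measurableSet_lt measurable_const measurable_euclLength
  have ms₃ : MeasurableSet {x : Pt n | euclLength x ≤ 3 * R} :=
    measurableSet_le measurable_euclLength measurable_const
  have mF₁ : Measurable F₁ := Measurable.indicator (by fun_prop) ms₁
  have mF₂ : Measurable F₂ := Measurable.indicator (by fun_prop) ms₂
  have mF₃ : Measurable F₃ := Measurable.indicator (by fun_prop) ms₃
  have pt : ∀ x ∈ upperHalf n, ENNReal.ofReal (powKer i j l m x y) ≤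
      ENNReal.ofReal A * (F₁ x * ENNReal.ofReal (R ^ (i - l - n)) +
        F₂ x * ENNReal.ofReal (R ^ (i - l + m - n)) +
        F₃ (x - (y, 0)) * ENNReal.ofReal (R ^ (m - l - n))) := by
    intro x hx
    have hg := euclLength_pos hx
    have hρ := bdryDist_pos hx y
    have hx0 : 0 < x.2 := hx
    have hxg : x.2 ≤ euclLength x := (le_abs_self _).trans (abs_snd_le_euclLength x)
    have tri1 := norm_le_euclLength_add_bdryDist x y
    have tri2 := euclLength_le_bdryDist_add x y
    have tri3 := bdryDist_le_add x y
    rcases le_or_gt (euclLength x) (R / 2) with hc | hc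
    · have e1 : F₁ x = ENNReal.ofReal (euclLength x ^ (-(i - l))) :=
        Set.indicator_of_mem (s := {x : Pt n | euclLength x ≤ R})
          (by show euclLength x ≤ R; linarith) _
      refine le_trans ?_ (mul_le_mul' le_rfl (le_add_right (le_add_right le_rfl)))
      rw [e1, ← ENNReal.ofReal_mul (by positivity), ← ENNReal.ofReal_mul hA0]
      refine ENNReal.ofReal_le_ofReal ?_
      refine (rpow_prod_le_of_half_le hl hm hg hR0 hx0 hxg hR0 (by linarith)).trans ?_
      rw [mul_assoc (euclLength x ^ (-(i - l))), ← Real.rpow_add hR0,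
        show -j + -m = i - l - n by linarith]
      gcongr
      rw [hA]
      linarith [show (0 : ℝ) < 2 ^ |i| by positivity]
    rcases le_or_gt (2 * R) (euclLength x) with hc' | hc'
    · have e1 : F₂ x = ENNReal.ofReal (euclLength x ^ (-(i - l + m))) :=
        Set.indicator_of_mem (s := {x : Pt n | R < euclLength x})
          (by show R < euclLength x; linarith) _
      refine le_trans ?_ (mul_le_mul' le_rfl (le_add_right (le_add_left le_rfl)))
      rw [e1, ← ENNReal.ofReal_mul (by positivity), ← ENNReal.ofReal_mul hA0]
      refine ENNReal.ofReal_le_ofReal ?_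
      refine (rpow_prod_le_of_half_le hl hm hg hR0 hx0 hxg hg (by linarith)).trans ?_
      rw [mul_right_comm, ← Real.rpow_add hg,
        show -(i - l) + -m = -(i - l + m) by ring, show -j = i - l + m - n by linarith]
      gcongr
      rw [hA]
      linarith [show (0 : ℝ) < 2 ^ |i| by positivity]
    · have e1 : F₃ (x - (y, 0)) = ENNReal.ofReal (bdryDist x y ^ (-(m - l))) := by
        rw [bdryDist_eq]
        refine Set.indicator_of_mem (s := {x : Pt n | euclLength x ≤ 3 * R}) ?_ _
        show euclLength (x - (y, 0)) ≤ 3 * R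
        rw [← bdryDist_eq]
        linarith
      refine le_trans ?_ (mul_le_mul' le_rfl (le_add_left le_rfl))
      rw [e1, ← ENNReal.ofReal_mul (by positivity), ← ENNReal.ofReal_mul hA0]
      refine ENNReal.ofReal_le_ofReal ?_
      have b1 := rpow_neg_le_of_comparable hR0 hc.le hc'.le i
      have b2 := rpow_mul_rpow_neg_le (m := m) hl hx0 (snd_le_bdryDist x y)
      calc powKer i j l m x y
          = euclLength x ^ (-i) * R ^ (-j) * (x.2 ^ l * bdryDist x y ^ (-m)) := by
            rw [powKer]; ring
        _ ≤ (2 ^ |i| * R ^ (-i)) * R ^ (-j) * bdryDist x y ^ (-(m - l)) := by gcongr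
        _ = 2 ^ |i| * (bdryDist x y ^ (-(m - l)) * R ^ (m - l - n)) := by
            rw [show m - l - n = -i + -j by linarith, Real.rpow_add hR0]; ring
        _ ≤ _ := by
          gcongr
          rw [hA]
          linarith [show (0 : ℝ) < 2 ^ m by positivity]
  calc ∫⁻ x in upperHalf n, ENNReal.ofReal (powKer i j l m x y)
      ≤ ∫⁻ x in upperHalf n, ENNReal.ofReal A * (F₁ x * ENNReal.ofReal (R ^ (i - l - n)) +
        F₂ x * ENNReal.ofReal (R ^ (i - l + m - n)) +
        F₃ (x - (y, 0)) * ENNReal.ofReal (R ^ (m - l - n))) :=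
        setLIntegral_mono' measurableSet_upperHalf pt
    _ ≤ ∫⁻ x, ENNReal.ofReal A * (F₁ x * ENNReal.ofReal (R ^ (i - l - n)) +
        F₂ x * ENNReal.ofReal (R ^ (i - l + m - n)) +
        F₃ (x - (y, 0)) * ENNReal.ofReal (R ^ (m - l - n))) := setLIntegral_le_lintegral _ _
    _ = ENNReal.ofReal A * ((∫⁻ x, F₁ x) * ENNReal.ofReal (R ^ (i - l - n)) +
        (∫⁻ x, F₂ x) * ENNReal.ofReal (R ^ (i - l + m - n)) +
        (∫⁻ x, F₃ x) * ENNReal.ofReal (R ^ (m - l - n))) := by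
        rw [lintegral_const_mul _ (by fun_prop), lintegral_add_left (by fun_prop),
          lintegral_add_left (by fun_prop), lintegral_mul_const _ mF₁, lintegral_mul_const _ mF₂,
          lintegral_mul_const _ (by fun_prop), lintegral_sub_right_eq_self F₃]
    _ ≤ ENNReal.ofReal A * ((C₁ * ENNReal.ofReal (R ^ (n - (i - l)))) *
          ENNReal.ofReal (R ^ (i - l - n)) +
        (C₂ * ENNReal.ofReal (R ^ (n - (i - l + m)))) * ENNReal.ofReal (R ^ (i - l + m - n)) +
        (C₃ * ENNReal.ofReal ((3 * R) ^ (n - (m - l)))) * ENNReal.ofReal (R ^ (m - l - n))) := by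
        rw [lintegral_indicator ms₁, lintegral_indicator ms₂, lintegral_indicator ms₃]
        gcongr
        · exact H₁ R hR0
        · exact H₂ R hR0
        · exact H₃ (3 * R) (by positivity)
    _ = _ := by
        rw [mul_assoc C₁, mul_assoc C₂, ofReal_rpow_mul_rpow_neg hR0 (by ring),
          ofReal_rpow_mul_rpow_neg hR0 (by ring), Real.mul_rpow (by norm_num) hR0.le,
          ENNReal.ofReal_mul (by positivity), ← mul_assoc C₃, mul_assoc (C₃ * _),
          ofReal_rpow_mul_rpow_neg hR0 (by ring), mul_one, mul_one, mul_one]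

/-- The same splitting by scale invariance, now for `y` in dimension `n - 1`. The bound is uniform
in the height of `x` because the distance to `y` is at least `‖x.1 - y‖`. -/
theorem exists_lintegral_powKer_snd_le (hn : 2 ≤ n) {i j l m : ℝ} (hl : 0 ≤ l) (hm : 0 ≤ m)
    (h0 : j < n - 1) (h1 : n - 1 < j + m) (h2 : m - l < n - 1) (hhom : i + j + m - l = n - 1) :
    ∃ C : ℝ≥0∞, C ≠ ∞ ∧ ∀ x ∈ upperHalf n,
      ∫⁻ y, ENNReal.ofReal (powKer i j l m x y) ≤ C := by
  have := nontrivial_bdry hn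
  have hfr := finrank_bdry hn
  have hn1 : (0 : ℝ) < n - 1 := by
    have : (2 : ℝ) ≤ n := by exact_mod_cast hn
    linarith
  -- Replacing the distance by the smaller `‖x.1 - y‖` is legitimate only for a nonpositive power.
  -- If `m - l` is negative, the surplus power is bounded by the scale `3 R` instead.
  set γ := max (m - l) 0 with hγ
  have hγ0 : 0 ≤ γ := le_max_right _ _
  have hγm : 0 ≤ γ - (m - l) := by linarith [le_max_left (m - l) 0]
  have hnorm2 : ∀ y : Bdry n, ‖y‖ ≤ 2 * ‖y‖ := fun y => by linarith [norm_nonneg y]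
  obtain ⟨C₁, hC₁, H₁⟩ := exists_lintegral_rpow_le_of_lt (volume : Measure (Bdry n))
    (g := fun y => ‖y‖) (fun _ => le_rfl) hnorm2 (e := j) (by rwa [hfr])
  obtain ⟨C₂, hC₂, H₂⟩ := exists_lintegral_rpow_le_of_gt (volume : Measure (Bdry n))
    (g := fun y => ‖y‖) (fun _ => le_rfl) hnorm2 (e := j + m) (by rwa [hfr])
  obtain ⟨C₃, hC₃, H₃⟩ := exists_lintegral_rpow_le_of_lt (volume : Measure (Bdry n))
    (g := fun y => ‖y‖) (fun _ => le_rfl) hnorm2 (e := γ)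
    (by rw [hfr]; exact max_lt h2 hn1)
  rw [hfr] at H₁ H₂ H₃
  set A : ℝ := 2 ^ m + 2 ^ |j| * 3 ^ (γ - (m - l)) with hA
  have hA0 : 0 ≤ A := by positivity
  refine ⟨ENNReal.ofReal A * (C₁ + C₂ + C₃ * ENNReal.ofReal (3 ^ (n - 1 - γ))),
    ENNReal.mul_ne_top ENNReal.ofReal_ne_top (ENNReal.add_ne_top.2
      ⟨ENNReal.add_ne_top.2 ⟨hC₁, hC₂⟩, ENNReal.mul_ne_top hC₃ ENNReal.ofReal_ne_top⟩),
    fun x hx => ?_⟩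
  set R := euclLength x with hR
  have hR0 : 0 < R := euclLength_pos hx
  set F₁ : Bdry n → ℝ≥0∞ := {y : Bdry n | ‖y‖ ≤ R}.indicator
    (fun y => ENNReal.ofReal (‖y‖ ^ (-j))) with hF₁
  set F₂ : Bdry n → ℝ≥0∞ := {y : Bdry n | R < ‖y‖}.indicator
    (fun y => ENNReal.ofReal (‖y‖ ^ (-(j + m)))) with hF₂
  set F₃ : Bdry n → ℝ≥0∞ := {y : Bdry n | ‖y‖ ≤ 3 * R}.indicator
    (fun y => ENNReal.ofReal (‖y‖ ^ (-γ))) with hF₃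
  have ms₁ : MeasurableSet {y : Bdry n | ‖y‖ ≤ R} :=
    measurableSet_le measurable_norm measurable_const
  have ms₂ : MeasurableSet {y : Bdry n | R < ‖y‖} :=
    measurableSet_lt measurable_const measurable_norm
  have ms₃ : MeasurableSet {y : Bdry n | ‖y‖ ≤ 3 * R} :=
    measurableSet_le measurable_norm measurable_const
  have mF₁ : Measurable F₁ := Measurable.indicator (by fun_prop) ms₁
  have mF₂ : Measurable F₂ := Measurable.indicator (by fun_prop) ms₂
  have mF₃ : Measurable F₃ := Measurable.indicator (by fun_prop) ms₃
  have pt : ∀ y : Bdry n, y ≠ 0 → y ≠ x.1 → ENNReal.ofReal (powKer i j l m x y) ≤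
      ENNReal.ofReal A * (F₁ y * ENNReal.ofReal (R ^ (j - (n - 1))) +
        F₂ y * ENNReal.ofReal (R ^ (j + m - (n - 1))) +
        F₃ (x.1 - y) * ENNReal.ofReal (R ^ (γ - (n - 1)))) := by
    intro y hy hyx
    have hg : 0 < ‖y‖ := norm_pos_iff.2 hy
    have hd : 0 < ‖x.1 - y‖ := norm_pos_iff.2 (sub_ne_zero.2 hyx.symm)
    have hρ := bdryDist_pos hx y
    have hx0 : 0 < x.2 := hx
    have hxg : x.2 ≤ R := (le_abs_self _).trans (abs_snd_le_euclLength x)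
    have tri1 := norm_le_euclLength_add_bdryDist x y
    have tri2 := euclLength_le_bdryDist_add x y
    have tri3 := bdryDist_le_add x y
    rcases le_or_gt ‖y‖ (R / 2) with hc | hc
    · have e1 : F₁ y = ENNReal.ofReal (‖y‖ ^ (-j)) :=
        Set.indicator_of_mem (s := {y : Bdry n | ‖y‖ ≤ R}) (by show ‖y‖ ≤ R; linarith) _
      refine le_trans ?_ (mul_le_mul' le_rfl (le_add_right (le_add_right le_rfl)))
      rw [e1, ← ENNReal.ofReal_mul (by positivity), ← ENNReal.ofReal_mul hA0]
      refine ENNReal.ofReal_le_ofReal ?_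
      refine (rpow_prod_le_of_half_le hl hm hR0 hg hx0 hxg hR0 (by linarith)).trans ?_
      rw [mul_right_comm, ← Real.rpow_add hR0,
        show -(i - l) + -m = j - (n - 1) by linarith, mul_comm (R ^ _)]
      gcongr
      rw [hA]
      linarith [show (0 : ℝ) < 2 ^ |j| * 3 ^ (γ - (m - l)) by positivity]
    rcases le_or_gt (2 * R) ‖y‖ with hc' | hc'
    · have e1 : F₂ y = ENNReal.ofReal (‖y‖ ^ (-(j + m))) :=
        Set.indicator_of_mem (s := {y : Bdry n | R < ‖y‖}) (by show R < ‖y‖; linarith) _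
      refine le_trans ?_ (mul_le_mul' le_rfl (le_add_right (le_add_left le_rfl)))
      rw [e1, ← ENNReal.ofReal_mul (by positivity), ← ENNReal.ofReal_mul hA0]
      refine ENNReal.ofReal_le_ofReal ?_
      refine (rpow_prod_le_of_half_le hl hm hR0 hg hx0 hxg hg (by linarith)).trans ?_
      rw [mul_assoc (R ^ _), ← Real.rpow_add hg, show -j + -m = -(j + m) by ring,
        show -(i - l) = j + m - (n - 1) by linarith, mul_comm (R ^ _)]
      gcongr
      rw [hA]
      linarith [show (0 : ℝ) < 2 ^ |j| * 3 ^ (γ - (m - l)) by positivity]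
    · have e1 : F₃ (x.1 - y) = ENNReal.ofReal (‖x.1 - y‖ ^ (-γ)) := by
        refine Set.indicator_of_mem (s := {y : Bdry n | ‖y‖ ≤ 3 * R}) ?_ _
        show ‖x.1 - y‖ ≤ 3 * R
        linarith [norm_sub_le_bdryDist x y]
      refine le_trans ?_ (mul_le_mul' le_rfl (le_add_left le_rfl))
      rw [e1, ← ENNReal.ofReal_mul (by positivity), ← ENNReal.ofReal_mul hA0]
      refine ENNReal.ofReal_le_ofReal ?_
      have b1 := rpow_neg_le_of_comparable hR0 hc.le hc'.le j
      have b2 := rpow_mul_rpow_neg_le (m := m) hl hx0 (snd_le_bdryDist x y)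
      have b3 : bdryDist x y ^ (-(m - l)) ≤ ‖x.1 - y‖ ^ (-γ) * (3 * R) ^ (γ - (m - l)) := by
        rw [show -(m - l) = -γ + (γ - (m - l)) by ring, Real.rpow_add hρ]
        gcongr ?_ * ?_
        · exact Real.rpow_le_rpow_of_nonpos hd (norm_sub_le_bdryDist x y) (by linarith)
        · exact Real.rpow_le_rpow hρ.le (by linarith) hγm
      calc powKer i j l m x y
          = R ^ (-i) * ‖y‖ ^ (-j) * (x.2 ^ l * bdryDist x y ^ (-m)) := by
            rw [powKer]; ring
        _ ≤ R ^ (-i) * (2 ^ |j| * R ^ (-j)) *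
            (‖x.1 - y‖ ^ (-γ) * (3 * R) ^ (γ - (m - l))) := by
          exact mul_le_mul (by gcongr) (b2.trans b3) (by positivity) (by positivity)
        _ = (2 ^ |j| * 3 ^ (γ - (m - l))) * (‖x.1 - y‖ ^ (-γ) * R ^ (γ - (n - 1))) := by
            rw [show γ - (n - 1) = -i + (-j + (γ - (m - l))) by linarith, Real.rpow_add hR0,
              Real.rpow_add hR0, Real.mul_rpow (by norm_num) hR0.le]
            ring
        _ ≤ _ := by
          gcongr
          rw [hA]
          linarith [show (0 : ℝ) < 2 ^ m by positivity]
  calc ∫⁻ y, ENNReal.ofReal (powKer i j l m x y)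
      ≤ ∫⁻ y, ENNReal.ofReal A * (F₁ y * ENNReal.ofReal (R ^ (j - (n - 1))) +
        F₂ y * ENNReal.ofReal (R ^ (j + m - (n - 1))) +
        F₃ (x.1 - y) * ENNReal.ofReal (R ^ (γ - (n - 1)))) := by
        refine lintegral_mono_ae ?_
        filter_upwards [Measure.ae_ne volume (0 : Bdry n), Measure.ae_ne volume x.1] with y h1 h2
        exact pt y h1 h2
    _ = ENNReal.ofReal A * ((∫⁻ y, F₁ y) * ENNReal.ofReal (R ^ (j - (n - 1))) +
        (∫⁻ y, F₂ y) * ENNReal.ofReal (R ^ (j + m - (n - 1))) +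
        (∫⁻ y, F₃ y) * ENNReal.ofReal (R ^ (γ - (n - 1)))) := by
        rw [lintegral_const_mul _ (by fun_prop), lintegral_add_left (by fun_prop),
          lintegral_add_left (by fun_prop), lintegral_mul_const _ mF₁, lintegral_mul_const _ mF₂,
          lintegral_mul_const _ (by fun_prop), lintegral_sub_left_eq_self F₃]
    _ ≤ ENNReal.ofReal A * ((C₁ * ENNReal.ofReal (R ^ (n - 1 - j))) *
          ENNReal.ofReal (R ^ (j - (n - 1))) +
        (C₂ * ENNReal.ofReal (R ^ (n - 1 - (j + m)))) * ENNReal.ofReal (R ^ (j + m - (n - 1))) +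
        (C₃ * ENNReal.ofReal ((3 * R) ^ (n - 1 - γ))) * ENNReal.ofReal (R ^ (γ - (n - 1)))) := by
        rw [lintegral_indicator ms₁, lintegral_indicator ms₂, lintegral_indicator ms₃]
        gcongr
        · exact H₁ R hR0
        · exact H₂ R hR0
        · exact H₃ (3 * R) (by positivity)
    _ = _ := by
        rw [mul_assoc C₁, mul_assoc C₂, ofReal_rpow_mul_rpow_neg hR0 (by ring),
          ofReal_rpow_mul_rpow_neg hR0 (by ring), Real.mul_rpow (by norm_num) hR0.le,
          ENNReal.ofReal_mul (by positivity), ← mul_assoc C₃, mul_assoc (C₃ * _),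
          ofReal_rpow_mul_rpow_neg hR0 (by ring), mul_one, mul_one, mul_one]

/-- Exponents for splitting the weighted kernel in the Schur test. -/
theorem exists_schur_exponents {n α β lam μ s t : ℝ} (hn : 1 < n) (hμ : 0 < μ) (hs : 0 < s)
    (ht : 0 < t) (h1 : α < (n - 1) / t) (h2 : (n - 1) / t < α + μ)
    (hcrit : n / s + (n - 1) / t = α + β + μ - lam) (hαβ : 0 < α + β) :
    ∃ c d i j i' j' : ℝ, 0 < c ∧ 0 < d ∧
      (i - lam * c < n ∧ n < i - lam * c + μ * c ∧ μ * c - lam * c < n ∧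
        i + j + μ * c - lam * c = n) ∧
      (j' < n - 1 ∧ n - 1 < j' + μ * d ∧ μ * d - lam * d < n - 1 ∧
        i' + j' + μ * d - lam * d = n - 1) ∧
      i * (1 / s) + i' * (1 / t) = β ∧ j * (1 / s) + j' * (1 / t) = α ∧
      c * (1 / s) + d * (1 / t) = 1 := by
  have hn1 : (0 : ℝ) < n - 1 := by linarith
  have hn0 : (0 : ℝ) < n := by linarith
  obtain ⟨N, hN⟩ : ∃ N : ℝ, N = n / s + (n - 1) / t := ⟨_, rfl⟩
  have hN0 : 0 < N := by rw [hN]; positivity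
  -- `μ` and `lam` are shared out in proportion to the dimensions `n` and `n - 1`. As `α + β > 0`
  -- means `μ - lam < N`, both local singularities are then integrable at once.
  obtain ⟨c, hc⟩ : ∃ c : ℝ, c = n / N := ⟨_, rfl⟩
  obtain ⟨d, hd⟩ : ∃ d : ℝ, d = (n - 1) / N := ⟨_, rfl⟩
  have hc0 : 0 < c := by rw [hc]; positivity
  have hd0 : 0 < d := by rw [hd]; positivity
  -- `θ` locates `(n - 1) / t` between `α` and `α + μ`; `0 < θ < 1` is exactly what gives
  -- convergence at the origin and at infinity for both weights. The remaining exponents are fixed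
  -- by homogeneity.
  obtain ⟨θ, hθ⟩ : ∃ θ : ℝ, θ = ((n - 1) / t - α) / μ := ⟨_, rfl⟩
  have hθ0 : 0 < θ := by rw [hθ]; exact div_pos (by linarith) hμ
  have hθ1 : θ < 1 := by rw [hθ, div_lt_one hμ]; linarith
  have hμl : μ - lam < N := by linarith
  have hcd : c * (1 / s) + d * (1 / t) = 1 := by
    have : c * (1 / s) + d * (1 / t) = N / N := by rw [hc, hd, hN]; field_simp
    rw [this, div_self hN0.ne']
  have hcN : (μ - lam) * c < n := by
    rw [hc, ← mul_div_assoc, div_lt_iff₀ hN0]; nlinarith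
  have hdN : (μ - lam) * d < n - 1 := by
    rw [hd, ← mul_div_assoc, div_lt_iff₀ hN0]; nlinarith
  have hμc : 0 < μ * c := by positivity
  have hμd : 0 < μ * d := by positivity
  have hθc : μ * c * θ < μ * c := by nlinarith
  have hθc0 : 0 < μ * c * θ := by positivity
  have hθd : μ * d * θ < μ * d := by nlinarith
  have hθd0 : 0 < μ * d * θ := by positivity
  have hα' : -(μ * c * θ) * (1 / s) + (n - 1 - μ * d * θ) * (1 / t) = α := by
    have : -(μ * c * θ) * (1 / s) + (n - 1 - μ * d * θ) * (1 / t) =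
        (n - 1) / t - μ * θ * (c * (1 / s) + d * (1 / t)) := by ring
    rw [this, hcd, mul_one, hθ, mul_div_cancel₀ _ hμ.ne']
    ring
  refine ⟨c, d, n + μ * c * θ - (μ - lam) * c, -(μ * c * θ), μ * d * θ - (μ - lam) * d,
    n - 1 - μ * d * θ, hc0, hd0, ⟨by linarith, by linarith, by linarith, by ring⟩,
    ⟨by linarith, by linarith, by linarith, by ring⟩, ?_, hα', hcd⟩
  have : (n + μ * c * θ - (μ - lam) * c) * (1 / s) + (μ * d * θ - (μ - lam) * d) * (1 / t) =
      N - (-(μ * c * θ) * (1 / s) + (n - 1 - μ * d * θ) * (1 / t)) -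
        (μ - lam) * (c * (1 / s) + d * (1 / t)) := by
    rw [hN]; ring
  rw [this, hα', hcd]
  linarith

/-- The doubly weighted Hardy-Littlewood-Sobolev inequality on the upper half space, in the
superlinear range `p q ≥ 1`. -/
theorem exists_weighted_hls (hn : 2 ≤ n) {α β lam μ p q : ℝ} (hμ : 0 < μ) (hlam : 0 ≤ lam)
    (hp : 0 < p) (hq : 0 < q) (hpq : 1 ≤ p * q) (h1 : α < (n - 1) / (p + 1))
    (h2 : (n - 1) / (p + 1) < α + μ)
    (hcrit : n / (q + 1) + (n - 1) / (p + 1) = α + β + μ - lam) (hαβ : 0 < α + β) :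
    ∃ C : ℝ≥0∞, C ≠ ∞ ∧ ∀ f : Bdry n → ℝ≥0∞, Measurable f →
      ∫⁻ x in upperHalf n, (∫⁻ y, weightedKer α β lam μ x y * f y) ^ (q + 1) ≤
        C * (∫⁻ y, f y ^ ((p + 1) / p)) ^ ((q + 1) * p / (p + 1)) := by
  have hn' : (1 : ℝ) < n := by exact_mod_cast (by omega : 1 < n)
  obtain ⟨c, d, i, j, i', j', hc0, hd0, ⟨a1, a2, a3, a4⟩, ⟨b1, b2, b3, b4⟩, hβ', hα', hcd⟩ :=
    exists_schur_exponents hn' hμ (by linarith : 0 < q + 1) (by linarith : 0 < p + 1) h1 h2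
      hcrit hαβ
  obtain ⟨C₁, hC₁, H₁⟩ := exists_lintegral_powKer_fst_le hn (i := i) (j := j) (l := lam * c)
    (m := μ * c) (by positivity) (by positivity) a1 a2 a3 a4
  obtain ⟨C₂, hC₂, H₂⟩ := exists_lintegral_powKer_snd_le hn (i := i') (j := j') (l := lam * d)
    (m := μ * d) (by positivity) (by positivity) b1 b2 b3 b4
  refine ⟨C₁ * C₂ ^ ((q + 1) / (p + 1)), ENNReal.mul_ne_top hC₁
    (ENNReal.rpow_ne_top_of_nonneg (by positivity) hC₂), fun f hf => ?_⟩
  have e3 : lam * c * (1 / (q + 1)) + lam * d * (1 / (p + 1)) = lam := by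
    rw [mul_assoc, mul_assoc, ← mul_add, hcd, mul_one]
  have e4 : μ * c * (1 / (q + 1)) + μ * d * (1 / (p + 1)) = μ := by
    rw [mul_assoc, mul_assoc, ← mul_add, hcd, mul_one]
  have mw : ∀ i j l m : ℝ, Measurable
      (Function.uncurry fun (x : Pt n) y => ENNReal.ofReal (powKer i j l m x y)) :=
    fun i j l m => (measurable_powKer i j l m).ennreal_ofReal
  have := nontrivial_bdry hn
  have hk : ∀ᵐ x ∂(volume.restrict (upperHalf n)), ∀ᵐ y : Bdry n, weightedKer α β lam μ x y ≤
      ENNReal.ofReal (powKer i j (lam * c) (μ * c) x y) ^ (1 / (q + 1)) *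
      ENNReal.ofReal (powKer i' j' (lam * d) (μ * d) x y) ^ (1 / (p + 1)) := by
    filter_upwards [ae_restrict_mem measurableSet_upperHalf] with x hx
    filter_upwards [Measure.ae_ne volume (0 : Bdry n)] with y hy
    rw [weightedKer_eq_powKer _ _ _ _ hx hy,
      ENNReal.ofReal_rpow_of_nonneg (powKer_nonneg _ _ _ _ hx y) (by positivity),
      ENNReal.ofReal_rpow_of_nonneg (powKer_nonneg _ _ _ _ hx y) (by positivity),
      ← ENNReal.ofReal_mul (Real.rpow_nonneg (powKer_nonneg _ _ _ _ hx y) _),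
      powKer_rpow_mul_rpow hx hy, hα', hβ', e3, e4]
  -- `p + 1` is conjugate to `(p + 1) / p`, and `(p + 1) / p ≤ q + 1` amounts to `p q ≥ 1`.
  have key := lintegral_rpow_lintegral_le_of_schur (S := q + 1) (r := (p + 1) / p) (r' := p + 1)
    (mw i j (lam * c) (μ * c)) (mw i' j' (lam * d) (μ * d)) (by positivity) (by positivity)
    (by field_simp) (by rw [div_le_iff₀ hp]; nlinarith) hk (C₁ := C₁) (C₂ := C₂)
    ((Measure.ae_ne volume (0 : Bdry n)).mono fun y hy => H₁ y hy)
    ((ae_restrict_mem measurableSet_upperHalf).mono fun x hx => H₂ x hx) hf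
  rwa [div_div_eq_mul_div] at key

end PowKerIntegrals

/-! ### Folding an integral along an involution -/

section Comparison

variable {Z : Type*} [MeasurableSpace Z]

theorem lintegral_eq_setLIntegral_add_comp {ζ : Measure Z} {ρ : Z → Z}
    (hρ : MeasurePreserving ρ ζ ζ) {S : Set Z} (hS : MeasurableSet S)
    (hSρ : ρ ⁻¹' (ρ ⁻¹' S) = S) (hSc : ρ ⁻¹' S =ᵐ[ζ] (Sᶜ : Set Z)) {F : Z → ℝ≥0∞} (hF : Measurable F) :
    ∫⁻ z, F z ∂ζ = ∫⁻ z in S, (F z + F (ρ z)) ∂ζ := by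
  have h := hρ.setLIntegral_comp_preimage (hρ.measurable hS) hF
  rw [hSρ, setLIntegral_congr hSc] at h
  rw [lintegral_add_left hF, h, lintegral_add_compl F hS]

/-- The comparison inequality behind the method of moving planes. -/
theorem lintegral_le_lintegral_reflect_add {ζ : Measure Z} {ρ : Z → Z}
    (hρ : MeasurePreserving ρ ζ ζ) (hρρ : ∀ z, ρ (ρ z) = z) {S : Set Z} (hS : MeasurableSet S)
    (hSc : ρ ⁻¹' S =ᵐ[ζ] (Sᶜ : Set Z)) {b P₀ P₁ G : Z → ℝ≥0∞} (hb : Measurable b) (hP₀ : Measurable P₀)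
    (hP₁ : Measurable P₁) (hG : Measurable G) (h01 : ∀ z, P₀ (ρ z) = P₁ z)
    (hP : ∀ᵐ z ∂ζ, z ∈ S → P₁ z ≤ P₀ z) (hbb : ∀ᵐ z ∂ζ, z ∈ S → b z ≤ b (ρ z)) :
    ∫⁻ z, b z * P₀ z * G z ∂ζ ≤ ∫⁻ z, b z * P₁ z * G z ∂ζ +
      ∫⁻ z in S, b z * (P₀ z - P₁ z) * (G z - G (ρ z)) ∂ζ := by
  have hSρ : ρ ⁻¹' (ρ ⁻¹' S) = S := by
    ext z
    simp [hρρ]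
  have h10 : ∀ z, P₁ (ρ z) = P₀ z := fun z => by rw [← h01, hρρ]
  have hm := hρ.measurable
  rw [lintegral_eq_setLIntegral_add_comp hρ hS hSρ hSc
      (F := fun z => b z * P₀ z * G z) (by fun_prop),
    lintegral_eq_setLIntegral_add_comp hρ hS hSρ hSc
      (F := fun z => b z * P₁ z * G z) (by fun_prop),
    ← lintegral_add_left (by fun_prop)]
  refine lintegral_mono_ae ?_
  filter_upwards [ae_restrict_of_ae hP, ae_restrict_of_ae hbb, ae_restrict_mem hS] with z h1 h2 hz
  simp only [h01, h10]
  -- After folding onto `S`, the two integrands differ formally by `D (b G - (b ∘ ρ) (G ∘ ρ))`,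
  -- which is at most `D b (G - G ∘ ρ)⁺` since `b ≤ b ∘ ρ`. It is written additively because values
  -- may be infinite.
  obtain ⟨D, hD⟩ : ∃ D, D = P₀ z - P₁ z := ⟨_, rfl⟩
  have hD' : P₀ z = P₁ z + D := by rw [hD, add_tsub_cancel_of_le (h1 hz)]
  have hGG : G z ≤ G (ρ z) + (G z - G (ρ z)) := le_add_tsub
  rw [← hD, hD']
  calc b z * (P₁ z + D) * G z + b (ρ z) * P₁ z * G (ρ z)
      = b z * P₁ z * G z + b z * D * G z + b (ρ z) * P₁ z * G (ρ z) := by ring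
    _ ≤ b z * P₁ z * G z + b z * D * (G (ρ z) + (G z - G (ρ z))) +
        b (ρ z) * P₁ z * G (ρ z) := by gcongr
    _ = b z * P₁ z * G z + b z * D * G (ρ z) + b (ρ z) * P₁ z * G (ρ z) +
        b z * D * (G z - G (ρ z)) := by ring
    _ ≤ b z * P₁ z * G z + b (ρ z) * D * G (ρ z) + b (ρ z) * P₁ z * G (ρ z) +
        b z * D * (G z - G (ρ z)) := by
        gcongr
        exact h2 hz
    _ = _ := by ring

end Comparison

/-! ### Reflections in hyperplanes and their effect on the kernel -/

section Reflection

variable {n : ℕ}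

/-- The reflection in the hyperplane `⟨y, e⟩ = h`, for a unit vector `e`. -/
noncomputable def bdryReflect (e : Bdry n) (h : ℝ) (y : Bdry n) : Bdry n :=
  y + (2 * (h - inner ℝ y e)) • e

/-- The reflection of the half space in the hyperplane `⟨x', e⟩ = h`. -/
noncomputable def ptReflect (e : Bdry n) (h : ℝ) (x : Pt n) : Pt n := (bdryReflect e h x.1, x.2)

/-- The open half space beyond the hyperplane. -/
def beyond (e : Bdry n) (h : ℝ) : Set (Bdry n) := {y | h < inner ℝ y e}

variable {e : Bdry n} (he : ‖e‖ = 1) (h : ℝ)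
include he

theorem inner_bdryReflect (y : Bdry n) :
    inner ℝ (bdryReflect e h y) e = 2 * h - inner ℝ y e := by
  rw [bdryReflect, inner_add_left, inner_smul_left, real_inner_self_eq_norm_sq, he]
  simp
  ring

theorem bdryReflect_bdryReflect (y : Bdry n) : bdryReflect e h (bdryReflect e h y) = y := by
  rw [bdryReflect, inner_bdryReflect he, bdryReflect, add_assoc, ← add_smul]
  simp
  left
  ring

/-- The source of all reflection inequalities: the correction has the sign of the product of the two
signed distances to the hyperplane. The case `x = 0`, `h > 0` shows that reflecting from beyond
moves closer to the origin. -/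
theorem norm_sub_bdryReflect_sq (x y : Bdry n) : ‖x - bdryReflect e h y‖ ^ 2 =
    ‖x - y‖ ^ 2 + 4 * (inner ℝ x e - h) * (inner ℝ y e - h) := by
  rw [bdryReflect, ← sub_sub, norm_sub_sq_real, inner_smul_right, inner_sub_left, norm_smul, he,
    mul_one, Real.norm_eq_abs, sq_abs]
  ring

theorem norm_bdryReflect_sq (y : Bdry n) :
    ‖bdryReflect e h y‖ ^ 2 = ‖y‖ ^ 2 - 4 * h * (inner ℝ y e - h) := by
  have := norm_sub_bdryReflect_sq he h 0 y
  simp only [zero_sub, norm_neg, inner_zero_left] at this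
  rw [this]
  ring

theorem norm_bdryReflect_sub_bdryReflect (x y : Bdry n) :
    ‖bdryReflect e h x - bdryReflect e h y‖ = ‖x - y‖ := by
  have h1 : ‖bdryReflect e h x - bdryReflect e h y‖ ^ 2 = ‖x - y‖ ^ 2 := by
    rw [norm_sub_bdryReflect_sq he, inner_bdryReflect he, norm_sub_rev, norm_sub_bdryReflect_sq he,
      norm_sub_rev y]
    ring
  exact (sq_eq_sq₀ (norm_nonneg _) (norm_nonneg _)).1 h1

theorem norm_bdryReflect_sub (x y : Bdry n) :
    ‖bdryReflect e h x - y‖ = ‖x - bdryReflect e h y‖ := by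
  rw [← norm_bdryReflect_sub_bdryReflect he h, bdryReflect_bdryReflect he]

theorem bdryReflect_eq_reflection (y : Bdry n) :
    bdryReflect e h y = (Submodule.reflection (ℝ ∙ e)ᗮ) y + (2 * h) • e := by
  rw [Submodule.reflection_orthogonal_apply, Submodule.reflection_singleton_apply, bdryReflect, he,
    real_inner_comm]
  simp only [RCLike.ofReal_real_eq_id, id, one_pow, div_one]
  module

theorem measurePreserving_bdryReflect : MeasurePreserving (bdryReflect e h) := by
  have h1 : bdryReflect e h = (fun y => y + (2 * h) • e) ∘ (Submodule.reflection (ℝ ∙ e)ᗮ) := by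
    ext1 y
    exact bdryReflect_eq_reflection he h y
  rw [h1]
  exact (measurePreserving_add_right volume _).comp (LinearIsometryEquiv.measurePreserving _)

theorem measurePreserving_ptReflect : MeasurePreserving (ptReflect e h) :=
  (measurePreserving_bdryReflect he h).prod (MeasurePreserving.id volume)

theorem measurePreserving_ptReflect_upperHalf :
    MeasurePreserving (ptReflect e h) (volume.restrict (upperHalf n))
      (volume.restrict (upperHalf n)) :=
  (measurePreserving_ptReflect he h).restrict_preimage measurableSet_upperHalf

theorem ptReflect_ptReflect (x : Pt n) : ptReflect e h (ptReflect e h x) = x := by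
  ext1
  · exact bdryReflect_bdryReflect he h x.1
  · rfl

omit he in
theorem measurableSet_beyond : MeasurableSet (beyond e h) :=
  measurableSet_lt measurable_const (by fun_prop)

theorem ae_inner_ne : ∀ᵐ y : Bdry n, inner ℝ y e ≠ h := by
  have hne : (ℝ ∙ e)ᗮ ≠ ⊤ := by
    intro htop
    have : e ∈ (ℝ ∙ e)ᗮ := htop ▸ Submodule.mem_top
    rw [Submodule.mem_orthogonal_singleton_iff_inner_right, real_inner_self_eq_norm_sq, he] at this
    norm_num at this
  have h0 := Measure.addHaar_submodule (volume : Measure (Bdry n)) _ hne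
  have h1 : volume ((fun y => y + (-h) • e) ⁻¹' (((ℝ ∙ e)ᗮ : Submodule ℝ (Bdry n)) : Set (Bdry n)))
      = 0 := by rw [measure_preimage_add_right, h0]
  refine measure_mono_null (fun y hy => ?_) h1
  have hy' : inner ℝ y e = h := by simpa using hy
  show y + (-h) • e ∈ (ℝ ∙ e)ᗮ
  rw [Submodule.mem_orthogonal_singleton_iff_inner_left, inner_add_left, inner_smul_left,
    real_inner_self_eq_norm_sq, he, hy']
  simp

theorem preimage_beyond_ae_eq : bdryReflect e h ⁻¹' (beyond e h) =ᵐ[volume]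
    ((beyond e h)ᶜ : Set (Bdry n)) := by
  filter_upwards [ae_inner_ne he h] with y hy
  refine propext ?_
  show h < inner ℝ (bdryReflect e h y) e ↔ ¬ h < inner ℝ y e
  rw [inner_bdryReflect he, not_lt]
  constructor
  · intro h'
    linarith
  · intro h'
    have := lt_of_le_of_ne h' hy
    linarith

theorem ptReflect_preimage_ae_eq :
    ptReflect e h ⁻¹' (Prod.fst ⁻¹' beyond e h) =ᵐ[volume.restrict (upperHalf n)]
      ((Prod.fst ⁻¹' beyond e h)ᶜ : Set (Pt n)) := by
  refine ae_restrict_of_ae ?_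
  have hq : Measure.QuasiMeasurePreserving (Prod.fst : Pt n → Bdry n) volume volume :=
    Measure.quasiMeasurePreserving_fst
  exact hq.ae (preimage_beyond_ae_eq he h)

variable {h}

theorem norm_bdryReflect_lt (hh : 0 < h) {y : Bdry n} (hy : y ∈ beyond e h) :
    ‖bdryReflect e h y‖ < ‖y‖ := by
  have hy' : h < inner ℝ y e := hy
  refine lt_of_pow_lt_pow_left₀ 2 (norm_nonneg _) ?_
  rw [norm_bdryReflect_sq he]
  nlinarith

theorem norm_sub_le_norm_sub_bdryReflect {x y : Bdry n} (hx : x ∈ beyond e h)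
    (hy : y ∈ beyond e h) : ‖x - y‖ ≤ ‖x - bdryReflect e h y‖ := by
  have hx' : h < inner ℝ x e := hx
  have hy' : h < inner ℝ y e := hy
  refine le_of_sq_le_sq ?_ (norm_nonneg _)
  rw [norm_sub_bdryReflect_sq he]
  nlinarith

theorem euclLength_ptReflect_lt (hh : 0 < h) {x : Pt n} (hx : x.1 ∈ beyond e h) :
    euclLength (ptReflect e h x) < euclLength x := by
  have := norm_bdryReflect_lt he hh hx
  refine Real.sqrt_lt_sqrt (by positivity) ?_
  simp only [ptReflect]
  gcongr

theorem kerP_ptReflect (lam μ : ℝ) (x : Pt n) (y : Bdry n) :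
    kerP lam μ (ptReflect e h x) y = kerP lam μ x (bdryReflect e h y) := by
  simp only [kerP, ptReflect, norm_bdryReflect_sub he]

theorem kerP_bdryReflect_le {lam μ : ℝ} (hμ : 0 ≤ μ) {x : Pt n} (hx0 : 0 < x.2)
    (hx : x.1 ∈ beyond e h) {y : Bdry n} (hy : y ∈ beyond e h) :
    kerP lam μ x (bdryReflect e h y) ≤ kerP lam μ x y := by
  have := norm_sub_le_norm_sub_bdryReflect he hx hy
  unfold kerP
  gcongr

end Reflection

/-! ### The reflected system and the antisymmetrised kernel -/

section System

variable {n : ℕ}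

/-- The weight `|y|^{-a}` on the boundary. -/
noncomputable def bdryWeight (a : ℝ) (y : Bdry n) : ℝ≥0∞ := ENNReal.ofReal ‖y‖ ^ (-a)

/-- The weight `|x|^{-b}` on the half space. -/
noncomputable def ptWeight (b : ℝ) (x : Pt n) : ℝ≥0∞ := ENNReal.ofReal (euclLength x) ^ (-b)

/-- The unweighted kernel with values in `[0, ∞]`. -/
noncomputable def poissonKer (lam μ : ℝ) (x : Pt n) (y : Bdry n) : ℝ≥0∞ :=
  ENNReal.ofReal (kerP lam μ x y)

/-- The antisymmetrised weighted kernel. -/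
noncomputable def diffKer (a b lam μ : ℝ) (e : Bdry n) (h : ℝ) (x : Pt n) (y : Bdry n) : ℝ≥0∞ :=
  bdryWeight a y * (poissonKer lam μ x y - poissonKer lam μ x (bdryReflect e h y)) * ptWeight b x

theorem weightedKer_eq_mul (a b lam μ : ℝ) (x : Pt n) (y : Bdry n) :
    weightedKer a b lam μ x y = bdryWeight a y * poissonKer lam μ x y * ptWeight b x := rfl

theorem diffKer_le_weightedKer (a b lam μ : ℝ) (e : Bdry n) (h : ℝ) (x : Pt n) (y : Bdry n) :
    diffKer a b lam μ e h x y ≤ weightedKer a b lam μ x y := by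
  rw [weightedKer_eq_mul, diffKer]
  gcongr
  exact tsub_le_self

@[fun_prop]
theorem measurable_bdryWeight (a : ℝ) : Measurable (bdryWeight a : Bdry n → ℝ≥0∞) := by
  unfold bdryWeight
  fun_prop

@[fun_prop]
theorem measurable_ptWeight (b : ℝ) : Measurable (ptWeight b : Pt n → ℝ≥0∞) := by
  unfold ptWeight
  fun_prop

theorem measurable_poissonKer (lam μ : ℝ) :
    Measurable (fun z : Pt n × Bdry n => poissonKer lam μ z.1 z.2) := by
  unfold poissonKer kerP
  fun_prop

@[fun_prop]
theorem measurable_poissonKer_comp {Z : Type*} [MeasurableSpace Z] (lam μ : ℝ) {f : Z → Pt n}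
    {g : Z → Bdry n} (hf : Measurable f) (hg : Measurable g) :
    Measurable (fun z => poissonKer lam μ (f z) (g z)) :=
  (measurable_poissonKer lam μ).comp (hf.prodMk hg)

@[fun_prop]
theorem measurable_bdryReflect (e : Bdry n) (h : ℝ) : Measurable (bdryReflect e h) := by
  unfold bdryReflect
  fun_prop

@[fun_prop]
theorem measurable_ptReflect (e : Bdry n) (h : ℝ) : Measurable (ptReflect e h) := by
  unfold ptReflect
  fun_prop

@[fun_prop]
theorem measurable_diffKer (a b lam μ : ℝ) (e : Bdry n) (h : ℝ) :
    Measurable (fun z : Pt n × Bdry n => diffKer a b lam μ e h z.1 z.2) := by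
  unfold diffKer
  fun_prop

@[fun_prop]
theorem measurable_weightedKer (a b lam μ : ℝ) :
    Measurable (fun z : Pt n × Bdry n => weightedKer a b lam μ z.1 z.2) := by
  simp only [weightedKer_eq_mul]
  fun_prop

theorem bdryWeight_le {a : ℝ} (ha : 0 ≤ a) {y z : Bdry n} (h : ‖y‖ ≤ ‖z‖) :
    bdryWeight a z ≤ bdryWeight a y := by
  unfold bdryWeight
  rw [ENNReal.rpow_neg, ENNReal.rpow_neg]
  gcongr

theorem ptWeight_le {b : ℝ} (hb : 0 ≤ b) {x z : Pt n} (h : euclLength x ≤ euclLength z) :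
    ptWeight b z ≤ ptWeight b x := by
  unfold ptWeight
  rw [ENNReal.rpow_neg, ENNReal.rpow_neg]
  gcongr

theorem bdryWeight_lt {a : ℝ} (ha : 0 < a) {y z : Bdry n} (h : ‖y‖ < ‖z‖) :
    bdryWeight a z < bdryWeight a y := by
  unfold bdryWeight
  rw [ENNReal.rpow_neg, ENNReal.rpow_neg, ENNReal.inv_lt_inv]
  refine ENNReal.rpow_lt_rpow ?_ ha
  exact (ENNReal.ofReal_lt_ofReal_iff ((norm_nonneg y).trans_lt h)).2 h

theorem bdryWeight_pos {a : ℝ} (ha : 0 ≤ a) (y : Bdry n) : bdryWeight a y ≠ 0 := by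
  unfold bdryWeight
  rw [ENNReal.rpow_neg]
  exact ENNReal.inv_ne_zero.2 (ENNReal.rpow_ne_top_of_nonneg ha ENNReal.ofReal_ne_top)

theorem bdryWeight_ne_top {a : ℝ} {y : Bdry n} (hy : y ≠ 0) : bdryWeight a y ≠ ∞ := by
  unfold bdryWeight
  rw [ENNReal.ofReal_rpow_of_pos (norm_pos_iff.2 hy)]
  exact ENNReal.ofReal_ne_top

theorem ptWeight_eq {b : ℝ} {x : Pt n} (hx : 0 < x.2) :
    ptWeight b x = ENNReal.ofReal (euclLength x ^ (-b)) := by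
  rw [ptWeight, ENNReal.ofReal_rpow_of_pos (euclLength_pos hx)]

theorem ptWeight_ne_zero {b : ℝ} {x : Pt n} (hx : 0 < x.2) : ptWeight b x ≠ 0 := by
  rw [ptWeight_eq hx]
  exact (ENNReal.ofReal_pos.2 (Real.rpow_pos_of_pos (euclLength_pos hx) _)).ne'

theorem ptWeight_ne_top {b : ℝ} {x : Pt n} (hx : 0 < x.2) : ptWeight b x ≠ ∞ := by
  rw [ptWeight_eq hx]
  exact ENNReal.ofReal_ne_top

theorem ptWeight_lt {b : ℝ} (hb : 0 < b) {x z : Pt n} (h : euclLength x < euclLength z) :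
    ptWeight b z < ptWeight b x := by
  unfold ptWeight
  rw [ENNReal.rpow_neg, ENNReal.rpow_neg, ENNReal.inv_lt_inv]
  refine ENNReal.rpow_lt_rpow ?_ hb
  exact (ENNReal.ofReal_lt_ofReal_iff ((euclLength_nonneg x).trans_lt h)).2 h

theorem poissonKer_ne_zero (lam μ : ℝ) {x : Pt n} (hx : 0 < x.2) (y : Bdry n) :
    poissonKer lam μ x y ≠ 0 := by
  have := bdryDist_pos hx y
  rw [poissonKer, kerP_eq]
  exact (ENNReal.ofReal_pos.2 (by positivity)).ne'

variable {a b lam μ p q : ℝ} {u : Bdry n → ℝ≥0∞} {v : Pt n → ℝ≥0∞}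

theorem IsPositiveSolution.u_eq_mul (hs : IsPositiveSolution n a b lam μ p q u v)
    (hv : Measurable v) (y : Bdry n) : u y = bdryWeight a y *
      ∫⁻ x in upperHalf n, ptWeight b x * poissonKer lam μ x y * v x ^ q := by
  rw [hs.u_eq, ← lintegral_const_mul _ (by fun_prop)]
  refine lintegral_congr fun x => ?_
  rw [weightedKer_eq_mul]
  ring

theorem IsPositiveSolution.v_eq_mul (hs : IsPositiveSolution n a b lam μ p q u v)
    (hu : Measurable u) {x : Pt n} (hx : x ∈ upperHalf n) : v x = ptWeight b x *
      ∫⁻ y, bdryWeight a y * poissonKer lam μ x y * u y ^ p := by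
  rw [hs.v_eq x hx, ← lintegral_const_mul _ (by fun_prop)]
  refine lintegral_congr fun x => ?_
  rw [weightedKer_eq_mul]
  ring

variable {e : Bdry n} {h : ℝ}

/-- The half space beyond the plane, as a measure. -/
noncomputable def ptBeyond (e : Bdry n) (h : ℝ) : Measure (Pt n) :=
  (volume.restrict (upperHalf n)).restrict (Prod.fst ⁻¹' beyond e h)

theorem ae_ptBeyond (e : Bdry n) (h : ℝ) :
    ∀ᵐ x ∂(ptBeyond e h), x ∈ upperHalf n ∧ x.1 ∈ beyond e h := by
  filter_upwards [ae_restrict_of_ae (ae_restrict_mem measurableSet_upperHalf),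
    ae_restrict_mem (measurable_fst (measurableSet_beyond h))] with x h1 h2
  exact ⟨h1, h2⟩

/-- The folding inequality, with reflection of `x` turned into reflection of `y` in the kernel. The
outer weight in `y` is left out, so the same estimate serves both the difference bound and the
weighted comparison. -/
theorem lintegral_ptWeight_le (he : ‖e‖ = 1) (hh : 0 < h) (hb : 0 ≤ b) (hμ : 0 ≤ μ)
    (hv : Measurable v) {y : Bdry n} (hy : y ∈ beyond e h) :
    ∫⁻ x in upperHalf n, ptWeight b x * poissonKer lam μ x y * v x ^ q ≤
      (∫⁻ x in upperHalf n, ptWeight b x * poissonKer lam μ x (bdryReflect e h y) * v x ^ q) +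
      ∫⁻ x, ptWeight b x * (poissonKer lam μ x y - poissonKer lam μ x (bdryReflect e h y)) *
        (v x ^ q - v (ptReflect e h x) ^ q) ∂(ptBeyond e h) := by
  refine lintegral_le_lintegral_reflect_add (measurePreserving_ptReflect_upperHalf he h)
    (ptReflect_ptReflect he h) (measurable_fst (measurableSet_beyond h))
    (ptReflect_preimage_ae_eq he h) (by fun_prop) (by fun_prop) (by fun_prop) (hv.pow_const q)
    (fun x => ?_) ?_ ?_
  · simp only [poissonKer, kerP_ptReflect he]
  · filter_upwards [ae_restrict_mem measurableSet_upperHalf] with x hx hxS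
    exact ENNReal.ofReal_le_ofReal (kerP_bdryReflect_le he hμ hx hxS hy)
  · filter_upwards with x hxS
    exact ptWeight_le hb (euclLength_ptReflect_lt he hh hxS).le

theorem lintegral_bdryWeight_le (he : ‖e‖ = 1) (hh : 0 < h) (ha : 0 ≤ a) (hμ : 0 ≤ μ)
    (hu : Measurable u) {x : Pt n} (hx0 : x ∈ upperHalf n) (hx : x.1 ∈ beyond e h) :
    ∫⁻ y, bdryWeight a y * poissonKer lam μ x y * u y ^ p ≤
      (∫⁻ y, bdryWeight a y * poissonKer lam μ x (bdryReflect e h y) * u y ^ p) +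
      ∫⁻ y in beyond e h, bdryWeight a y *
        (poissonKer lam μ x y - poissonKer lam μ x (bdryReflect e h y)) *
        (u y ^ p - u (bdryReflect e h y) ^ p) := by
  refine lintegral_le_lintegral_reflect_add (measurePreserving_bdryReflect he h)
    (bdryReflect_bdryReflect he h) (measurableSet_beyond h)
    (preimage_beyond_ae_eq he h) (by fun_prop) (by fun_prop) (by fun_prop) (hu.pow_const p)
    (fun x => rfl) ?_ ?_
  · filter_upwards with y hy
    exact ENNReal.ofReal_le_ofReal (kerP_bdryReflect_le he hμ hx0 hx hy)
  · filter_upwards with y hy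
    exact bdryWeight_le ha (norm_bdryReflect_lt he hh hy).le

theorem IsPositiveSolution.v_ptReflect_eq (hs : IsPositiveSolution n a b lam μ p q u v)
    (he : ‖e‖ = 1) (hu : Measurable u) {x : Pt n} (hx : x ∈ upperHalf n) :
    v (ptReflect e h x) = ptWeight b (ptReflect e h x) *
      ∫⁻ y, bdryWeight a y * poissonKer lam μ x (bdryReflect e h y) * u y ^ p := by
  rw [hs.v_eq_mul hu (show ptReflect e h x ∈ upperHalf n from hx)]
  simp only [poissonKer, kerP_ptReflect he]

/-- Reflection increases the outer weight, so replacing it in the main term only helps, and the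
folding correction remains. -/
theorem IsPositiveSolution.u_sub_le (hs : IsPositiveSolution n a b lam μ p q u v)
    (he : ‖e‖ = 1) (hh : 0 < h) (ha : 0 ≤ a) (hb : 0 ≤ b) (hμ : 0 ≤ μ)
    (hv : Measurable v) {y : Bdry n} (hy : y ∈ beyond e h) :
    u y - u (bdryReflect e h y) ≤ ∫⁻ x, diffKer a b lam μ e h x y *
      (v x ^ q - v (ptReflect e h x) ^ q) ∂(ptBeyond e h) := by
  rw [tsub_le_iff_left, hs.u_eq_mul hv y, hs.u_eq_mul hv (bdryReflect e h y)]
  refine (mul_le_mul' le_rfl (lintegral_ptWeight_le he hh hb hμ hv hy)).trans ?_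
  rw [mul_add]
  refine add_le_add (mul_le_mul' (bdryWeight_le ha (norm_bdryReflect_lt he hh hy).le) le_rfl) ?_
  rw [← lintegral_const_mul _ (by fun_prop)]
  refine (lintegral_congr fun x => ?_).le
  rw [diffKer]
  ring

theorem IsPositiveSolution.v_sub_le (hs : IsPositiveSolution n a b lam μ p q u v)
    (he : ‖e‖ = 1) (hh : 0 < h) (ha : 0 ≤ a) (hb : 0 ≤ b) (hμ : 0 ≤ μ)
    (hu : Measurable u) {x : Pt n} (hx0 : x ∈ upperHalf n) (hx : x.1 ∈ beyond e h) :
    v x - v (ptReflect e h x) ≤ ∫⁻ y in beyond e h, diffKer a b lam μ e h x y *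
      (u y ^ p - u (bdryReflect e h y) ^ p) := by
  rw [tsub_le_iff_left, hs.v_eq_mul hu hx0, hs.v_ptReflect_eq he hu hx0]
  refine (mul_le_mul' le_rfl (lintegral_bdryWeight_le he hh ha hμ hu hx0 hx)).trans ?_
  rw [mul_add]
  refine add_le_add (mul_le_mul' (ptWeight_le hb (euclLength_ptReflect_lt he hh hx).le) le_rfl) ?_
  rw [← lintegral_const_mul _ (by fun_prop)]
  refine (lintegral_congr fun x => ?_).le
  rw [diffKer]
  ring

/-- The correction term vanishes once `u` is ordered, leaving an ordering of the unweighted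
integrals. Keeping the outer weights cross-multiplied gives the weak, the strict and the uniform
comparison of `v` from one inequality, even for infinite values. -/
theorem IsPositiveSolution.ptWeight_mul_le (hs : IsPositiveSolution n a b lam μ p q u v)
    (he : ‖e‖ = 1) (hh : 0 < h) (ha : 0 ≤ a) (hμ : 0 ≤ μ) (hp : 0 ≤ p) (hu : Measurable u)
    (hle : ∀ᵐ y, y ∈ beyond e h → u y ≤ u (bdryReflect e h y))
    {x : Pt n} (hx0 : x ∈ upperHalf n) (hx : x.1 ∈ beyond e h) :
    ptWeight b (ptReflect e h x) * v x ≤ ptWeight b x * v (ptReflect e h x) := by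
  have h1 := lintegral_bdryWeight_le (lam := lam) (p := p) he hh ha hμ hu hx0 hx
  rw [setLIntegral_congr_fun_ae (g := 0) (measurableSet_beyond h), lintegral_zero_fun,
    add_zero] at h1
  · rw [hs.v_eq_mul hu hx0, hs.v_ptReflect_eq he hu hx0, mul_left_comm]
    gcongr
  · filter_upwards [hle] with y hy hyS
    rw [tsub_eq_zero_of_le (ENNReal.rpow_le_rpow (hy hyS) hp), mul_zero]
    rfl

theorem IsPositiveSolution.bdryWeight_mul_le (hs : IsPositiveSolution n a b lam μ p q u v)
    (he : ‖e‖ = 1) (hh : 0 < h) (hb : 0 ≤ b) (hμ : 0 ≤ μ) (hq : 0 ≤ q) (hv : Measurable v)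
    (hle : ∀ x ∈ upperHalf n, x.1 ∈ beyond e h → v x ≤ v (ptReflect e h x))
    {y : Bdry n} (hy : y ∈ beyond e h) :
    bdryWeight a (bdryReflect e h y) * u y ≤ bdryWeight a y * u (bdryReflect e h y) := by
  have h1 := lintegral_ptWeight_le (lam := lam) (q := q) he hh hb hμ hv hy
  rw [lintegral_congr_ae (μ := ptBeyond e h) (g := 0), lintegral_zero_fun, add_zero] at h1
  · rw [hs.u_eq_mul hv y, hs.u_eq_mul hv (bdryReflect e h y), mul_left_comm]
    gcongr
  · filter_upwards [ae_ptBeyond e h] with x hx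
    rw [tsub_eq_zero_of_le (ENNReal.rpow_le_rpow (hle x hx.1 hx.2) hq), mul_zero]
    rfl

end System

/-! ### From the solution to the normalised sub-Markovian system -/

section SmallSupport

/-- The positive part of a difference of powers depends, relative to `v ^ q`, only on the relative
deficit `(v - w)⁺ / v`. Both sides vanish when `w ≥ v`. -/
theorem ENNReal.rpow_mul_one_sub_one_sub_div_rpow {v w : ℝ≥0∞} (hv0 : v ≠ 0) (hv : v ≠ ∞) {q : ℝ}
    (hq : 0 < q) : v ^ q * (1 - (1 - (v - w) / v) ^ q) = v ^ q - w ^ q := by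
  rcases le_total w v with h | h
  · have h1 : 1 - (v - w) / v = w / v := by
      rw [ENNReal.sub_div (fun _ _ => hv0), ENNReal.div_self hv0 hv]
      exact ENNReal.sub_sub_cancel ENNReal.one_ne_top (ENNReal.div_le_of_le_mul (by simpa))
    rw [h1, ENNReal.mul_sub (fun _ _ => ENNReal.rpow_ne_top_of_nonneg hq.le hv), mul_one,
      ← ENNReal.mul_rpow_of_nonneg _ _ hq.le, ENNReal.mul_div_cancel hv0 hv]
  · rw [tsub_eq_zero_of_le h, tsub_eq_zero_of_le (ENNReal.rpow_le_rpow h hq.le)]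
    simp

theorem ENNReal.rpow_add_one_mul_inv {v : ℝ≥0∞} (hv0 : v ≠ 0) (hv : v ≠ ∞) (q : ℝ) :
    v ^ (q + 1) * v⁻¹ = v ^ q := by
  rw [ENNReal.rpow_add _ _ hv0 hv, ENNReal.rpow_one, mul_assoc, ENNReal.mul_inv_cancel hv0 hv,
    mul_one]

theorem ENNReal.ae_ne_top_of_lintegral_rpow {Z : Type*} [MeasurableSpace Z] {ζ : Measure Z}
    {f : Z → ℝ≥0∞} (hf : Measurable f) {s : ℝ} (hs : 0 < s) (h : ∫⁻ z, f z ^ s ∂ζ ≠ ∞) :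
    ∀ᵐ z ∂ζ, f z ≠ ∞ := by
  filter_upwards [ae_lt_top (hf.pow_const s) h] with z hz
  intro h0
  rw [h0, ENNReal.top_rpow_of_pos hs] at hz
  exact lt_irrefl _ hz

variable {n : ℕ} {a b lam μ p q : ℝ} {u : Bdry n → ℝ≥0∞} {v : Pt n → ℝ≥0∞} {e : Bdry n} {h : ℝ}

theorem restrict_upperHalf_compl_beyond_ne_zero (hh : 0 < h) :
    (volume.restrict (upperHalf n)) (Prod.fst ⁻¹' beyond e h)ᶜ ≠ 0 := by
  rw [Measure.restrict_apply (measurable_fst (measurableSet_beyond h)).compl]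
  have hopen : IsOpen {x : Pt n | inner ℝ x.1 e < h ∧ 0 < x.2} :=
    (isOpen_lt (f := fun x : Pt n => inner ℝ x.1 e) (by fun_prop) continuous_const).inter
      (isOpen_lt continuous_const continuous_snd)
  have hpos := hopen.measure_pos volume ⟨(0, 1), by simpa using hh⟩
  have hsub : {x : Pt n | inner ℝ x.1 e < h ∧ 0 < x.2} ⊆
      (Prod.fst ⁻¹' beyond e h)ᶜ ∩ upperHalf n :=
    fun x hx => ⟨fun hx' => lt_asymm hx.1 hx', hx.2⟩
  exact (hpos.trans_le (measure_mono hsub)).ne'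

/-- Strictness comes from the part of the integral for `u y` over the near side of the hyperplane,
which is positive and is discarded on the left; finiteness of `u y` keeps the loss visible. -/
theorem IsPositiveSolution.lintegral_diffKer_lt (hs : IsPositiveSolution n a b lam μ p q u v)
    (ha : 0 ≤ a) (hq : 0 ≤ q) (hh : 0 < h) (hv : Measurable v) {y : Bdry n} (hy : u y ≠ ∞) :
    ∫⁻ x, diffKer a b lam μ e h x y * v x ^ q ∂(ptBeyond e h) < u y := by
  have hmS : MeasurableSet (Prod.fst ⁻¹' beyond e h : Set (Pt n)) :=
    measurable_fst (measurableSet_beyond h)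
  have hm : Measurable fun x => weightedKer a b lam μ x y * v x ^ q := by
    simp only [weightedKer_eq_mul]
    fun_prop
  have hpos : 0 < ∫⁻ x in (Prod.fst ⁻¹' beyond e h)ᶜ, weightedKer a b lam μ x y * v x ^ q
      ∂(volume.restrict (upperHalf n)) := by
    rw [lintegral_pos_iff_support hm, pos_iff_ne_zero]
    intro h0
    refine restrict_upperHalf_compl_beyond_ne_zero (n := n) (e := e) hh ?_
    rw [← Measure.restrict_apply_self, ← nonpos_iff_eq_zero]
    refine le_trans (measure_mono_ae ?_) h0.le
    filter_upwards [ae_restrict_of_ae (ae_restrict_mem measurableSet_upperHalf)] with x hx _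
    show weightedKer a b lam μ x y * v x ^ q ≠ 0
    rw [weightedKer_eq_mul]
    refine mul_ne_zero (mul_ne_zero (mul_ne_zero (bdryWeight_pos ha y)
      (poissonKer_ne_zero _ _ hx y)) (ptWeight_ne_zero hx)) ?_
    rw [Ne, ENNReal.rpow_eq_zero_iff]
    rintro (⟨h1, -⟩ | ⟨-, h1⟩)
    · exact (hs.v_pos x hx).ne' h1
    · exact not_lt.2 hq h1
  have hsum := lintegral_add_compl (μ := volume.restrict (upperHalf n))
    (fun x => weightedKer a b lam μ x y * v x ^ q) hmS
  rw [← hs.u_eq y] at hsum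
  calc _ ≤ ∫⁻ x, weightedKer a b lam μ x y * v x ^ q ∂(ptBeyond e h) := by
        gcongr
        exact diffKer_le_weightedKer _ _ _ _ _ _ _ _
    _ < u y := by
        rw [← hsum]
        refine ENNReal.lt_add_right ?_ hpos.ne'
        refine ne_top_of_le_ne_top hy ?_
        rw [← hsum]
        exact le_self_add

/-- The reflection inequality holds as soon as the set where it fails carries little mass of
`u ^ (p + 1)`, with a threshold independent of the hyperplane. -/
theorem IsPositiveSolution.exists_pos_forall_le_reflect
    (hs : IsPositiveSolution n a b lam μ p q u v) (ha : 0 ≤ a) (hb : 0 ≤ b) (hμ : 0 ≤ μ)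
    (hp : 0 < p) (hq : 0 < q) (hu : Measurable u) (hv : Measurable v)
    (hufin : ∫⁻ y, u y ^ (p + 1) ≠ ∞) (hvfin : ∫⁻ x in upperHalf n, v x ^ (q + 1) ≠ ∞)
    (hHLS : 1 < p * q → ∃ C : ℝ≥0∞, C ≠ ∞ ∧ ∀ f : Bdry n → ℝ≥0∞, Measurable f →
      ∫⁻ x in upperHalf n, (∫⁻ y, weightedKer a b lam μ x y * f y) ^ (q + 1) ≤
        C * (∫⁻ y, f y ^ ((p + 1) / p)) ^ ((q + 1) * p / (p + 1))) :
    ∃ ε : ℝ≥0∞, 0 < ε ∧ ∀ (e : Bdry n) (h : ℝ), ‖e‖ = 1 → 0 < h →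
      ∫⁻ y in beyond e h ∩ {y | u (bdryReflect e h y) < u y}, u y ^ (p + 1) < ε →
      ∀ᵐ y, y ∈ beyond e h → u y ≤ u (bdryReflect e h y) := by
  have huae : ∀ᵐ y, u y ≠ ∞ := ENNReal.ae_ne_top_of_lintegral_rpow hu (by linarith) hufin
  have hvae : ∀ᵐ x ∂(volume.restrict (upperHalf n)), v x ≠ ∞ :=
    ENNReal.ae_ne_top_of_lintegral_rpow hv (by linarith) hvfin
  obtain ⟨C, hC, hHLS'⟩ : ∃ C : ℝ≥0∞, C ≠ ∞ ∧ (1 < p * q → ∀ f : Bdry n → ℝ≥0∞, Measurable f →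
      ∫⁻ x in upperHalf n, (∫⁻ y, weightedKer a b lam μ x y * f y) ^ (q + 1) ≤
        C * (∫⁻ y, f y ^ ((p + 1) / p)) ^ ((q + 1) * p / (p + 1))) := by
    by_cases hpq : 1 < p * q
    · obtain ⟨C, hC, hC'⟩ := hHLS hpq
      exact ⟨C, hC, fun _ => hC'⟩
    -- In the sublinear range the estimate is never invoked, so any finite constant will do.
    · exact ⟨0, ENNReal.zero_ne_top, fun h => absurd h hpq⟩
  obtain ⟨ε, hε, H⟩ := exists_pos_ae_eq_zero_of_system (X := Pt n) (Y := Bdry n) hp hq hC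
  refine ⟨ε, hε, fun e h he hh hsmall => ?_⟩
  have hmS := measurableSet_beyond (e := e) h
  set m : Measure (Bdry n) := (volume.restrict (beyond e h)).withDensity fun y => u y ^ (p + 1)
    with hm
  set ν : Measure (Pt n) := (ptBeyond e h).withDensity fun x => v x ^ (q + 1) with hν
  have hup : Measurable fun y => u y ^ (p + 1) := hu.pow_const _
  have hvp : Measurable fun x => v x ^ (q + 1) := hv.pow_const _
  have hfinm : IsFiniteMeasure m :=
    isFiniteMeasure_withDensity (ne_top_of_le_ne_top hufin (setLIntegral_le_lintegral _ _))
  have : SFinite (ptBeyond e h) := by unfold ptBeyond; infer_instance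
  have hSν : SFinite ν := by rw [hν]; infer_instance
  have mac : m ≪ volume.restrict (beyond e h) := withDensity_absolutelyContinuous _ _
  have νac : ν ≪ ptBeyond e h := withDensity_absolutelyContinuous _ _
  have goody : ∀ᵐ y ∂(volume.restrict (beyond e h)), y ∈ beyond e h ∧ u y ≠ 0 ∧ u y ≠ ∞ := by
    filter_upwards [ae_restrict_mem hmS, ae_restrict_of_ae huae] with y h1 h2
    exact ⟨h1, (hs.u_pos y).ne', h2⟩
  have goodx : ∀ᵐ x ∂(ptBeyond e h),
      x ∈ upperHalf n ∧ x.1 ∈ beyond e h ∧ v x ≠ 0 ∧ v x ≠ ∞ := by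
    filter_upwards [ae_ptBeyond e h, ae_restrict_of_ae hvae] with x h1 h2
    exact ⟨h1.1, h1.2, (hs.v_pos x h1.1).ne', h2⟩
  set D := diffKer a b lam μ e h with hD
  have hDm : Measurable (Function.uncurry D) := measurable_diffKer a b lam μ e h
  have hDx : ∀ x, Measurable (D x) := fun x => hDm.of_uncurry_left
  have hDy : ∀ y, Measurable fun x => D x y := fun y => hDm.of_uncurry_right
  -- Dividing by `u y * v x` against the measures `u ^ (p + 1)` and `v ^ (q + 1)` leaves the
  -- original powers `u ^ p` and `v ^ q`, so the two equations themselves say that `κ` has mass at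
  -- most one in each variable.
  set κ : Pt n → Bdry n → ℝ≥0∞ := fun x y => D x y * ((u y)⁻¹ * (v x)⁻¹) with hκ
  have hκm : Measurable (Function.uncurry κ) :=
    hDm.mul ((hu.comp measurable_snd).inv.mul (hv.comp measurable_fst).inv)
  have hκx : ∀ x, Measurable (κ x) := fun x => hκm.of_uncurry_left
  have hκy : ∀ y, Measurable fun x => κ x y := fun y => hκm.of_uncurry_right
  set A : Bdry n → ℝ≥0∞ := fun y => (u y - u (bdryReflect e h y)) / u y with hA
  set B : Pt n → ℝ≥0∞ := fun x => (v x - v (ptReflect e h x)) / v x with hB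
  have hAm : Measurable A := (hu.sub (hu.comp (measurable_bdryReflect e h))).div hu
  have hBm : Measurable B := (hv.sub (hv.comp (measurable_ptReflect e h))).div hv
  have hA1 : ∀ y, A y ≤ 1 := fun y =>
    (ENNReal.div_le_div_right tsub_le_self _).trans ENNReal.div_self_le_one
  have hB1 : ∀ x, B x ≤ 1 := fun x =>
    (ENNReal.div_le_div_right tsub_le_self _).trans ENNReal.div_self_le_one
  have intν : ∀ y, ∀ g : Pt n → ℝ≥0∞, Measurable g →
      ∫⁻ x, κ x y * g x ∂ν = (u y)⁻¹ * ∫⁻ x, D x y * (v x ^ q * g x) ∂(ptBeyond e h) := by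
    intro y g hg
    rw [hν, lintegral_kernel_eq_withDensity hvp (f := fun x => κ x y * g x) ((hκy y).mul hg),
      ← lintegral_const_mul (f := fun x => D x y * (v x ^ q * g x)) _
      ((hDy y).mul ((hv.pow_const q).mul hg))]
    refine lintegral_congr_ae ?_
    filter_upwards [goodx] with x hx
    rw [← ENNReal.rpow_add_one_mul_inv hx.2.2.1 hx.2.2.2 q]
    simp only [hκ]
    ring
  have intm : ∀ x, ∀ g : Bdry n → ℝ≥0∞, Measurable g →
      ∫⁻ y, κ x y * g y ∂m = (v x)⁻¹ * ∫⁻ y in beyond e h, D x y * (u y ^ p * g y) := by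
    intro x g hg
    rw [hm, lintegral_kernel_eq_withDensity hup (f := fun y => κ x y * g y) ((hκx x).mul hg),
      ← lintegral_const_mul (f := fun y => D x y * (u y ^ p * g y)) _
      ((hDx x).mul ((hu.pow_const p).mul hg))]
    refine lintegral_congr_ae ?_
    filter_upwards [goody] with y hy
    rw [← ENNReal.rpow_add_one_mul_inv hy.2.1 hy.2.2 p]
    simp only [hκ]
    ring
  have hzero := H m ν κ A B hκm hAm hBm hA1 hB1 ?_ ?_ ?_ ?_ ?_ ?_
  · rw [hm, ae_withDensity_iff hup, ae_restrict_iff' hmS] at hzero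
    filter_upwards [hzero, huae] with y hy hyt hyS
    have h0 : A y = 0 := by
      refine hy hyS ?_
      rw [Ne, ENNReal.rpow_eq_zero_iff]
      rintro (⟨h1, -⟩ | ⟨h1, -⟩)
      · exact (hs.u_pos y).ne' h1
      · exact hyt h1
    rcases ENNReal.div_eq_zero_iff.1 h0 with h1 | h1
    · exact tsub_eq_zero_iff_le.1 h1
    · exact absurd h1 hyt
  · filter_upwards [mac.ae_le goody] with y hy
    rw [intν y _ (by fun_prop)]
    have h1 := hs.u_sub_le he hh ha hb hμ hv hy.1
    rw [mul_comm]
    refine ENNReal.div_le_div_right (h1.trans (lintegral_mono_ae ?_)) _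
    filter_upwards [goodx] with x hx
    rw [ENNReal.rpow_mul_one_sub_one_sub_div_rpow hx.2.2.1 hx.2.2.2 hq]
  · filter_upwards [νac.ae_le goodx] with x hx
    rw [intm x _ (by fun_prop)]
    have h1 := hs.v_sub_le he hh ha hb hμ hu hx.1 hx.2.1
    rw [mul_comm]
    refine ENNReal.div_le_div_right (h1.trans (lintegral_mono_ae ?_)) _
    filter_upwards [goody] with y hy
    rw [ENNReal.rpow_mul_one_sub_one_sub_div_rpow hy.2.1 hy.2.2 hp]
  · filter_upwards [mac.ae_le goody] with y hy
    have h1 := intν y (fun _ => 1) measurable_const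
    simp only [mul_one] at h1
    rw [h1, mul_comm, ← div_eq_mul_inv, ENNReal.div_lt_iff (Or.inl hy.2.1) (Or.inl hy.2.2), one_mul]
    exact hs.lintegral_diffKer_lt ha hq.le hh hv hy.2.2
  · filter_upwards [νac.ae_le goodx] with x hx
    have h1 := intm x (fun _ => 1) measurable_const
    simp only [mul_one] at h1
    rw [h1, mul_comm, ← div_eq_mul_inv]
    refine (ENNReal.div_le_div_right ?_ _).trans (ENNReal.div_self_le_one (a := v x))
    rw [hs.v_eq x hx.1]
    refine (setLIntegral_le_lintegral _ _).trans ?_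
    gcongr
    exact diffKer_le_weightedKer _ _ _ _ _ _ _ _
  · intro hpq
    -- With `f = u ^ p A` beyond the plane, `f ^ ((p + 1) / p) = u ^ (p + 1) A ^ ((p + 1) / p)`, and
    -- the factor `v ^ (q + 1)` of `ν` cancels the division by `v` in `κ`. This is the unnormalised
    -- inequality exactly.
    set f : Bdry n → ℝ≥0∞ := (beyond e h).indicator fun y => u y ^ p * A y with hf
    have hfm : Measurable f := ((hu.pow_const p).mul hAm).indicator hmS
    have e1 : ∫⁻ y, f y ^ ((p + 1) / p) = ∫⁻ y, A y ^ ((p + 1) / p) ∂m := by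
      rw [hm, lintegral_kernel_eq_withDensity hup (hAm.pow_const _), ← lintegral_indicator hmS]
      refine lintegral_congr fun y => ?_
      by_cases hy : y ∈ beyond e h
      · rw [hf, Set.indicator_of_mem hy, Set.indicator_of_mem hy,
          ENNReal.mul_rpow_of_nonneg _ _ (by positivity), ← ENNReal.rpow_mul,
          mul_div_cancel₀ _ hp.ne']
      · rw [hf, Set.indicator_of_notMem hy, Set.indicator_of_notMem hy,
          ENNReal.zero_rpow_of_pos (by positivity)]
    rw [← e1]
    refine le_trans ?_ (hHLS' hpq f hfm)
    have hmeas : Measurable fun x => ∫⁻ y, κ x y * A y ∂m :=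
      Measurable.lintegral_prod_right' (f := fun z : Pt n × Bdry n => κ z.1 z.2 * A z.2)
        (hκm.mul (hAm.comp measurable_snd))
    rw [hν, lintegral_kernel_eq_withDensity hvp (hmeas.pow_const _)]
    refine le_trans (lintegral_mono_ae ?_) (setLIntegral_le_lintegral (Prod.fst ⁻¹' beyond e h) _)
    filter_upwards [goodx] with x hx
    rw [intm x A hAm, ← ENNReal.mul_rpow_of_nonneg _ _ (by linarith), ← mul_assoc,
      ENNReal.mul_inv_cancel hx.2.2.1 hx.2.2.2, one_mul]
    refine ENNReal.rpow_le_rpow ?_ (by linarith)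
    rw [← lintegral_indicator hmS]
    refine lintegral_mono fun y => ?_
    by_cases hy : y ∈ beyond e h
    · rw [hf, Set.indicator_of_mem hy, Set.indicator_of_mem hy]
      gcongr
      exact diffKer_le_weightedKer _ _ _ _ _ _ _ _
    · rw [Set.indicator_of_notMem hy]
      exact zero_le
  · have hAset : MeasurableSet {y | A y ≠ 0} := (measurableSet_eq_fun hAm measurable_const).compl
    rw [hm, withDensity_apply _ hAset, Measure.restrict_restrict hAset]
    refine lt_of_le_of_lt (lintegral_mono_set (t := beyond e h ∩
      {y | u (bdryReflect e h y) < u y}) fun y hy => ⟨hy.2, ?_⟩) hsmall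
    show u (bdryReflect e h y) < u y
    by_contra hle
    refine hy.1 ?_
    simp only [hA, tsub_eq_zero_of_le (not_lt.1 hle), ENNReal.zero_div]

end SmallSupport

/-! ### Moving the plane up to the origin -/

section MovingPlanes

variable {n : ℕ} {a b lam μ p q : ℝ} {u : Bdry n → ℝ≥0∞} {v : Pt n → ℝ≥0∞} {e : Bdry n} {h : ℝ}

theorem continuous_bdryReflect_uncurry (e : Bdry n) :
    Continuous fun z : ℝ × Bdry n => bdryReflect e z.1 z.2 := by
  unfold bdryReflect
  fun_prop

/-- Reflections depend continuously on the hyperplane, almost everywhere along a subsequence. -/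
theorem exists_seq_tendsto_comp_bdryReflect (he : ‖e‖ = 1) (hu : Measurable u) {s : ℝ}
    (hs : 1 ≤ s) (hufin : ∫⁻ y, u y ^ s ≠ ∞) {hk : ℕ → ℝ} {h₀ : ℝ}
    (hlim : Tendsto hk atTop (𝓝 h₀)) :
    ∃ φ : ℕ → ℕ, StrictMono φ ∧ ∀ᵐ y, Tendsto (fun k => u (bdryReflect e (hk (φ k)) y)) atTop
      (𝓝 (u (bdryReflect e h₀ y))) := by
  have huae : ∀ᵐ y, u y ≠ ∞ := ENNReal.ae_ne_top_of_lintegral_rpow hu (by linarith) hufin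
  have hs1 : Fact ((1 : ℝ≥0∞) ≤ ENNReal.ofReal s) := ⟨by simpa using ENNReal.ofReal_le_ofReal hs⟩
  have hsmem : MemLp (fun y => (u y).toReal) (ENNReal.ofReal s) volume := by
    refine ⟨hu.ennreal_toReal.aestronglyMeasurable, ?_⟩
    rw [eLpNorm_lt_top_iff_lintegral_rpow_enorm_lt_top
      (by simpa using (by linarith : 0 < s)) ENNReal.ofReal_ne_top,
      ENNReal.toReal_ofReal (by linarith)]
    refine lt_of_le_of_lt (lintegral_mono fun y => ?_) hufin.lt_top
    refine ENNReal.rpow_le_rpow ?_ (by linarith)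
    rw [Real.enorm_eq_ofReal ENNReal.toReal_nonneg]
    exact ENNReal.ofReal_toReal_le
  set F := hsmem.toLp with hF
  set g : C(ℝ, C(Bdry n, Bdry n)) := ContinuousMap.curry ⟨_, continuous_bdryReflect_uncurry e⟩
  have hmp : ∀ t, MeasurePreserving (g t) volume volume := fun t =>
    measurePreserving_bdryReflect he t
  have hcont : Tendsto (fun k => Lp.compMeasurePreserving (g (hk k)) (hmp (hk k)) F) atTop
      (𝓝 (Lp.compMeasurePreserving (g h₀) (hmp h₀) F)) :=
    Filter.Tendsto.compMeasurePreservingLp tendsto_const_nhds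
      ((g.continuous.tendsto h₀).comp hlim) _ _ ENNReal.ofReal_ne_top
  obtain ⟨φ, hφ, hae⟩ := (tendstoInMeasure_of_tendsto_Lp hcont).exists_seq_tendsto_ae
  refine ⟨φ, hφ, ?_⟩
  have hval : ∀ t, ∀ᵐ y, ENNReal.ofReal
      ((Lp.compMeasurePreserving (g t) (hmp t) F : Bdry n → ℝ) y) = u (bdryReflect e t y) := by
    intro t
    filter_upwards [Lp.coeFn_compMeasurePreserving F (hmp t),
      (hmp t).quasiMeasurePreserving.ae hsmem.coeFn_toLp,
      (hmp t).quasiMeasurePreserving.ae huae] with y h1 h2 h3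
    rw [h1, Function.comp_apply, hF, h2]
    exact ENNReal.ofReal_toReal h3
  filter_upwards [hae, hval h₀, ae_all_iff.2 fun k => hval (hk (φ k))] with y h1 h2 h3
  have h4 := (ENNReal.continuous_ofReal.tendsto _).comp h1
  rw [h2] at h4
  exact h4.congr h3

theorem ENNReal.le_of_weighted_le {c d x w : ℝ≥0∞} (hcd : c ≤ d) (hc0 : c ≠ 0) (hc : c ≠ ∞)
    (hle : d * x ≤ c * w) : x ≤ w := by
  have h1 : c * x ≤ c * w := le_trans (by gcongr) hle
  exact (ENNReal.mul_le_mul_iff_right hc0 hc).1 h1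

theorem ENNReal.lt_of_weighted_le {c d x w : ℝ≥0∞} (hcd : c < d) (hx0 : x ≠ 0) (hx : x ≠ ∞)
    (hle : d * x ≤ c * w) : x < w := by
  by_contra hwx
  have h1 : c * x < d * x := by
    rw [mul_comm c, mul_comm d]
    exact ENNReal.mul_lt_mul_right hx0 hx hcd
  have h2 : c * w ≤ c * x := by
    gcongr
    exact not_lt.1 hwx
  exact absurd (hle.trans h2) (not_le.2 h1)

theorem ne_zero_of_mem_beyond (hh : 0 < h) {y : Bdry n} (hy : y ∈ beyond e h) : y ≠ 0 := by
  rintro rfl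
  have : h < inner ℝ (0 : Bdry n) e := hy
  rw [inner_zero_left] at this
  linarith

theorem IsPositiveSolution.v_le_ptReflect (hs : IsPositiveSolution n a b lam μ p q u v)
    (he : ‖e‖ = 1) (hh : 0 < h) (ha : 0 ≤ a) (hb : 0 ≤ b) (hμ : 0 ≤ μ) (hp : 0 ≤ p)
    (hu : Measurable u) (hle : ∀ᵐ y, y ∈ beyond e h → u y ≤ u (bdryReflect e h y))
    {x : Pt n} (hx0 : x ∈ upperHalf n) (hx : x.1 ∈ beyond e h) : v x ≤ v (ptReflect e h x) :=
  ENNReal.le_of_weighted_le (ptWeight_le hb (euclLength_ptReflect_lt he hh hx).le)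
    (ptWeight_ne_zero hx0) (ptWeight_ne_top hx0)
    (hs.ptWeight_mul_le he hh ha hμ hp hu hle hx0 hx)

theorem IsPositiveSolution.v_lt_ptReflect (hs : IsPositiveSolution n a b lam μ p q u v)
    (he : ‖e‖ = 1) (hh : 0 < h) (ha : 0 ≤ a) (hb : 0 < b) (hμ : 0 ≤ μ) (hp : 0 ≤ p)
    (hu : Measurable u) (hle : ∀ᵐ y, y ∈ beyond e h → u y ≤ u (bdryReflect e h y))
    {x : Pt n} (hx0 : x ∈ upperHalf n) (hx : x.1 ∈ beyond e h) (hv : v x ≠ ∞) :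
    v x < v (ptReflect e h x) :=
  ENNReal.lt_of_weighted_le (ptWeight_lt hb (euclLength_ptReflect_lt he hh hx))
    (hs.v_pos x hx0).ne' hv (hs.ptWeight_mul_le he hh ha hμ hp hu hle hx0 hx)

theorem IsPositiveSolution.u_le_bdryReflect (hs : IsPositiveSolution n a b lam μ p q u v)
    (he : ‖e‖ = 1) (hh : 0 < h) (ha : 0 ≤ a) (hb : 0 ≤ b) (hμ : 0 ≤ μ) (hp : 0 ≤ p) (hq : 0 ≤ q)
    (hu : Measurable u) (hv : Measurable v)
    (hle : ∀ᵐ y, y ∈ beyond e h → u y ≤ u (bdryReflect e h y))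
    {y : Bdry n} (hy : y ∈ beyond e h) : u y ≤ u (bdryReflect e h y) :=
  ENNReal.le_of_weighted_le (bdryWeight_le ha (norm_bdryReflect_lt he hh hy).le)
    (bdryWeight_pos ha y) (bdryWeight_ne_top (ne_zero_of_mem_beyond hh hy))
    (hs.bdryWeight_mul_le he hh hb hμ hq hv
      (fun _ hx0 hx => hs.v_le_ptReflect he hh ha hb hμ hp hu hle hx0 hx) hy)

theorem IsPositiveSolution.u_lt_bdryReflect (hs : IsPositiveSolution n a b lam μ p q u v)
    (he : ‖e‖ = 1) (hh : 0 < h) (ha : 0 < a) (hb : 0 ≤ b) (hμ : 0 ≤ μ) (hp : 0 ≤ p) (hq : 0 ≤ q)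
    (hu : Measurable u) (hv : Measurable v)
    (hle : ∀ᵐ y, y ∈ beyond e h → u y ≤ u (bdryReflect e h y))
    {y : Bdry n} (hy : y ∈ beyond e h) (huy : u y ≠ ∞) : u y < u (bdryReflect e h y) :=
  ENNReal.lt_of_weighted_le (bdryWeight_lt ha (norm_bdryReflect_lt he hh hy))
    (hs.u_pos y).ne' huy (hs.bdryWeight_mul_le he hh hb hμ hq hv
      (fun _ hx0 hx => hs.v_le_ptReflect he hh ha.le hb hμ hp hu hle hx0 hx) hy)

/-- The method of moving planes: every hyperplane that misses the origin is reached. -/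
theorem IsPositiveSolution.ae_le_bdryReflect (hs : IsPositiveSolution n a b lam μ p q u v)
    (ha : 0 < a) (hb : 0 ≤ b) (hμ : 0 ≤ μ) (hp : 0 < p) (hq : 0 < q) (hu : Measurable u)
    (hv : Measurable v) (hufin : ∫⁻ y, u y ^ (p + 1) ≠ ∞)
    (hvfin : ∫⁻ x in upperHalf n, v x ^ (q + 1) ≠ ∞)
    (hHLS : 1 < p * q → ∃ C : ℝ≥0∞, C ≠ ∞ ∧ ∀ f : Bdry n → ℝ≥0∞, Measurable f →
      ∫⁻ x in upperHalf n, (∫⁻ y, weightedKer a b lam μ x y * f y) ^ (q + 1) ≤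
        C * (∫⁻ y, f y ^ ((p + 1) / p)) ^ ((q + 1) * p / (p + 1)))
    (he : ‖e‖ = 1) (hh : 0 < h) :
    ∀ᵐ y, y ∈ beyond e h → u y ≤ u (bdryReflect e h y) := by
  obtain ⟨ε, hε, H⟩ := hs.exists_pos_forall_le_reflect ha.le hb hμ hp hq hu hv hufin hvfin hHLS
  have huae : ∀ᵐ y, u y ≠ ∞ := ENNReal.ae_ne_top_of_lintegral_rpow hu (by linarith) hufin
  set bad : ℝ → Set (Bdry n) := fun t => beyond e t ∩ {y | u (bdryReflect e t y) < u y} with hbad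
  have hbadm : ∀ t, MeasurableSet (bad t) := fun t => (measurableSet_beyond t).inter
    (measurableSet_lt (hu.comp (measurable_bdryReflect e t)) hu)
  have hup : Measurable fun y => u y ^ (p + 1) := hu.pow_const _
  -- Dominated convergence with majorant `u ^ (p + 1)`: if almost every point is eventually not bad,
  -- the mass of the bad sets tends to zero and eventually beats the threshold.
  have small_of_tendsto : ∀ t : ℕ → ℝ, (∀ᵐ y, ∀ᶠ k in atTop, y ∉ bad (t k)) →
      ∀ᶠ k in atTop, ∫⁻ y in bad (t k), u y ^ (p + 1) < ε := by
    intro t ht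
    have hlim : Tendsto (fun k => ∫⁻ y, (bad (t k)).indicator (fun y => u y ^ (p + 1)) y) atTop
        (𝓝 (∫⁻ _ : Bdry n, 0)) := by
      refine tendsto_lintegral_of_dominated_convergence (fun y => u y ^ (p + 1))
        (fun k => hup.indicator (hbadm _)) (fun k => ?_) hufin ?_
      · exact Eventually.of_forall fun y => Set.indicator_le_self _ _ y
      · filter_upwards [ht] with y hy
        refine tendsto_const_nhds.congr' ?_
        filter_upwards [hy] with k hk
        rw [Set.indicator_of_notMem hk]
    rw [lintegral_zero] at hlim
    filter_upwards [hlim.eventually_lt_const hε] with k hk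
    rwa [lintegral_indicator (hbadm _)] at hk
  set good : Set ℝ := {t | 0 < t ∧ ∀ᵐ y, y ∈ beyond e t → u y ≤ u (bdryReflect e t y)} with hgood
  suffices hsub : Set.Ioi 0 ⊆ good from (hsub hh).2
  refine isPreconnected_Ioi.subset_of_closure_inter_subset ?_ ?_ ?_
  -- Openness. If planes `t k → t₀` failed with `t₀` good, then along a subsequence the reflected
  -- values converge almost everywhere. The inequality at `t₀` is strict beyond the plane wherever
  -- `u` is finite, so bad points disappear in the limit. No continuity of `u` is needed.
  · rw [isOpen_iff_mem_nhds]
    rintro t₀ ⟨ht₀, hgood₀⟩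
    by_contra hnot
    have hfreq : ∃ᶠ t in 𝓝 t₀, t ∉ good := by
      rw [← not_eventually]
      exact hnot
    obtain ⟨t, ht, htp⟩ := exists_seq_forall_of_frequently
      (hfreq.and_eventually (lt_mem_nhds ht₀))
    obtain ⟨φ, hφ, hae⟩ := exists_seq_tendsto_comp_bdryReflect he hu (by linarith) hufin ht
    have htφ : Tendsto (fun k => t (φ k)) atTop (𝓝 t₀) := ht.comp hφ.tendsto_atTop
    have hev := small_of_tendsto (fun k => t (φ k)) ?_
    · obtain ⟨k, hk⟩ := hev.exists
      exact (htp (φ k)).1 ⟨(htp (φ k)).2, H e _ he (htp (φ k)).2 hk⟩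
    · filter_upwards [hae, huae, ae_inner_ne he t₀] with y h1 h2 h3
      rcases lt_or_gt_of_ne h3 with h4 | h4
      · filter_upwards [htφ.eventually_const_lt h4] with k hk hmem
        exact lt_asymm hk hmem.1
      · have h5 := hs.u_lt_bdryReflect he ht₀ ha hb hμ hp.le hq.le hu hv hgood₀ h4 h2
        filter_upwards [h1.eventually_const_lt h5] with k hk hmem
        exact lt_asymm hk hmem.2
  -- A start exists: each fixed point is eventually on the near side of the plane at height `k`.
  · have hev := small_of_tendsto (fun k : ℕ => (k : ℝ)) (Eventually.of_forall fun y => by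
      filter_upwards [tendsto_natCast_atTop_atTop.eventually_gt_atTop (inner ℝ y e)] with k hk hmem
      exact lt_asymm hk hmem.1)
    obtain ⟨k, hk, hk0⟩ := (hev.and (eventually_gt_atTop 0)).exists
    have hk' : (0 : ℝ) < k := by exact_mod_cast hk0
    exact ⟨k, hk', hk', H e k he hk' hk⟩
  -- Closedness: the weak inequality passes to the almost everywhere limit along a subsequence.
  · rintro t₀ ⟨hcl, ht₀⟩
    refine ⟨ht₀, ?_⟩
    obtain ⟨t, htg, ht⟩ := mem_closure_iff_seq_limit.1 hcl
    obtain ⟨φ, hφ, hae⟩ := exists_seq_tendsto_comp_bdryReflect he hu (by linarith) hufin ht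
    have htφ : Tendsto (fun k => t (φ k)) atTop (𝓝 t₀) := ht.comp hφ.tendsto_atTop
    filter_upwards [hae, ae_all_iff.2 fun k => (htg (φ k)).2] with y h1 h2 hy
    refine ge_of_tendsto h1 ?_
    filter_upwards [htφ.eventually_lt_const (show t₀ < inner ℝ y e from hy)] with k hk
    exact h2 k hk

end MovingPlanes

/-! ### Lower bounds, exponent restrictions and finiteness of `v` -/

section Exponents

variable {n : ℕ} {a b lam μ p q : ℝ} {u : Bdry n → ℝ≥0∞} {v : Pt n → ℝ≥0∞} {e : Bdry n} {h : ℝ}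

/-- For `‖y‖ ≤ M` the distance from `x` to `y` grows at most linearly in `M`, so the kernel is at
least `M ^ (-μ)` times a positive function of `x` alone. -/
theorem rpow_neg_mul_le_kerP (hμ : 0 ≤ μ) {M : ℝ} (hM : 1 ≤ M) {x : Pt n} (hx : 0 < x.2)
    {y : Bdry n} (hy : ‖y‖ ≤ M) :
    M ^ (-μ) * (x.2 ^ lam / ((‖x.1‖ + 1) ^ 2 + x.2 ^ 2) ^ (μ / 2)) ≤ kerP lam μ x y := by
  have hM0 : 0 < M := by linarith
  have h1 : ‖x.1 - y‖ ≤ M * (‖x.1‖ + 1) := by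
    have := norm_sub_le x.1 y
    nlinarith [norm_nonneg x.1]
  have h2 : ‖x.1 - y‖ ^ 2 + x.2 ^ 2 ≤ M ^ 2 * ((‖x.1‖ + 1) ^ 2 + x.2 ^ 2) := by
    have h3 : ‖x.1 - y‖ ^ 2 ≤ (M * (‖x.1‖ + 1)) ^ 2 := by gcongr
    have h4 : x.2 ^ 2 ≤ M ^ 2 * x.2 ^ 2 :=
      le_mul_of_one_le_left (sq_nonneg _) (one_le_pow₀ hM)
    rw [mul_add, ← mul_pow]
    exact add_le_add h3 h4
  have h3 : (M ^ 2 * ((‖x.1‖ + 1) ^ 2 + x.2 ^ 2)) ^ (μ / 2) =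
      M ^ μ * ((‖x.1‖ + 1) ^ 2 + x.2 ^ 2) ^ (μ / 2) := by
    rw [Real.mul_rpow (by positivity) (by positivity), ← Real.rpow_natCast, ← Real.rpow_mul hM0.le]
    congr 2
    push_cast
    ring
  calc _ = x.2 ^ lam / (M ^ 2 * ((‖x.1‖ + 1) ^ 2 + x.2 ^ 2)) ^ (μ / 2) := by
        rw [h3, Real.rpow_neg hM0.le]
        field_simp
    _ ≤ kerP lam μ x y := by
        unfold kerP
        gcongr

/-- A pointwise lower bound for `u`, with the decay of the kernel. -/
theorem IsPositiveSolution.exists_lower_bound (hs : IsPositiveSolution n a b lam μ p q u v)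
    (hμ : 0 ≤ μ) (hq : 0 ≤ q) (hv : Measurable v) :
    ∃ c : ℝ≥0∞, c ≠ 0 ∧ ∀ (M : ℝ) (y : Bdry n), 1 ≤ M → ‖y‖ ≤ M →
      bdryWeight a y * (ENNReal.ofReal (M ^ (-μ)) * c) ≤ u y := by
  set k : Pt n → ℝ≥0∞ := fun x =>
    ENNReal.ofReal (x.2 ^ lam / ((‖x.1‖ + 1) ^ 2 + x.2 ^ 2) ^ (μ / 2)) with hk
  have hkm : Measurable k := by fun_prop
  have hm : Measurable fun x => ptWeight b x * k x * v x ^ q := by fun_prop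
  refine ⟨∫⁻ x in upperHalf n, ptWeight b x * k x * v x ^ q, ?_, fun M y hM hy => ?_⟩
  · rw [← pos_iff_ne_zero, lintegral_pos_iff_support hm, pos_iff_ne_zero]
    intro h0
    have hopen : IsOpen (upperHalf n) := isOpen_lt continuous_const continuous_snd
    refine (hopen.measure_pos volume ⟨(0, 1), (one_pos : (0 : ℝ) < 1)⟩).ne' ?_
    rw [← Measure.restrict_apply_self, ← nonpos_iff_eq_zero]
    refine le_trans (measure_mono_ae ?_) h0.le
    filter_upwards [ae_restrict_mem measurableSet_upperHalf] with x hx _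
    have hx0 : 0 < x.2 := hx
    show ptWeight b x * k x * v x ^ q ≠ 0
    refine mul_ne_zero (mul_ne_zero (ptWeight_ne_zero hx) ?_) ?_
    · exact (ENNReal.ofReal_pos.2 (by positivity)).ne'
    · rw [Ne, ENNReal.rpow_eq_zero_iff]
      rintro (⟨h1, -⟩ | ⟨-, h1⟩)
      · exact (hs.v_pos x hx).ne' h1
      · exact not_lt.2 hq h1
  · rw [hs.u_eq_mul hv y, ← lintegral_const_mul _ hm]
    refine mul_le_mul' le_rfl (setLIntegral_mono' measurableSet_upperHalf fun x hx => ?_)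
    have h1 : ENNReal.ofReal (M ^ (-μ)) * k x ≤ poissonKer lam μ x y := by
      rw [hk, ← ENNReal.ofReal_mul (by positivity)]
      exact ENNReal.ofReal_le_ofReal (rpow_neg_mul_le_kerP hμ hM hx hy)
    calc _ = ptWeight b x * (ENNReal.ofReal (M ^ (-μ)) * k x) * v x ^ q := by ring
      _ ≤ _ := by gcongr

theorem lintegral_norm_rpow_le_of_le {S : Set (Bdry n)} (hS : MeasurableSet S) {c : ℝ≥0∞}
    {t s : ℝ} (hs : 0 ≤ s) (hle : ∀ y ∈ S, ENNReal.ofReal (‖y‖ ^ (-t)) * c ≤ u y) :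
    (∫⁻ y in S, ENNReal.ofReal (‖y‖ ^ (-(t * s)))) * c ^ s ≤ ∫⁻ y, u y ^ s := by
  rw [← lintegral_mul_const _ (by fun_prop)]
  refine le_trans (setLIntegral_mono' hS fun y hy => ?_) (setLIntegral_le_lintegral S _)
  rw [show -(t * s) = -t * s by ring, Real.rpow_mul (norm_nonneg y),
    ← ENNReal.ofReal_rpow_of_nonneg (by positivity) hs, ← ENNReal.mul_rpow_of_nonneg _ _ hs]
  exact ENNReal.rpow_le_rpow (hle y hy) hs

/-- The lower bound with `M = 1` puts a multiple of `‖y‖ ^ (-a)` below `u` in the unit ball, and its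
power `p + 1` must be integrable there. -/
theorem IsPositiveSolution.lt_div (hn : 2 ≤ n) (hs : IsPositiveSolution n a b lam μ p q u v)
    (hμ : 0 ≤ μ) (hp : 0 < p) (hq : 0 ≤ q) (hv : Measurable v)
    (hufin : ∫⁻ y, u y ^ (p + 1) ≠ ∞) : a < (n - 1) / (p + 1) := by
  have := nontrivial_bdry hn
  by_contra hcon
  rw [not_lt, div_le_iff₀ (by linarith)] at hcon
  obtain ⟨c, hc0, hc⟩ := hs.exists_lower_bound hμ hq hv
  have hmS : MeasurableSet {y : Bdry n | ‖y‖ ∈ Set.Ioo (0 : ℝ) 1} :=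
    measurable_norm measurableSet_Ioo
  have h1 := lintegral_norm_rpow_le_of_le (u := u) (c := c) (t := a) (s := p + 1) hmS
    (by linarith) fun y hy => by
      have := hc 1 y le_rfl hy.2.le
      rwa [Real.one_rpow, ENNReal.ofReal_one, one_mul, bdryWeight,
        ENNReal.ofReal_rpow_of_pos hy.1] at this
  rw [lintegral_ball_rpow_eq_top _ (by rwa [finrank_bdry hn]), ENNReal.top_mul] at h1
  · exact hufin (top_le_iff.1 h1)
  · simp [ENNReal.rpow_eq_zero_iff, hc0]
    intro
    linarith

/-- The lower bound with `M = ‖y‖` puts a multiple of `‖y‖ ^ (-(a + μ))` below `u` outside the unit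
ball, and its power `p + 1` must be integrable at infinity. -/
theorem IsPositiveSolution.div_lt (hn : 2 ≤ n) (hs : IsPositiveSolution n a b lam μ p q u v)
    (hμ : 0 ≤ μ) (hp : 0 < p) (hq : 0 ≤ q) (hv : Measurable v)
    (hufin : ∫⁻ y, u y ^ (p + 1) ≠ ∞) : (n - 1) / (p + 1) < a + μ := by
  have := nontrivial_bdry hn
  by_contra hcon
  rw [not_lt, le_div_iff₀ (by linarith)] at hcon
  obtain ⟨c, hc0, hc⟩ := hs.exists_lower_bound hμ hq hv
  have hmS : MeasurableSet {y : Bdry n | ‖y‖ ∈ Set.Ioi (1 : ℝ)} :=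
    measurable_norm measurableSet_Ioi
  have h1 := lintegral_norm_rpow_le_of_le (u := u) (c := c) (t := a + μ) (s := p + 1) hmS
    (by linarith) fun y hy => by
      have hy1 : 1 < ‖y‖ := hy
      have hy0 : 0 < ‖y‖ := by linarith
      have := hc ‖y‖ y hy1.le le_rfl
      rwa [bdryWeight, ENNReal.ofReal_rpow_of_pos hy0, ← mul_assoc,
        ← ENNReal.ofReal_mul (by positivity), ← Real.rpow_add hy0, ← neg_add] at this
  rw [lintegral_compl_ball_rpow_eq_top _ (by rwa [finrank_bdry hn]), ENNReal.top_mul] at h1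
  · exact hufin (top_le_iff.1 h1)
  · simp [ENNReal.rpow_eq_zero_iff, hc0]
    intro
    linarith

/-- A Harnack-type bound, uniform in `y`: by the triangle inequality the distance from `z` to `y` is
at most the distance from `x` plus `euclLength (z - x)`, and the distance from `x` is at least the
height of `x`. -/
theorem kerP_le_mul_kerP (hμ : 0 ≤ μ) {x z : Pt n} (hx : 0 < x.2) (hz : 0 < z.2) (y : Bdry n) :
    kerP lam μ x y ≤ x.2 ^ lam / z.2 ^ lam * (euclLength (z - x) / x.2 + 1) ^ μ *
      kerP lam μ z y := by
  have h1 := bdryDist_pos hx y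
  have h2 := bdryDist_pos hz y
  have h3 := euclLength_nonneg (z - x)
  set K := euclLength (z - x) / x.2 + 1 with hK
  have hK0 : 0 < K := by positivity
  have hle : bdryDist z y ≤ K * bdryDist x y := by
    calc bdryDist z y ≤ euclLength (z - x) + bdryDist x y := by
          rw [bdryDist_eq, bdryDist_eq]
          have := euclLength_add_le (z - x) (x - (y, 0))
          rwa [sub_add_sub_cancel] at this
      _ = euclLength (z - x) / x.2 * x.2 + bdryDist x y := by field_simp
      _ ≤ euclLength (z - x) / x.2 * bdryDist x y + bdryDist x y := by
          gcongr
          exact snd_le_bdryDist x y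
      _ = _ := by rw [hK]; ring
  rw [kerP_eq, kerP_eq]
  have h4 : bdryDist z y ^ μ ≤ K ^ μ * bdryDist x y ^ μ := by
    rw [← Real.mul_rpow hK0.le h1.le]
    exact Real.rpow_le_rpow h2.le hle hμ
  rw [show x.2 ^ lam / z.2 ^ lam * K ^ μ * (z.2 ^ lam / bdryDist z y ^ μ) =
    x.2 ^ lam * K ^ μ / bdryDist z y ^ μ by field_simp, div_le_div_iff₀ (by positivity)
    (by positivity)]
  calc x.2 ^ lam * bdryDist z y ^ μ ≤ x.2 ^ lam * (K ^ μ * bdryDist x y ^ μ) := by gcongr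
    _ = _ := by ring

/-- `v` is finite everywhere once it is finite at one point. -/
theorem IsPositiveSolution.v_ne_top (hs : IsPositiveSolution n a b lam μ p q u v)
    (hμ : 0 ≤ μ) (hq : 0 < q) (hu : Measurable u) (hv : Measurable v)
    (hvfin : ∫⁻ x in upperHalf n, v x ^ (q + 1) ≠ ∞) {x : Pt n} (hx : x ∈ upperHalf n) :
    v x ≠ ∞ := by
  have hvae : ∀ᵐ x ∂(volume.restrict (upperHalf n)), v x ≠ ∞ :=
    ENNReal.ae_ne_top_of_lintegral_rpow hv (by linarith) hvfin
  have hne : NeBot (ae (volume.restrict (upperHalf n))) := by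
    rw [ae_neBot, Ne, Measure.restrict_eq_zero]
    have hopen : IsOpen (upperHalf n) := isOpen_lt continuous_const continuous_snd
    exact (hopen.measure_pos volume ⟨(0, 1), (one_pos : (0 : ℝ) < 1)⟩).ne'
  obtain ⟨z, hzv, hz⟩ := (hvae.and (ae_restrict_mem measurableSet_upperHalf)).exists
  rw [hs.v_eq_mul hu hz] at hzv
  rw [hs.v_eq_mul hu hx]
  have hfin : ∫⁻ y, bdryWeight a y * poissonKer lam μ z y * u y ^ p ≠ ∞ := by
    intro htop
    rw [htop, ENNReal.mul_top (ptWeight_ne_zero hz)] at hzv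
    exact hzv rfl
  refine ENNReal.mul_ne_top (ptWeight_ne_top hx) ?_
  set K := x.2 ^ lam / z.2 ^ lam * (euclLength (z - x) / x.2 + 1) ^ μ with hK
  have hx0 : 0 < x.2 := hx
  have hz0 : 0 < z.2 := hz
  have hK0 : 0 ≤ K := by
    have := euclLength_nonneg (z - x)
    positivity
  refine ne_top_of_le_ne_top (ENNReal.mul_ne_top (ENNReal.ofReal_ne_top (r := K)) hfin) ?_
  rw [← lintegral_const_mul _ (by fun_prop)]
  refine lintegral_mono fun y => ?_
  calc _ ≤ bdryWeight a y * (ENNReal.ofReal K * poissonKer lam μ z y) * u y ^ p := by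
        gcongr
        rw [poissonKer, poissonKer, ← ENNReal.ofReal_mul hK0]
        exact ENNReal.ofReal_le_ofReal (kerP_le_mul_kerP hμ hx hz y)
    _ = _ := by ring

end Exponents

/-! ### Monotonicity in the norm and rotation invariance -/

section Conclusion

variable {n : ℕ} {a b lam μ p q : ℝ} {u : Bdry n → ℝ≥0∞} {v : Pt n → ℝ≥0∞}

/-- Two points at different distances from the origin are exchanged by the reflection in a
hyperplane that separates the farther one from the origin. -/
theorem exists_bdryReflect_eq {y z : Bdry n} (hyz : ‖y‖ < ‖z‖) :
    ∃ (e : Bdry n) (h : ℝ), ‖e‖ = 1 ∧ 0 < h ∧ z ∈ beyond e h ∧ bdryReflect e h z = y := by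
  have hne : z - y ≠ 0 := by
    intro h0
    rw [sub_eq_zero.1 h0] at hyz
    exact lt_irrefl _ hyz
  set d := ‖z - y‖ with hd
  have hd0 : 0 < d := norm_pos_iff.2 hne
  have hin : inner ℝ z (z - y) = (‖z‖ ^ 2 - ‖y‖ ^ 2 + d ^ 2) / 2 := by
    rw [hd, norm_sub_sq_real, inner_sub_right, real_inner_self_eq_norm_sq]
    ring
  have hin' : inner ℝ z (d⁻¹ • (z - y)) = (‖z‖ ^ 2 - ‖y‖ ^ 2) / (2 * d) + d / 2 := by
    rw [inner_smul_right, hin]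
    field_simp
  -- The perpendicular bisector of `y` and `z`; its offset is positive exactly because `z` has the
  -- larger norm.
  refine ⟨d⁻¹ • (z - y), (‖z‖ ^ 2 - ‖y‖ ^ 2) / (2 * d), ?_, ?_, ?_, ?_⟩
  · rw [norm_smul, norm_inv, Real.norm_of_nonneg hd0.le, inv_mul_cancel₀ hd0.ne']
  · refine div_pos ?_ (by positivity)
    nlinarith [norm_nonneg y]
  · show _ < inner ℝ z (d⁻¹ • (z - y))
    rw [hin']
    linarith
  · rw [bdryReflect, hin', smul_smul]
    have : 2 * ((‖z‖ ^ 2 - ‖y‖ ^ 2) / (2 * d) - ((‖z‖ ^ 2 - ‖y‖ ^ 2) / (2 * d) + d / 2)) * d⁻¹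
        = -1 := by
      field_simp
      ring
    rw [this]
    simp

/-- The reflection inequality for all hyperplanes missing the origin. -/
def ReflectDecreasing (u : Bdry n → ℝ≥0∞) : Prop :=
  ∀ (e : Bdry n) (h : ℝ), ‖e‖ = 1 → 0 < h →
    ∀ᵐ y, y ∈ beyond e h → u y ≤ u (bdryReflect e h y)

theorem IsPositiveSolution.u_le (hs : IsPositiveSolution n a b lam μ p q u v)
    (ha : 0 ≤ a) (hb : 0 ≤ b) (hμ : 0 ≤ μ) (hp : 0 ≤ p) (hq : 0 ≤ q) (hu : Measurable u)
    (hv : Measurable v) (hR : ReflectDecreasing u) {y z : Bdry n} (hyz : ‖y‖ < ‖z‖) :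
    u z ≤ u y := by
  obtain ⟨e, h, he, hh, hz, rfl⟩ := exists_bdryReflect_eq hyz
  exact hs.u_le_bdryReflect he hh ha hb hμ hp hq hu hv (hR e h he hh) hz

/-- An infinite value at `z ≠ 0` would spread, by monotonicity, to the whole ball of radius `‖z‖`,
which is not a null set. -/
theorem IsPositiveSolution.u_ne_top (hn : 2 ≤ n) (hs : IsPositiveSolution n a b lam μ p q u v)
    (ha : 0 ≤ a) (hb : 0 ≤ b) (hμ : 0 ≤ μ) (hp : 0 ≤ p) (hq : 0 ≤ q) (hu : Measurable u)
    (hv : Measurable v) (hR : ReflectDecreasing u) (huae : ∀ᵐ y, u y ≠ ∞) {z : Bdry n}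
    (hz : z ≠ 0) : u z ≠ ∞ := by
  intro htop
  have := nontrivial_bdry hn
  have hsub : Metric.ball (0 : Bdry n) ‖z‖ ⊆ {y | ¬ u y ≠ ∞} := by
    intro y hy
    have h1 := hs.u_le ha hb hμ hp hq hu hv hR (mem_ball_zero_iff.1 hy)
    rw [htop, top_le_iff] at h1
    exact not_not.2 h1
  exact (Metric.measure_ball_pos volume (0 : Bdry n) (norm_pos_iff.2 hz)).ne'
    (measure_mono_null hsub huae)

theorem IsPositiveSolution.u_lt (hn : 2 ≤ n) (hs : IsPositiveSolution n a b lam μ p q u v)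
    (ha : 0 < a) (hb : 0 ≤ b) (hμ : 0 ≤ μ) (hp : 0 ≤ p) (hq : 0 ≤ q) (hu : Measurable u)
    (hv : Measurable v) (hR : ReflectDecreasing u) (huae : ∀ᵐ y, u y ≠ ∞) {y z : Bdry n}
    (hyz : ‖y‖ < ‖z‖) : u z < u y := by
  have hz0 : z ≠ 0 := norm_pos_iff.1 ((norm_nonneg y).trans_lt hyz)
  have hzt := hs.u_ne_top hn ha.le hb hμ hp hq hu hv hR huae hz0
  obtain ⟨e, h, he, hh, hz, rfl⟩ := exists_bdryReflect_eq hyz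
  exact hs.u_lt_bdryReflect he hh ha hb hμ hp hq hu hv (hR e h he hh) hz hzt

theorem IsPositiveSolution.ptWeight_mul_le_of_norm_lt
    (hs : IsPositiveSolution n a b lam μ p q u v) (ha : 0 ≤ a) (hμ : 0 ≤ μ) (hp : 0 ≤ p)
    (hu : Measurable u) (hR : ReflectDecreasing u) {y z : Bdry n} (hyz : ‖y‖ < ‖z‖) {t : ℝ}
    (ht : 0 < t) : ptWeight b ((y, t) : Pt n) * v (z, t) ≤ ptWeight b ((z, t) : Pt n) * v (y, t) := by
  obtain ⟨e, h, he, hh, hz, rfl⟩ := exists_bdryReflect_eq hyz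
  exact hs.ptWeight_mul_le he hh ha hμ hp hu (hR e h he hh) (x := (z, t)) ht hz

theorem IsPositiveSolution.v_lt (hs : IsPositiveSolution n a b lam μ p q u v)
    (ha : 0 ≤ a) (hb : 0 < b) (hμ : 0 ≤ μ) (hp : 0 ≤ p) (hu : Measurable u)
    (hR : ReflectDecreasing u) {y z : Bdry n} (hyz : ‖y‖ < ‖z‖) {t : ℝ} (ht : 0 < t)
    (hvz : v (z, t) ≠ ∞) : v (z, t) < v (y, t) := by
  obtain ⟨e, h, he, hh, hz, rfl⟩ := exists_bdryReflect_eq hyz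
  exact hs.v_lt_ptReflect he hh ha hb hμ hp hu (hR e h he hh) (x := (z, t)) ht hz hvz

/-- For `0 < t ≤ 1` the decay of `v(·, t)` is uniform in `t`. -/
theorem IsPositiveSolution.exists_one_lt_mul_le (hs : IsPositiveSolution n a b lam μ p q u v)
    (ha : 0 ≤ a) (hb : 0 < b) (hμ : 0 ≤ μ) (hp : 0 ≤ p) (hu : Measurable u)
    (hR : ReflectDecreasing u) {y z : Bdry n} (hyz : ‖y‖ < ‖z‖) :
    ∃ κ : ℝ≥0∞, 1 < κ ∧ κ ≠ ∞ ∧ ∀ t : ℝ, 0 < t → t ≤ 1 → κ * v (z, t) ≤ v (y, t) := by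
  -- The smallest value, attained at `t = 1`, of the ratio of squared lengths of `(z, t)` and `(y,
  -- t)` over `0 < t ≤ 1`. A factor independent of `t` is needed for strictness to survive the
  -- boundary limit.
  set r : ℝ := (‖z‖ ^ 2 + 1) / (‖y‖ ^ 2 + 1) with hr
  have hyz2 : ‖y‖ ^ 2 < ‖z‖ ^ 2 := by gcongr
  have hr1 : 1 < r := by
    rw [hr, one_lt_div (by positivity)]
    linarith
  have hr0 : 0 < r := by linarith
  refine ⟨ENNReal.ofReal (√r ^ b), ?_, ENNReal.ofReal_ne_top, fun t ht ht1 => ?_⟩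
  · rw [← ENNReal.ofReal_one, ENNReal.ofReal_lt_ofReal_iff (by positivity)]
    exact Real.one_lt_rpow (Real.lt_sqrt_of_sq_lt (by simpa using hr1)) hb
  · have hzt : (0 : ℝ) < ((z, t) : Pt n).2 := ht
    have hyt : (0 : ℝ) < ((y, t) : Pt n).2 := ht
    have hlz := euclLength_pos hzt
    have hly := euclLength_pos hyt
    have hlen : √r * euclLength ((y, t) : Pt n) ≤ euclLength ((z, t) : Pt n) := by
      rw [euclLength, euclLength, ← Real.sqrt_mul hr0.le]
      refine Real.sqrt_le_sqrt ?_
      show r * (‖y‖ ^ 2 + t ^ 2) ≤ ‖z‖ ^ 2 + t ^ 2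
      rw [hr, div_mul_eq_mul_div, div_le_iff₀ (by positivity)]
      have ht2 : t ^ 2 ≤ 1 := by nlinarith
      nlinarith
    have hw : ENNReal.ofReal (√r ^ b) * ptWeight b ((z, t) : Pt n) ≤
        ptWeight b ((y, t) : Pt n) := by
      rw [ptWeight_eq hzt, ptWeight_eq hyt, ← ENNReal.ofReal_mul (by positivity)]
      refine ENNReal.ofReal_le_ofReal ?_
      calc √r ^ b * euclLength ((z, t) : Pt n) ^ (-b)
          ≤ √r ^ b * (√r * euclLength ((y, t) : Pt n)) ^ (-b) := by
            refine mul_le_mul_of_nonneg_left ?_ (by positivity)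
            exact Real.rpow_le_rpow_of_nonpos (by positivity) hlen (by linarith)
        _ = _ := by
            rw [Real.mul_rpow (by positivity) hly.le, ← mul_assoc,
              ← Real.rpow_add (by positivity), add_neg_cancel, Real.rpow_zero, one_mul]
    refine (ENNReal.mul_le_mul_iff_right (ptWeight_ne_zero (b := b) hzt)
      (ptWeight_ne_top hzt)).1 ?_
    calc ptWeight b ((z, t) : Pt n) * (ENNReal.ofReal (√r ^ b) * v (z, t))
        = ENNReal.ofReal (√r ^ b) * ptWeight b ((z, t) : Pt n) * v (z, t) := by ring
      _ ≤ ptWeight b ((y, t) : Pt n) * v (z, t) := by gcongr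
      _ ≤ _ := hs.ptWeight_mul_le_of_norm_lt ha hμ hp hu hR hyz ht

theorem kerP_linearIsometry (ρ : Bdry n ≃ₗᵢ[ℝ] Bdry n) (x : Pt n) (y : Bdry n) :
    kerP lam μ ((ρ x.1, x.2) : Pt n) (ρ y) = kerP lam μ x y := by
  simp only [kerP, ← map_sub, LinearIsometryEquiv.norm_map]

theorem weightedKer_linearIsometry (ρ : Bdry n ≃ₗᵢ[ℝ] Bdry n) (x : Pt n) (y : Bdry n) :
    weightedKer a b lam μ ((ρ x.1, x.2) : Pt n) (ρ y) = weightedKer a b lam μ x y := by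
  simp only [weightedKer, kerP_linearIsometry, LinearIsometryEquiv.norm_map, euclLength]

theorem IsPositiveSolution.v_linearIsometry (hs : IsPositiveSolution n a b lam μ p q u v)
    (ρ : Bdry n ≃ₗᵢ[ℝ] Bdry n) (hρ : ∀ᵐ y, u (ρ y) = u y) {x : Pt n} (hx : x ∈ upperHalf n) :
    v (ρ x.1, x.2) = v x := by
  rw [hs.v_eq (ρ x.1, x.2) hx, hs.v_eq x hx,
    ← ρ.measurePreserving.lintegral_comp_emb ρ.toHomeomorph.measurableEmbedding]
  refine lintegral_congr_ae ?_
  filter_upwards [hρ] with y hy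
  rw [hy, weightedKer_linearIsometry]

theorem IsPositiveSolution.u_linearIsometry (hs : IsPositiveSolution n a b lam μ p q u v)
    (ρ : Bdry n ≃ₗᵢ[ℝ] Bdry n) (hρ : ∀ᵐ y, u (ρ y) = u y) (y : Bdry n) : u (ρ y) = u y := by
  have hmp : MeasurePreserving (fun x : Pt n => (ρ x.1, x.2)) (volume.restrict (upperHalf n))
      (volume.restrict (upperHalf n)) :=
    (ρ.measurePreserving.prod (MeasurePreserving.id (volume : Measure ℝ))).restrict_preimage
      measurableSet_upperHalf
  have hemb : MeasurableEmbedding (fun x : Pt n => (ρ x.1, x.2)) :=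
    (ρ.toHomeomorph.prodCongr (Homeomorph.refl ℝ)).measurableEmbedding
  rw [hs.u_eq (ρ y), hs.u_eq y, ← hmp.lintegral_comp_emb hemb]
  refine setLIntegral_congr_fun measurableSet_upperHalf fun x hx => ?_
  simp only [hs.v_linearIsometry ρ hρ hx, weightedKer_linearIsometry]

/-- For `s > 1` and `y ≠ 0`, the point `s⁻¹ • y` has smaller norm than both `y` and `ρ y`, so `max
(u (ρ y)) (u y) ≤ u (s⁻¹ • y)`. The integral of the dilated power exceeds the original by the factor
`s` to the dimension. Letting `s → 1` leaves no room for the maximum to exceed `u` on a set of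
positive measure. -/
theorem IsPositiveSolution.ae_linearIsometry (hn : 2 ≤ n)
    (hs : IsPositiveSolution n a b lam μ p q u v) (ha : 0 ≤ a) (hb : 0 ≤ b) (hμ : 0 ≤ μ)
    (hp : 0 ≤ p) (hq : 0 ≤ q) (hu : Measurable u) (hv : Measurable v) (hR : ReflectDecreasing u)
    (hufin : ∫⁻ y, u y ^ (p + 1) ≠ ∞) (ρ : Bdry n ≃ₗᵢ[ℝ] Bdry n) : ∀ᵐ y, u (ρ y) = u y := by
  have := nontrivial_bdry hn
  have key : ∀ ρ : Bdry n ≃ₗᵢ[ℝ] Bdry n, ∀ᵐ y, u (ρ y) ≤ u y := by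
    intro ρ
    have hmeas : Measurable fun y => max (u (ρ y)) (u y) ^ (p + 1) :=
      ((hu.comp ρ.continuous.measurable).max hu).pow_const _
    have hbound : ∀ s : ℝ, 1 < s → ∫⁻ y, max (u (ρ y)) (u y) ^ (p + 1) ≤
        ENNReal.ofReal (s ^ Module.finrank ℝ (Bdry n)) * ∫⁻ y, u y ^ (p + 1) := by
      intro s hs1
      have hs0 : 0 < s := by linarith
      have hmap := Measure.map_addHaar_smul (volume : Measure (Bdry n)) (inv_ne_zero hs0.ne')
      have e1 : ∫⁻ y, u (s⁻¹ • y) ^ (p + 1) =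
          ENNReal.ofReal (s ^ Module.finrank ℝ (Bdry n)) * ∫⁻ y, u y ^ (p + 1) := by
        rw [← lintegral_map (μ := volume) (f := fun y => u y ^ (p + 1)) (hu.pow_const _)
          (measurable_const_smul s⁻¹), hmap, lintegral_smul_measure, inv_pow, inv_inv,
          abs_of_pos (by positivity), smul_eq_mul]
      rw [← e1]
      refine lintegral_mono_ae ?_
      filter_upwards [Measure.ae_ne volume (0 : Bdry n)] with y hy
      have hlt : ‖s⁻¹ • y‖ < ‖y‖ := by
        rw [norm_smul, norm_inv, Real.norm_of_nonneg hs0.le]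
        exact mul_lt_of_lt_one_left (norm_pos_iff.2 hy) (inv_lt_one_of_one_lt₀ hs1)
      refine ENNReal.rpow_le_rpow (max_le ?_ ?_) (by linarith)
      · exact hs.u_le ha hb hμ hp hq hu hv hR (by rwa [LinearIsometryEquiv.norm_map])
      · exact hs.u_le ha hb hμ hp hq hu hv hR hlt
    have hle : ∫⁻ y, max (u (ρ y)) (u y) ^ (p + 1) ≤ ∫⁻ y, u y ^ (p + 1) := by
      have hlim : Tendsto (fun s : ℝ => ENNReal.ofReal (s ^ Module.finrank ℝ (Bdry n)) *
          ∫⁻ y, u y ^ (p + 1)) (𝓝[>] 1) (𝓝 (∫⁻ y, u y ^ (p + 1))) := by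
        have h1 : Tendsto (fun s : ℝ => ENNReal.ofReal (s ^ Module.finrank ℝ (Bdry n))) (𝓝[>] 1)
            (𝓝 1) := by
          have h2 : Continuous fun s : ℝ => ENNReal.ofReal (s ^ Module.finrank ℝ (Bdry n)) :=
            ENNReal.continuous_ofReal.comp (continuous_pow _)
          have h3 := (h2.tendsto 1).mono_left (nhdsWithin_le_nhds (s := Set.Ioi 1))
          simpa using h3
        simpa using ENNReal.Tendsto.mul_const h1 (Or.inl one_ne_zero)
      refine ge_of_tendsto hlim ?_
      filter_upwards [self_mem_nhdsWithin] with s hs1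
      exact hbound s hs1
    have heq := ae_eq_of_ae_le_of_lintegral_le (μ := (volume : Measure (Bdry n)))
      (f := fun y => u y ^ (p + 1)) (g := fun y => max (u (ρ y)) (u y) ^ (p + 1))
      (Eventually.of_forall fun y => ENNReal.rpow_le_rpow (le_max_right _ _) (by linarith))
      hufin hmeas.aemeasurable hle
    filter_upwards [heq] with y hy
    have h1 : u y = max (u (ρ y)) (u y) :=
      ENNReal.rpow_left_injective (by linarith : p + 1 ≠ 0) hy
    rw [h1]
    exact le_max_left _ _
  filter_upwards [key ρ, ρ.measurePreserving.quasiMeasurePreserving.ae (key ρ.symm)] with y h1 h2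
  rw [LinearIsometryEquiv.symm_apply_apply] at h2
  exact le_antisymm h1 h2

end Conclusion

/-! ### Symmetry of solutions, boundary traces and measurability -/

section Symmetry

variable {n : ℕ} {a b lam μ p q : ℝ} {u : Bdry n → ℝ≥0∞} {v w : Pt n → ℝ≥0∞}

/-- Two vectors of equal norm are exchanged by the reflection in their bisector through the origin.
-/
theorem RadialAbout.of_linearIsometry {f : Bdry n → ℝ≥0∞}
    (hf : ∀ (ρ : Bdry n ≃ₗᵢ[ℝ] Bdry n) y, f (ρ y) = f y) : RadialAbout 0 f := by
  intro y z hyz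
  rw [sub_zero, sub_zero] at hyz
  rw [← Submodule.reflection_sub hyz, hf]

theorem DecreasingAbout.of_norm_lt {f : Bdry n → ℝ≥0∞}
    (hf : ∀ y z, ‖y‖ < ‖z‖ → f z < f y) : DecreasingAbout 0 f := by
  intro y z hyz
  rw [sub_zero, sub_zero] at hyz
  exact hf y z hyz

theorem WeaklyDecreasingAbout.of_mul_le {f : Bdry n → ℝ≥0∞}
    (hf : ∀ y z, ‖y‖ < ‖z‖ → ∃ κ : ℝ≥0∞, 1 < κ ∧ κ * f z ≤ f y) : WeaklyDecreasingAbout 0 f := by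
  intro y z hyz
  rw [sub_zero, sub_zero] at hyz
  obtain ⟨κ, hκ, hle⟩ := hf y z hyz
  refine ⟨(le_mul_of_one_le_left' hκ.le).trans hle, fun h0 htop => lt_of_lt_of_le ?_ hle⟩
  calc f z = 1 * f z := (one_mul _).symm
    _ < κ * f z := by rwa [ENNReal.mul_lt_mul_iff_left h0 htop]

theorem lowerTrace_congr (h : ∀ x ∈ upperHalf n, v x = w x) : lowerTrace v = lowerTrace w := by
  funext y
  refine liminf_congr ?_
  filter_upwards [self_mem_nhdsWithin] with t ht
  exact h (y, t) ht

theorem upperTrace_congr (h : ∀ x ∈ upperHalf n, v x = w x) : upperTrace v = upperTrace w := by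
  funext y
  refine limsup_congr ?_
  filter_upwards [self_mem_nhdsWithin] with t ht
  exact h (y, t) ht

theorem slice_congr (h : ∀ x ∈ upperHalf n, v x = w x) {t : ℝ} (ht : 0 < t) :
    slice v t = slice w t :=
  funext fun y => h (y, t) ht

theorem lowerTrace_mul_le {κ : ℝ≥0∞} (hκ : κ ≠ ∞) {y z : Bdry n}
    (h : ∀ t : ℝ, 0 < t → t ≤ 1 → κ * v (z, t) ≤ v (y, t)) :
    κ * lowerTrace v z ≤ lowerTrace v y := by
  rw [lowerTrace, ← ENNReal.liminf_const_mul_of_ne_top hκ]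
  refine liminf_le_liminf ?_
  filter_upwards [Ioc_mem_nhdsGT (zero_lt_one' ℝ)] with t ht
  exact h t ht.1 ht.2

theorem upperTrace_mul_le {κ : ℝ≥0∞} (hκ : κ ≠ ∞) {y z : Bdry n}
    (h : ∀ t : ℝ, 0 < t → t ≤ 1 → κ * v (z, t) ≤ v (y, t)) :
    κ * upperTrace v z ≤ upperTrace v y := by
  rw [upperTrace, ← ENNReal.limsup_const_mul_of_ne_top hκ]
  refine limsup_le_limsup ?_
  filter_upwards [Ioc_mem_nhdsGT (zero_lt_one' ℝ)] with t ht
  exact h t ht.1 ht.2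

theorem IsPositiveSolution.reflectDecreasing (hn : 2 ≤ n)
    (hs : IsPositiveSolution n a b lam μ p q u v) (ha : 0 < a) (hb : 0 < b) (hlam : 0 ≤ lam)
    (hμ : 0 < μ) (hp : 0 < p) (hq : 0 < q)
    (hcrit : n / (q + 1) + (n - 1) / (p + 1) = a + b + μ - lam)
    (hu : Measurable u) (hv : Measurable v) (hufin : ∫⁻ y, u y ^ (p + 1) ≠ ∞)
    (hvfin : ∫⁻ x in upperHalf n, v x ^ (q + 1) ≠ ∞) : ReflectDecreasing u :=
  fun _ _ he hh => hs.ae_le_bdryReflect ha hb.le hμ.le hp hq hu hv hufin hvfin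
    (fun hpq => exists_weighted_hls hn hμ hlam hp hq hpq.le (hs.lt_div hn hμ.le hp hq.le hv hufin)
      (hs.div_lt hn hμ.le hp hq.le hv hufin) hcrit (by linarith)) he hh

theorem IsPositiveSolution.symmetric_of_measurable (hn : 2 ≤ n)
    (hs : IsPositiveSolution n a b lam μ p q u v) (ha : 0 < a) (hb : 0 < b) (hlam : 0 ≤ lam)
    (hμ : 0 < μ) (hp : 0 < p) (hq : 0 < q)
    (hcrit : n / (q + 1) + (n - 1) / (p + 1) = a + b + μ - lam)
    (hu : Measurable u) (hv : Measurable v) (hufin : ∫⁻ y, u y ^ (p + 1) ≠ ∞)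
    (hvfin : ∫⁻ x in upperHalf n, v x ^ (q + 1) ≠ ∞) :
    (RadialAbout 0 u ∧ DecreasingAbout 0 u) ∧
    (∀ t : ℝ, 0 < t → RadialAbout 0 (slice v t) ∧ DecreasingAbout 0 (slice v t)) ∧
    (RadialAbout 0 (lowerTrace v) ∧ WeaklyDecreasingAbout 0 (lowerTrace v)) ∧
    (RadialAbout 0 (upperTrace v) ∧ WeaklyDecreasingAbout 0 (upperTrace v)) := by
  have hR := hs.reflectDecreasing hn ha hb hlam hμ hp hq hcrit hu hv hufin hvfin
  have huae : ∀ᵐ y, u y ≠ ∞ := ENNReal.ae_ne_top_of_lintegral_rpow hu (by linarith) hufin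
  have hinv := hs.ae_linearIsometry hn ha.le hb.le hμ.le hp.le hq.le hu hv hR hufin
  have hslice : ∀ (ρ : Bdry n ≃ₗᵢ[ℝ] Bdry n) (y : Bdry n) (t : ℝ), 0 < t →
      v (ρ y, t) = v (y, t) :=
    fun ρ y t ht => hs.v_linearIsometry ρ (hinv ρ) (x := (y, t)) ht
  refine ⟨⟨.of_linearIsometry fun ρ => hs.u_linearIsometry ρ (hinv ρ), .of_norm_lt fun y z hyz =>
      hs.u_lt hn ha hb.le hμ.le hp.le hq.le hu hv hR huae hyz⟩, fun t ht =>
    ⟨.of_linearIsometry fun ρ y => hslice ρ y t ht, .of_norm_lt fun y z hyz =>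
      hs.v_lt ha.le hb hμ.le hp.le hu hR hyz ht (hs.v_ne_top hμ.le hq hu hv hvfin ht)⟩,
    ⟨.of_linearIsometry fun ρ y => ?_, .of_mul_le fun y z hyz => ?_⟩,
    ⟨.of_linearIsometry fun ρ y => ?_, .of_mul_le fun y z hyz => ?_⟩⟩
  · refine liminf_congr ?_
    filter_upwards [self_mem_nhdsWithin] with t ht
    exact hslice ρ y t ht
  · obtain ⟨κ, h1, h2, h3⟩ := hs.exists_one_lt_mul_le ha.le hb hμ.le hp.le hu hR hyz
    exact ⟨κ, h1, lowerTrace_mul_le h2 h3⟩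
  · refine limsup_congr ?_
    filter_upwards [self_mem_nhdsWithin] with t ht
    exact hslice ρ y t ht
  · obtain ⟨κ, h1, h2, h3⟩ := hs.exists_one_lt_mul_le ha.le hb hμ.le hp.le hu hR hyz
    exact ⟨κ, h1, upperTrace_mul_le h2 h3⟩

/-- The equation gives `u` at every point as a parameter integral in which a measurable version of
`v` may be used, so `u` is measurable, not just almost everywhere equal to a measurable function. -/
theorem IsPositiveSolution.measurable_u (hs : IsPositiveSolution n a b lam μ p q u v)
    (hv : AEMeasurable v (volume.restrict (upperHalf n))) : Measurable u := by
  have hu : u = fun y => ∫⁻ x in upperHalf n, weightedKer a b lam μ x y * hv.mk v x ^ q := by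
    funext y
    rw [hs.u_eq y]
    refine lintegral_congr_ae ?_
    filter_upwards [hv.ae_eq_mk] with x hx
    rw [hx]
  rw [hu]
  exact Measurable.lintegral_prod_left' (f := fun z : Pt n × Bdry n =>
    weightedKer a b lam μ z.1 z.2 * hv.mk v z.1 ^ q)
    ((measurable_weightedKer a b lam μ).mul ((hv.measurable_mk.comp measurable_fst).pow_const q))

/-- The values of `v` outside the half space can be changed to make `v` measurable. -/
theorem IsPositiveSolution.exists_measurable (hs : IsPositiveSolution n a b lam μ p q u v)
    (hu : Measurable u) : ∃ w : Pt n → ℝ≥0∞, Measurable w ∧ (∀ x ∈ upperHalf n, v x = w x) ∧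
      IsPositiveSolution n a b lam μ p q u w := by
  refine ⟨fun x => ∫⁻ y, weightedKer a b lam μ x y * u y ^ p, ?_, hs.v_eq, hs.u_pos,
    fun x hx => ?_, fun y => ?_, fun x _ => rfl⟩
  · exact Measurable.lintegral_prod_right' (f := fun z : Pt n × Bdry n =>
      weightedKer a b lam μ z.1 z.2 * u z.2 ^ p)
      ((measurable_weightedKer a b lam μ).mul ((hu.comp measurable_snd).pow_const p))
  · rw [← hs.v_eq x hx]
    exact hs.v_pos x hx
  · rw [hs.u_eq y]
    exact setLIntegral_congr_fun measurableSet_upperHalf fun x hx => by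
      simp only [hs.v_eq x hx]

theorem MeasureTheory.MemLp.lintegral_rpow_ne_top {X : Type*} [MeasurableSpace X] {ν : Measure X}
    {f : X → ℝ≥0∞} {s : ℝ} (hs : 0 < s) (hf : MemLp f (ENNReal.ofReal s) ν) :
    ∫⁻ x, f x ^ s ∂ν ≠ ∞ := by
  have h := (eLpNorm_lt_top_iff_lintegral_rpow_enorm_lt_top (ENNReal.ofReal_pos.2 hs).ne'
    ENNReal.ofReal_ne_top).1 hf.2
  simp only [ENNReal.toReal_ofReal hs.le, enorm_eq_self] at h
  exact h.ne

end Symmetry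

theorem theorem1p5 (n : ℕ) (hn : 2 ≤ n) (α β lam μ p₀ q₀ : ℝ)
    (hα : 0 < α) (hαn : α < n) (hβ : 0 < β) (hβn : β < n)
    (hlam : 0 ≤ lam) (hμ : 0 < μ) (hμn : μ < n - 2 * lam)
    (hp₀ : 0 < p₀) (hq₀ : 0 < q₀)
    (hcrit : ((n : ℝ) - 1) / n * (1 / (p₀ + 1)) + 1 / (q₀ + 1) = (α + β + μ - lam) / n)
    (u : Bdry n → ℝ≥0∞) (v : Pt n → ℝ≥0∞)
    (hu : MemLp u (ENNReal.ofReal (p₀ + 1)) volume)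
    (hv : MemLp v (ENNReal.ofReal (q₀ + 1)) (volume.restrict (upperHalf n)))
    (hsol : IsPositiveSolution n α β lam μ p₀ q₀ u v) :
    ∃ y₀ : Bdry n,
      (RadialAbout y₀ u ∧ DecreasingAbout y₀ u) ∧
      (∀ t : ℝ, 0 < t → RadialAbout y₀ (slice v t) ∧ DecreasingAbout y₀ (slice v t)) ∧
      (RadialAbout y₀ (lowerTrace v) ∧ WeaklyDecreasingAbout y₀ (lowerTrace v)) ∧
      (RadialAbout y₀ (upperTrace v) ∧ WeaklyDecreasingAbout y₀ (upperTrace v)) := by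
  have hum := hsol.measurable_u hv.1.aemeasurable
  obtain ⟨w, hwm, hvw, hw⟩ := hsol.exists_measurable hum
  have hn0 : (0 : ℝ) < n := by exact_mod_cast (by omega : 0 < n)
  have hcrit' : (n : ℝ) / (q₀ + 1) + (n - 1) / (p₀ + 1) = α + β + μ - lam := by
    rw [eq_div_iff hn0.ne'] at hcrit
    rw [← hcrit]
    field_simp
    ring
  have hwfin : ∫⁻ x in upperHalf n, w x ^ (q₀ + 1) ≠ ∞ := by
    rw [← setLIntegral_congr_fun measurableSet_upperHalf fun x hx => by
      show v x ^ (q₀ + 1) = w x ^ (q₀ + 1); rw [hvw x hx]]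
    exact hv.lintegral_rpow_ne_top (by linarith)
  obtain ⟨h1, h2, h3⟩ := hw.symmetric_of_measurable hn hα hβ hlam hμ hp₀ hq₀ hcrit' hum hwm
    (hu.lintegral_rpow_ne_top (by linarith)) hwfin
  -- The centre is the origin, singled out by the weights.
  refine ⟨0, h1, fun t ht => ?_, ?_⟩
  · rw [slice_congr hvw ht]
    exact h2 t ht
  · rwa [lowerTrace_congr hvw, upperTrace_congr hvw]
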